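/- Let $\mathbb K=\mathbb R$ or $\mathbb C$; "smooth" means $C^\infty$ if $\mathbb K=\mathbb R$ and holomorphic if $\mathbb K=\mathbb C$. A surface in $\mathbb P^3(\mathbb K)$ given by a lift $F:V\to\mathbb K^4$ is called a quadric if its image is contained in the zero locus of a nondegenerate quadratic form on $\mathbb K^4$. For $\alpha,\beta_1,\beta_2,\gamma_1,\gamma_2\in\mathbb K$ let $S_{F_2}$ be a surface $(x,y)\mapsto[F_0:F_1:F_2:F_3]$, where $F_0,\dots,F_3$ are smooth, linearly independent solutions, on a connected nonempty open subset $V$ of $\{xy(1-x)(1-y)(1-x-y)\neq0\}\subset\mathbb K^2$, of $$x(1-x)F_{xx}-xyF_{xy}+(\gamma_1-(\alpha+\beta_1+1)x)F_x-\beta_1yF_y-\alpha\beta_1F=0,$$ $$y(1-y)F_{yy}-xyF_{xy}+(\gamma_2-(\alpha+\beta_2+1)y)F_y-\beta_2xF_x-\alpha\beta_2F=0.$$ For $\alpha,\beta,\gamma_1,\gamma_2\in\mathbb K$ let $S_{F_4}$ be defined in the same way by smooth, linearly independent solutions, on a connected nonempty open subset $V$ of $\{xy((1-x-y)^2-4xy)\ne0\}$,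 of $$x(x+y-1)F_{xx}+2xyF_{xy}+((\alpha+\beta+1)x+\gamma_1(y-1))F_x+y(\alpha+\beta-\gamma_2+1)F_y+\alpha\beta F=0,$$ $$y(x+y-1)F_{yy}+2xyF_{xy}+x(\alpha+\beta-\gamma_1+1)F_x+((\alpha+\beta+1)y+\gamma_2(x-1))F_y+\alpha\beta F=0.$$ Introduce coordinates $(s,t)$ on $S_{F_2}$ by $(x,y)=\left(\frac1s,1-\frac ts\right)$ and on $S_{F_4}$ by $(x,y)=\left(\frac1{(s+t)^2},\frac{(s-t)^2}{(s+t)^2}\right)$. Let $S=S_{F_2}$ or $S=S_{F_4}$, let $U$ be a connected nonempty open set of the $(s,t)$-plane that is mapped into $V$, let $f$ be a nowhere vanishing smooth function on $U$, and let $z(s,t)=f(s,t)\,F(x(s,t),y(s,t))$. Then: 1. $S_{F_2}$ is a quadric if and only if $\alpha=\beta_1+\beta_2-\tfrac12$, $\gamma_1=2\beta_1$ and $\gamma_2=2\beta_2$. $S_{F_4}$ is a quadric if and only if $\gamma_2=\alpha+\beta-\gamma_1+1$. 2. The coordinates $(s,t)$ are conjugate: $z,z_s,z_t,z_{ss}$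 are linearly independent at every point of $U$ and there are (necessarily unique) smooth functions $a,b,c,q,m,n,r$ on $U$, $q$ nowhere zero, with $$z_{st}+az_s+bz_t+cz=0,\qquad z_{tt}+qz_{ss}+mz_s+nz_t+rz=0 .$$ 3. Let $\mathsf h=ab+a_s-c$ and $\mathsf k=ab+b_t-c$ be the Laplace invariants, and let $S^+$ and $S^-$ be given by the Laplace transforms $z^+=z_t+az$ and $z^-=z_s+bz$. If both focal surfaces $S,S^+$ of the congruence $\mathbf L^+=\{S,S^+\}$ are quadrics, then $\mathsf h\equiv0$ on $U$. If both focal surfaces $S,S^-$ of the congruence $\mathbf L^-=\{S,S^-\}$ are quadrics, then $\mathsf k\equiv0$ on $U$. -/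

import Mathlib

open scoped ContDiff

namespace HypergeometricCongruence

section

variable {𝕜 : Type*} [RCLike 𝕜] {E : Type*} [NormedAddCommGroup E] [NormedSpace 𝕜 E]

/-- Partial derivative with respect to the first coordinate. -/
noncomputable def pd₁ (f : 𝕜 × 𝕜 → E) (p : 𝕜 × 𝕜) : E := fderiv 𝕜 f p (1, 0)

/-- Partial derivative with respect to the second coordinate. -/
noncomputable def pd₂ (f : 𝕜 × 𝕜 → E) (p : 𝕜 × 𝕜) : E := fderiv 𝕜 f p (0, 1)

/-- The linear system annihilating Appell's `F₂`, for a function `F` of `p = (x, y)` (scalar, or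
vector valued: then each component is a solution). -/
def SolvesAppellF₂ (α β₁ β₂ γ₁ γ₂ : 𝕜) (V : Set (𝕜 × 𝕜)) (F : 𝕜 × 𝕜 → E) : Prop :=
  ∀ p ∈ V,
    (p.1 * (1 - p.1)) • pd₁ (pd₁ F) p - (p.1 * p.2) • pd₂ (pd₁ F) p
        + (γ₁ - (α + β₁ + 1) * p.1) • pd₁ F p - (β₁ * p.2) • pd₂ F p - (α * β₁) • F p = 0 ∧
    (p.2 * (1 - p.2)) • pd₂ (pd₂ F) p - (p.1 * p.2) • pd₂ (pd₁ F) p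
        + (γ₂ - (α + β₂ + 1) * p.2) • pd₂ F p - (β₂ * p.1) • pd₁ F p - (α * β₂) • F p = 0

/-- The linear system annihilating Appell's `F₄`, for a function `F` of `p = (x, y)`. -/
def SolvesAppellF₄ (α β γ₁ γ₂ : 𝕜) (V : Set (𝕜 × 𝕜)) (F : 𝕜 × 𝕜 → E) : Prop :=
  ∀ p ∈ V,
    (p.1 * (p.1 + p.2 - 1)) • pd₁ (pd₁ F) p + (2 * p.1 * p.2) • pd₂ (pd₁ F) p
        + ((α + β + 1) * p.1 + γ₁ * (p.2 - 1)) • pd₁ F p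
        + (p.2 * (α + β - γ₂ + 1)) • pd₂ F p + (α * β) • F p = 0 ∧
    (p.2 * (p.1 + p.2 - 1)) • pd₂ (pd₂ F) p + (2 * p.1 * p.2) • pd₂ (pd₁ F) p
        + (p.1 * (α + β - γ₁ + 1)) • pd₁ F p
        + ((α + β + 1) * p.2 + γ₂ * (p.1 - 1)) • pd₂ F p + (α * β) • F p = 0

/-- The complement of the singular locus `x y (1 - x) (1 - y) (1 - x - y) = 0` of the
`F₂` system. -/
def regularF₂ (𝕜 : Type*) [RCLike 𝕜] : Set (𝕜 × 𝕜) :=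
  {p | p.1 ≠ 0 ∧ p.2 ≠ 0 ∧ 1 - p.1 ≠ 0 ∧ 1 - p.2 ≠ 0 ∧ 1 - p.1 - p.2 ≠ 0}

/-- The complement of the singular locus `x y ((1 - x - y)² - 4 x y) = 0` of the `F₄` system. -/
def regularF₄ (𝕜 : Type*) [RCLike 𝕜] : Set (𝕜 × 𝕜) :=
  {p | p.1 ≠ 0 ∧ p.2 ≠ 0 ∧ (1 - p.1 - p.2) ^ 2 - 4 * p.1 * p.2 ≠ 0}

/-- `F : V → 𝕜⁴` is the local lift of an immersion `p ↦ [F₀ : F₁ : F₂ : F₃]` defined by a rank-4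
linear system: the domain is a connected open set avoiding the singular locus, and the four
components are smooth (`C^∞` if `𝕜 = ℝ`, holomorphic if `𝕜 = ℂ`) and linearly independent as
functions on `V`. -/
structure IsLocalLift (reg V : Set (𝕜 × 𝕜)) (F : 𝕜 × 𝕜 → (Fin 4 → 𝕜)) : Prop where
  isOpen : IsOpen V
  isConnected : IsConnected V
  subset_regular : V ⊆ reg
  smooth : ContDiffOn 𝕜 ∞ F V
  independent : LinearIndependent 𝕜 (fun (i : Fin 4) (p : V) => F p i)

/-- `F : V → 𝕜⁴` parametrizes (a piece of) the surface `S_{F₂} ⊂ ℙ³`: its components are four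
linearly independent local solutions of the `F₂` system. -/
def IsSurfaceF₂ (α β₁ β₂ γ₁ γ₂ : 𝕜) (V : Set (𝕜 × 𝕜)) (F : 𝕜 × 𝕜 → (Fin 4 → 𝕜)) : Prop :=
  IsLocalLift (regularF₂ 𝕜) V F ∧ SolvesAppellF₂ α β₁ β₂ γ₁ γ₂ V F

/-- `F : V → 𝕜⁴` parametrizes (a piece of) the surface `S_{F₄} ⊂ ℙ³`. -/
def IsSurfaceF₄ (α β γ₁ γ₂ : 𝕜) (V : Set (𝕜 × 𝕜)) (F : 𝕜 × 𝕜 → (Fin 4 → 𝕜)) : Prop :=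
  IsLocalLift (regularF₄ 𝕜) V F ∧ SolvesAppellF₄ α β γ₁ γ₂ V F

/-- The image of `[z] : U → ℙ³` is contained in a quadric surface, the zero locus of a
nondegenerate quadratic form `X ↦ Xᵀ M X`. -/
def IsQuadricOn (U : Set (𝕜 × 𝕜)) (z : 𝕜 × 𝕜 → (Fin 4 → 𝕜)) : Prop :=
  ∃ M : Matrix (Fin 4) (Fin 4) 𝕜, M.IsSymm ∧ M.det ≠ 0 ∧
    ∀ p ∈ U, z p ⬝ᵥ M.mulVec (z p) = 0

/-- The map `T₂`, `(x, y) = (1/s, 1 - t/s)`, giving conjugate coordinates `(s, t)` on `S_{F₂}`. -/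
noncomputable def T₂ (p : 𝕜 × 𝕜) : 𝕜 × 𝕜 := (1 / p.1, 1 - p.2 / p.1)

/-- The map `T₄`, `(x, y) = (1/(s+t)², (s-t)²/(s+t)²)`, giving conjugate coordinates `(s, t)`
on `S_{F₄}`. -/
noncomputable def T₄ (p : 𝕜 × 𝕜) : 𝕜 × 𝕜 :=
  (1 / (p.1 + p.2) ^ 2, (p.1 - p.2) ^ 2 / (p.1 + p.2) ^ 2)

/-- Coefficient functions of a rank-4 system in conjugate coordinates. -/
structure ConjugateCoeffs (𝕜 : Type*) where
  (a b c q m n r : 𝕜 × 𝕜 → 𝕜)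

/-- The lift `z` satisfies on `U` the rank-4 conjugate system
`z_st + a z_s + b z_t + c z = 0`, `z_tt + q z_ss + m z_s + n z_t + r z = 0` with smooth
coefficients, frame `(z, z_s, z_t, z_ss)`, and nondegenerate second fundamental form
`ds² - q dt²`. The coefficients are determined by `z` because of the frame condition. -/
structure IsConjugateSystem (U : Set (𝕜 × 𝕜)) (z : 𝕜 × 𝕜 → (Fin 4 → 𝕜))
    (C : ConjugateCoeffs 𝕜) : Prop where
  smooth_a : ContDiffOn 𝕜 ∞ C.a U
  smooth_b : ContDiffOn 𝕜 ∞ C.b U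
  smooth_c : ContDiffOn 𝕜 ∞ C.c U
  smooth_q : ContDiffOn 𝕜 ∞ C.q U
  smooth_m : ContDiffOn 𝕜 ∞ C.m U
  smooth_n : ContDiffOn 𝕜 ∞ C.n U
  smooth_r : ContDiffOn 𝕜 ∞ C.r U
  q_ne_zero : ∀ p ∈ U, C.q p ≠ 0
  frame : ∀ p ∈ U, LinearIndependent 𝕜 ![z p, pd₁ z p, pd₂ z p, pd₁ (pd₁ z) p]
  hyperbolic : ∀ p ∈ U,
    pd₂ (pd₁ z) p + C.a p • pd₁ z p + C.b p • pd₂ z p + C.c p • z p = 0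
  second : ∀ p ∈ U,
    pd₂ (pd₂ z) p + C.q p • pd₁ (pd₁ z) p + C.m p • pd₁ z p + C.n p • pd₂ z p + C.r p • z p = 0

/-- The positive Laplace invariant `h = a b + a_s - c`. -/
noncomputable def ConjugateCoeffs.h (C : ConjugateCoeffs 𝕜) (p : 𝕜 × 𝕜) : 𝕜 :=
  C.a p * C.b p + pd₁ C.a p - C.c p

/-- The negative Laplace invariant `k = a b + b_t - c`. -/
noncomputable def ConjugateCoeffs.k (C : ConjugateCoeffs 𝕜) (p : 𝕜 × 𝕜) : 𝕜 :=
  C.a p * C.b p + pd₂ C.b p - C.c p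

/-- The positive Laplace transform `z⁺ = z_t + a z`, the second focal surface of the congruence of
tangent lines to the `t`-curves of the surface `z`. -/
noncomputable def laplacePos (C : ConjugateCoeffs 𝕜) (z : 𝕜 × 𝕜 → (Fin 4 → 𝕜)) (p : 𝕜 × 𝕜) :
    Fin 4 → 𝕜 :=
  pd₂ z p + C.a p • z p

/-- The negative Laplace transform `z⁻ = z_s + b z`, the second focal surface of the congruence of
tangent lines to the `s`-curves of the surface `z`. -/
noncomputable def laplaceNeg (C : ConjugateCoeffs 𝕜) (z : 𝕜 × 𝕜 → (Fin 4 → 𝕜)) (p : 𝕜 × 𝕜) :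
    Fin 4 → 𝕜 :=
  pd₁ z p + C.b p • z p

/-- Both focal surfaces `S`, `S⁺` of the positive Laplace congruence are quadrics. -/
def PosFocalQuadrics (U : Set (𝕜 × 𝕜)) (z : 𝕜 × 𝕜 → (Fin 4 → 𝕜)) (C : ConjugateCoeffs 𝕜) : Prop :=
  IsQuadricOn U z ∧ IsQuadricOn U (laplacePos C z)

/-- Both focal surfaces `S`, `S⁻` of the negative Laplace congruence are quadrics. -/
def NegFocalQuadrics (U : Set (𝕜 × 𝕜)) (z : 𝕜 × 𝕜 → (Fin 4 → 𝕜)) (C : ConjugateCoeffs 𝕜) : Prop :=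
  IsQuadricOn U z ∧ IsQuadricOn U (laplaceNeg C z)

/-- `z` is a lift on `U`, in the coordinates `(s, t)` given by `T`, of the surface with lift `F`
on `V`; the nonvanishing factor `f` is a projective gauge transformation. -/
structure IsGaugedPullback (T : 𝕜 × 𝕜 → 𝕜 × 𝕜) (V : Set (𝕜 × 𝕜)) (F : 𝕜 × 𝕜 → (Fin 4 → 𝕜))
    (U : Set (𝕜 × 𝕜)) (z : 𝕜 × 𝕜 → (Fin 4 → 𝕜)) : Prop where
  isOpen : IsOpen U
  isConnected : IsConnected U
  mapsTo : Set.MapsTo T U V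
  gauge : ∃ f : 𝕜 × 𝕜 → 𝕜, ContDiffOn 𝕜 ∞ f U ∧ (∀ p ∈ U, f p ≠ 0) ∧
    ∀ p ∈ U, z p = f p • F (T p)

end

end HypergeometricCongruence

open HypergeometricCongruence

/-!
On either surface the lift and three suitable vectors solve a total (Pfaffian) linear system of
rank 4. By unique continuation linear independence of the components of the lift makes these four
vectors a basis at every point, which gives the conjugate coordinates. If `N` is a symmetric
nondegenerate matrix with `N₀₀ = 0` satisfying `dN = P N + N Pᵀ + ω N`, where `P` is the
coefficient of the system and `ω` a scalar form, then the constant quadratic form whose Gram matrix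
on the frame agrees with `N` at one point has Gram matrix proportional to `N` everywhere, so it
vanishes on the surface: such an `N` exists under the stated conditions on the parameters.

For the converse, let `⟨·, ·⟩` be a form vanishing on the lift. For `F₄`, differentiating
`⟨F, F⟩ = 0` three times gives `(γ₁ + γ₂ - 1 - α - β) ⟨F, T⟩ = 0` with `T` transversal, and
`⟨F, T⟩ ≠ 0`. For `F₂`, in the conjugate coordinates, the derivatives of `⟨z, z⟩ = 0` determine
`d log ⟨z_s, z_s⟩`. As the second fundamental form `ds² - q dt²` satisfies `(log q)_st = 0`, this
gives `a_s = b_t` and `2 m = 4 b q + q_s`, two identities that determine the parameters.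

Let `S` and `S⁺` be quadrics and `h ≠ 0` at some point. Near it, comparing the mixed second
derivatives of `log ⟨z, z⟩` for the form of `S⁺` gives `(log h)_st = 0`. Since `h` is invariant
under gauge transformations, it can be computed for one lift: it is `κ / (s - t)²` for `F₂` and
`κ / (s + t)² + ρ / (s - t)²` for `F₄`, with constants `κ`, `ρ`. For such a function
`h h_st = h_s h_t` forces `κ = ρ = 0`. The case of `k` follows by exchanging `s` and `t`.
-/

namespace HypergeometricCongruence

section Calculus

variable {𝕜 : Type*} [RCLike 𝕜] {E : Type*} [NormedAddCommGroup E] [NormedSpace 𝕜 E]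
  {G : Type*} [NormedAddCommGroup G] [NormedSpace 𝕜 G]
  {H : Type*} [NormedAddCommGroup H] [NormedSpace 𝕜 H]

/-- The derivative of `f` in the direction `v`; by definition `pd₁` and `pd₂` are the cases
`v = (1, 0)` and `v = (0, 1)`. -/
noncomputable def dirDeriv (v : 𝕜 × 𝕜) (f : 𝕜 × 𝕜 → E) (p : 𝕜 × 𝕜) : E := fderiv 𝕜 f p v

/-- `f` is differentiable at `p` with derivatives `fv` and `fw` in the directions `v` and `w`.
Arbitrary directions make statements about conjugate nets symmetric in the two coordinates. -/
structure HasDirDerivs (v w : 𝕜 × 𝕜) (f : 𝕜 × 𝕜 → E) (p : 𝕜 × 𝕜) (fv fw : E) : Prop where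
  differentiableAt : DifferentiableAt 𝕜 f p
  fst : dirDeriv v f p = fv
  snd : dirDeriv w f p = fw

/-- `f` is differentiable at `p` with partial derivatives `f₁` and `f₂`. -/
abbrev HasPartials (f : 𝕜 × 𝕜 → E) (p : 𝕜 × 𝕜) (f₁ f₂ : E) : Prop :=
  HasDirDerivs (1, 0) (0, 1) f p f₁ f₂

variable {v w p : 𝕜 × 𝕜} {f g : 𝕜 × 𝕜 → E} {fv fw gv gw : E} {φ ψ : 𝕜 × 𝕜 → 𝕜} {φv φw ψv ψw : 𝕜}
  {U : Set (𝕜 × 𝕜)}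

namespace HasDirDerivs

theorem of_hasFDerivAt {L : 𝕜 × 𝕜 →L[𝕜] E} (h : HasFDerivAt f L p) (hv : L v = fv)
    (hw : L w = fw) : HasDirDerivs v w f p fv fw :=
  ⟨h.differentiableAt, by rw [dirDeriv, h.fderiv, hv], by rw [dirDeriv, h.fderiv, hw]⟩

theorem hasFDerivAt (h : HasDirDerivs v w f p fv fw) : HasFDerivAt f (fderiv 𝕜 f p) p :=
  h.differentiableAt.hasFDerivAt

theorem congr (h : HasDirDerivs v w f p fv fw) (hv : fv = gv) (hw : fw = gw) :
    HasDirDerivs v w f p gv gw := hv ▸ hw ▸ h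

theorem congr_of_eqOn (h : HasDirDerivs v w f p fv fw) (hU : IsOpen U) (hp : p ∈ U)
    (hfg : ∀ p ∈ U, f p = g p) : HasDirDerivs v w g p fv fw := by
  have hgf : g =ᶠ[nhds p] f := by
    filter_upwards [hU.mem_nhds hp] with x hx using (hfg x hx).symm
  exact .of_hasFDerivAt (h.hasFDerivAt.congr_of_eventuallyEq hgf) h.fst h.snd

theorem unique (h : HasDirDerivs v w f p fv fw) (h' : HasDirDerivs v w f p gv gw) :
    fv = gv ∧ fw = gw :=
  ⟨h.fst.symm.trans h'.fst, h.snd.symm.trans h'.snd⟩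

theorem eq_of_eqOn (hU : IsOpen U) (hp : p ∈ U) (hfg : ∀ p ∈ U, f p = g p)
    (hf : HasDirDerivs v w f p fv fw) (hg : HasDirDerivs v w g p gv gw) : fv = gv ∧ fw = gw :=
  (hf.congr_of_eqOn hU hp hfg).unique hg

theorem const (c : E) : HasDirDerivs v w (fun _ => c) p 0 0 :=
  .of_hasFDerivAt (hasFDerivAt_const c p) rfl rfl

theorem comp_fst {ψ : 𝕜 → 𝕜} (hψ : DifferentiableAt 𝕜 ψ p.1) :
    HasPartials (fun p => ψ p.1) p (deriv ψ p.1) 0 :=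
  .of_hasFDerivAt (hψ.hasDerivAt.comp_hasFDerivAt p hasFDerivAt_fst) (mul_one _) (mul_zero _)

theorem comp_snd {ψ : 𝕜 → 𝕜} (hψ : DifferentiableAt 𝕜 ψ p.2) :
    HasPartials (fun p => ψ p.2) p 0 (deriv ψ p.2) :=
  .of_hasFDerivAt (hψ.hasDerivAt.comp_hasFDerivAt p hasFDerivAt_snd) (mul_zero _) (mul_one _)

theorem coord₁ : HasPartials (fun p : 𝕜 × 𝕜 => p.1) p 1 0 :=
  .of_hasFDerivAt hasFDerivAt_fst rfl rfl

theorem coord₂ : HasPartials (fun p : 𝕜 × 𝕜 => p.2) p 0 1 :=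
  .of_hasFDerivAt hasFDerivAt_snd rfl rfl

theorem add (hf : HasDirDerivs v w f p fv fw) (hg : HasDirDerivs v w g p gv gw) :
    HasDirDerivs v w (fun p => f p + g p) p (fv + gv) (fw + gw) :=
  .of_hasFDerivAt (hf.hasFDerivAt.add hg.hasFDerivAt) (congrArg₂ (· + ·) hf.fst hg.fst)
    (congrArg₂ (· + ·) hf.snd hg.snd)

theorem neg (hf : HasDirDerivs v w f p fv fw) :
    HasDirDerivs v w (fun p => -f p) p (-fv) (-fw) :=
  .of_hasFDerivAt hf.hasFDerivAt.neg (congrArg _ hf.fst) (congrArg _ hf.snd)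

theorem sub (hf : HasDirDerivs v w f p fv fw) (hg : HasDirDerivs v w g p gv gw) :
    HasDirDerivs v w (fun p => f p - g p) p (fv - gv) (fw - gw) := by
  simpa only [sub_eq_add_neg] using hf.add hg.neg

theorem clm (L : E →L[𝕜] G) (hf : HasDirDerivs v w f p fv fw) :
    HasDirDerivs v w (fun p => L (f p)) p (L fv) (L fw) :=
  .of_hasFDerivAt (L.hasFDerivAt.comp p hf.hasFDerivAt) (congrArg L hf.fst) (congrArg L hf.snd)

theorem bilin (B : E →L[𝕜] G →L[𝕜] H) {g : 𝕜 × 𝕜 → G} {gv gw : G}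
    (hf : HasDirDerivs v w f p fv fw) (hg : HasDirDerivs v w g p gv gw) :
    HasDirDerivs v w (fun p => B (f p) (g p)) p (B fv (g p) + B (f p) gv)
      (B fw (g p) + B (f p) gw) := by
  refine .of_hasFDerivAt (B.hasFDerivAt_of_bilinear hf.hasFDerivAt hg.hasFDerivAt) ?_ ?_
  · simp [← hf.fst, ← hg.fst, dirDeriv, add_comm]
  · simp [← hf.snd, ← hg.snd, dirDeriv, add_comm]

theorem smul (hφ : HasDirDerivs v w φ p φv φw) (hg : HasDirDerivs v w g p gv gw) :
    HasDirDerivs v w (fun p => φ p • g p) p (φv • g p + φ p • gv) (φw • g p + φ p • gw) :=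
  hφ.bilin (ContinuousLinearMap.lsmul 𝕜 𝕜) hg

theorem mul (hφ : HasDirDerivs v w φ p φv φw) (hψ : HasDirDerivs v w ψ p ψv ψw) :
    HasDirDerivs v w (fun p => φ p * ψ p) p (φv * ψ p + φ p * ψv) (φw * ψ p + φ p * ψw) :=
  hφ.smul hψ

theorem inv (hφ : HasDirDerivs v w φ p φv φw) (h0 : φ p ≠ 0) :
    HasDirDerivs v w (fun p => (φ p)⁻¹) p (-φv / φ p ^ 2) (-φw / φ p ^ 2) := by
  refine .of_hasFDerivAt ((hasDerivAt_inv h0).comp_hasFDerivAt p hφ.hasFDerivAt) ?_ ?_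
  · simp [← hφ.fst, dirDeriv]; field_simp
  · simp [← hφ.snd, dirDeriv]; field_simp

theorem div (hφ : HasDirDerivs v w φ p φv φw) (hψ : HasDirDerivs v w ψ p ψv ψw) (h0 : ψ p ≠ 0) :
    HasDirDerivs v w (fun p => φ p / ψ p) p ((φv * ψ p - φ p * ψv) / ψ p ^ 2)
      ((φw * ψ p - φ p * ψw) / ψ p ^ 2) := by
  simp only [div_eq_mul_inv (φ _)]
  refine (hφ.mul (hψ.inv h0)).congr ?_ ?_ <;> field_simp <;> ring

theorem pow (hφ : HasDirDerivs v w φ p φv φw) (n : ℕ) :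
    HasDirDerivs v w (fun p => φ p ^ n) p (n * φ p ^ (n - 1) * φv) (n * φ p ^ (n - 1) * φw) :=
  .of_hasFDerivAt ((hasDerivAt_pow n (φ p)).comp_hasFDerivAt p hφ.hasFDerivAt)
    (congrArg _ hφ.fst) (congrArg _ hφ.snd)

theorem const_div_pow (hφ : HasDirDerivs v w φ p φv φw) (h0 : φ p ≠ 0) (c : 𝕜) (n : ℕ) :
    HasDirDerivs v w (fun p => c / φ p ^ n) p (-(n * c * φv) / φ p ^ (n + 1))
      (-(n * c * φw) / φ p ^ (n + 1)) := by
  refine ((const c).div (hφ.pow n) (pow_ne_zero n h0)).congr ?_ ?_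
  all_goals
    rcases n with - | n
    · simp
    · rw [Nat.add_sub_cancel]
      field_simp
      ring

theorem pi {ι : Type*} [Fintype ι] {f : ι → 𝕜 × 𝕜 → E} {fv fw : ι → E}
    (h : ∀ i, HasDirDerivs v w (f i) p (fv i) (fw i)) :
    HasDirDerivs v w (fun p i => f i p) p fv fw :=
  .of_hasFDerivAt (hasFDerivAt_pi.2 fun i => (h i).hasFDerivAt) (funext fun i => (h i).fst)
    (funext fun i => (h i).snd)

theorem comp {S T : 𝕜 × 𝕜 → 𝕜} {Sv Sw Tv Tw : 𝕜} {f₁ f₂ : E}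
    (hf : HasPartials f (S p, T p) f₁ f₂)
    (hS : HasDirDerivs v w S p Sv Sw) (hT : HasDirDerivs v w T p Tv Tw) :
    HasDirDerivs v w (fun p => f (S p, T p)) p (Sv • f₁ + Tv • f₂) (Sw • f₁ + Tw • f₂) := by
  have hfd (a b : 𝕜) : fderiv 𝕜 f (S p, T p) (a, b) = a • f₁ + b • f₂ := by
    rw [show ((a, b) : 𝕜 × 𝕜) = a • (1, 0) + b • (0, 1) by simp, map_add, map_smul, map_smul,
      ← hf.fst, ← hf.snd, dirDeriv, dirDeriv]
  refine .of_hasFDerivAt (hf.hasFDerivAt.comp p (hS.hasFDerivAt.prodMk hT.hasFDerivAt)) ?_ ?_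
  · rw [← hS.fst, ← hT.fst, ← hfd]; rfl
  · rw [← hS.snd, ← hT.snd, ← hfd]; rfl

theorem of_contDiffOn (hU : IsOpen U) (hf : ContDiffOn 𝕜 ∞ f U) (hp : p ∈ U) :
    HasDirDerivs v w f p (dirDeriv v f p) (dirDeriv w f p) :=
  ⟨(hf.contDiffAt (hU.mem_nhds hp)).differentiableAt (by simp), rfl, rfl⟩

end HasDirDerivs

theorem HasPartials.of_contDiffOn (hU : IsOpen U) (hf : ContDiffOn 𝕜 ∞ f U) (hp : p ∈ U) :
    HasPartials f p (pd₁ f p) (pd₂ f p) := HasDirDerivs.of_contDiffOn hU hf hp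

theorem contDiffOn_dirDeriv (hU : IsOpen U) (hf : ContDiffOn 𝕜 ∞ f U) :
    ContDiffOn 𝕜 ∞ (dirDeriv v f) U :=
  (hf.fderiv_of_isOpen (m := ∞) hU (by simp)).clm_apply contDiffOn_const

theorem contDiffOn_pd₁ (hU : IsOpen U) (hf : ContDiffOn 𝕜 ∞ f U) : ContDiffOn 𝕜 ∞ (pd₁ f) U :=
  contDiffOn_dirDeriv hU hf

theorem contDiffOn_pd₂ (hU : IsOpen U) (hf : ContDiffOn 𝕜 ∞ f U) : ContDiffOn 𝕜 ∞ (pd₂ f) U :=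
  contDiffOn_dirDeriv hU hf

theorem dirDeriv_comm (hU : IsOpen U) (hf : ContDiffOn 𝕜 ∞ f U) (hp : p ∈ U) :
    dirDeriv v (dirDeriv w f) p = dirDeriv w (dirDeriv v f) p := by
  have hsymm : IsSymmSndFDerivAt 𝕜 f p := (hf.contDiffAt (hU.mem_nhds hp)).isSymmSndFDerivAt (by
    rw [minSmoothness_of_isRCLikeNormedField]; exact WithTop.coe_le_coe.2 le_top)
  have hd : DifferentiableAt 𝕜 (fderiv 𝕜 f) p :=
    ((hf.fderiv_of_isOpen (m := ∞) hU (by simp)).contDiffAt (hU.mem_nhds hp)).differentiableAt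
      (by simp)
  have hdd (a b : 𝕜 × 𝕜) : dirDeriv a (dirDeriv b f) p = fderiv 𝕜 (fderiv 𝕜 f) p a b := by
    have hb := (hd.hasFDerivAt.clm_apply (hasFDerivAt_const b p)).fderiv
    change fderiv 𝕜 (fun q => fderiv 𝕜 f q b) p a = _
    simp [hb]
  rw [hdd, hdd, hsymm]

theorem pd₁_pd₂_comm (hU : IsOpen U) (hf : ContDiffOn 𝕜 ∞ f U) (hp : p ∈ U) :
    pd₁ (pd₂ f) p = pd₂ (pd₁ f) p := dirDeriv_comm hU hf hp

theorem pd₁_congr (hU : IsOpen U) (hp : p ∈ U) (hfg : ∀ p ∈ U, f p = g p) :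
    pd₁ f p = pd₁ g p := by
  have hfg' : f =ᶠ[nhds p] g := by
    filter_upwards [hU.mem_nhds hp] with x hx using hfg x hx
  rw [pd₁, pd₁, hfg'.fderiv_eq]

theorem pd₂_congr (hU : IsOpen U) (hp : p ∈ U) (hfg : ∀ p ∈ U, f p = g p) :
    pd₂ f p = pd₂ g p := by
  have hfg' : f =ᶠ[nhds p] g := by
    filter_upwards [hU.mem_nhds hp] with x hx using hfg x hx
  rw [pd₂, pd₂, hfg'.fderiv_eq]

end Calculus

section UniqueContinuation

theorem eq_zero_of_norm_fderiv_le_of_convex {X E : Type*} [NormedAddCommGroup X] [NormedSpace ℝ X]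
    [NormedAddCommGroup E] [NormedSpace ℝ E] {Y : X → E} {Y' : X → X →L[ℝ] E} {K : ℝ} {B : Set X}
    (hB : Convex ℝ B) (hY : ∀ x ∈ B, HasFDerivAt Y (Y' x) x)
    (hle : ∀ x ∈ B, ‖Y' x‖ ≤ K * ‖Y x‖) {p : X} (hp : p ∈ B) (h0 : Y p = 0) :
    ∀ q ∈ B, Y q = 0 := by
  intro q hq
  let γ : ℝ → X := fun τ => p + τ • (q - p)
  have hγB : ∀ τ ∈ Set.Icc (0 : ℝ) 1, γ τ ∈ B := fun τ hτ => hB.add_smul_sub_mem hp hq hτ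
  have hγ (τ : ℝ) : HasDerivAt γ (q - p) τ :=
    (((hasDerivAt_id τ).smul_const (q - p)).const_add p).congr_deriv (one_smul ℝ _)
  have hYγ : ∀ τ ∈ Set.Icc (0 : ℝ) 1, HasDerivAt (Y ∘ γ) (Y' (γ τ) (q - p)) τ := fun τ hτ =>
    (hY _ (hγB τ hτ)).comp_hasDerivAt τ (hγ τ)
  have hGronwall := eq_zero_of_abs_deriv_le_mul_abs_self_of_eq_zero_right (K := K * ‖q - p‖)
    (fun τ hτ => (hYγ τ hτ).continuousAt.continuousWithinAt)
    (fun τ hτ => (hYγ τ (Set.Ico_subset_Icc_self hτ)).hasDerivWithinAt) (by simp [γ, h0])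
    (fun τ hτ => calc
      ‖Y' (γ τ) (q - p)‖ ≤ ‖Y' (γ τ)‖ * ‖q - p‖ := (Y' (γ τ)).le_opNorm _
      _ ≤ K * ‖Y (γ τ)‖ * ‖q - p‖ := by
        gcongr; exact hle _ (hγB τ (Set.Ico_subset_Icc_self hτ))
      _ = K * ‖q - p‖ * ‖Y (γ τ)‖ := by ring)
    1 (by simp)
  simpa [γ] using hGronwall

theorem eq_zero_of_norm_fderiv_le {X E : Type*} [NormedAddCommGroup X] [NormedSpace ℝ X]
    [NormedAddCommGroup E] [NormedSpace ℝ E] {Y : X → E} {Y' : X → X →L[ℝ] E} {κ : X → ℝ}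
    {U : Set X} (hU : IsOpen U) (hUc : IsPreconnected U) (hκ : ContinuousOn κ U)
    (hY : ∀ x ∈ U, HasFDerivAt Y (Y' x) x) (hle : ∀ x ∈ U, ‖Y' x‖ ≤ κ x * ‖Y x‖) {p₀ : X}
    (hp₀ : p₀ ∈ U) (h0 : Y p₀ = 0) : ∀ p ∈ U, Y p = 0 := by
  have hball : ∀ p ∈ U, ∃ r > 0, ∀ q ∈ Metric.ball p r, Y q = 0 →
      ∀ x ∈ Metric.ball p r, Y x = 0 := by
    intro p hp
    have hκp : ∀ᶠ x in nhds p, κ x < κ p + 1 :=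
      (hκ.continuousAt (hU.mem_nhds hp)).eventually_lt continuousAt_const (by simp)
    obtain ⟨r, hr, hr'⟩ := Metric.eventually_nhds_iff_ball.1 (hκp.and (hU.mem_nhds hp))
    refine ⟨r, hr, fun q hq hq0 => eq_zero_of_norm_fderiv_le_of_convex (K := κ p + 1)
      (convex_ball p r) (fun y hy => hY y (hr' y hy).2) (fun y hy => ?_) hq hq0⟩
    exact (hle y (hr' y hy).2).trans (by gcongr; exact (hr' y hy).1.le)
  have hsub : U ⊆ interior {p | Y p = 0} := by
    refine hUc.subset_of_closure_inter_subset isOpen_interior ⟨p₀, hp₀, ?_⟩ ?_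
    · obtain ⟨r, hr, h⟩ := hball p₀ hp₀
      exact mem_interior.2 ⟨_, h p₀ (Metric.mem_ball_self hr) h0, Metric.isOpen_ball,
        Metric.mem_ball_self hr⟩
    · rintro p ⟨hp, hpU⟩
      obtain ⟨r, hr, h⟩ := hball p hpU
      obtain ⟨q, hq, hqi⟩ := mem_closure_iff.1 hp _ Metric.isOpen_ball (Metric.mem_ball_self hr)
      exact mem_interior.2 ⟨_, h q hq (interior_subset (s := {p | Y p = 0}) hqi),
        Metric.isOpen_ball, Metric.mem_ball_self hr⟩
  exact fun p hp => interior_subset (s := {p | Y p = 0}) (hsub hp)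

variable {𝕜 : Type*} [RCLike 𝕜] {E : Type*} [NormedAddCommGroup E] [NormedSpace 𝕜 E]
  {U : Set (𝕜 × 𝕜)}

theorem norm_fderiv_le_add (f : 𝕜 × 𝕜 → E) (p : 𝕜 × 𝕜) :
    ‖fderiv 𝕜 f p‖ ≤ ‖pd₁ f p‖ + ‖pd₂ f p‖ := by
  refine ContinuousLinearMap.opNorm_le_bound _ (by positivity) fun v => ?_
  calc ‖fderiv 𝕜 f p v‖ = ‖v.1 • pd₁ f p + v.2 • pd₂ f p‖ := by
        rw [pd₁, pd₂, ← map_smul, ← map_smul, ← map_add]; simp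
    _ ≤ ‖v.1‖ * ‖pd₁ f p‖ + ‖v.2‖ * ‖pd₂ f p‖ := by
        simpa only [norm_smul] using norm_add_le (v.1 • pd₁ f p) (v.2 • pd₂ f p)
    _ ≤ ‖v‖ * ‖pd₁ f p‖ + ‖v‖ * ‖pd₂ f p‖ := by
        gcongr
        exacts [norm_fst_le v, norm_snd_le v]
    _ = (‖pd₁ f p‖ + ‖pd₂ f p‖) * ‖v‖ := by ring

theorem eq_zero_of_hasPartials_linear {Y : 𝕜 × 𝕜 → E} {A B : 𝕜 × 𝕜 → E →L[𝕜] E} (hU : IsOpen U)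
    (hUc : IsPreconnected U) (hA : ContinuousOn A U) (hB : ContinuousOn B U)
    (hY : ∀ p ∈ U, HasPartials Y p (A p (Y p)) (B p (Y p))) {p₀ : 𝕜 × 𝕜} (hp₀ : p₀ ∈ U)
    (h0 : Y p₀ = 0) : ∀ p ∈ U, Y p = 0 := by
  let _ : NormedSpace ℝ E := NormedSpace.restrictScalars ℝ 𝕜 E
  have : IsScalarTower ℝ 𝕜 E := RestrictScalars.isScalarTower ℝ 𝕜 E
  refine eq_zero_of_norm_fderiv_le hU hUc (hA.norm.add hB.norm)
    (fun p hp => (hY p hp).hasFDerivAt.restrictScalars ℝ) (fun p hp => ?_) hp₀ h0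
  calc ‖(fderiv 𝕜 Y p).restrictScalars ℝ‖ = ‖fderiv 𝕜 Y p‖ :=
        ContinuousLinearMap.norm_restrictScalars _
    _ ≤ ‖A p (Y p)‖ + ‖B p (Y p)‖ := by
        rw [← (hY p hp).fst, ← (hY p hp).snd]; exact norm_fderiv_le_add Y p
    _ ≤ ‖A p‖ * ‖Y p‖ + ‖B p‖ * ‖Y p‖ := add_le_add ((A p).le_opNorm _) ((B p).le_opNorm _)
    _ = (‖A p‖ + ‖B p‖) * ‖Y p‖ := by ring

/-- If `K` solves a linear system and `N` solves it up to the scalar factors `μ` and `ν`, then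
normalizing by a functional `ℓ` with `ℓ N = 1` turns `K - ℓ(K) N` into a solution of a linear
system. -/
theorem eq_smul_of_hasPartials_conformal {K N : 𝕜 × 𝕜 → E} {A B : 𝕜 × 𝕜 → E →L[𝕜] E}
    {μ ν : 𝕜 × 𝕜 → 𝕜} (ℓ : E →L[𝕜] 𝕜) (hU : IsOpen U) (hUc : IsPreconnected U)
    (hA : ContinuousOn A U) (hB : ContinuousOn B U)
    (hK : ∀ p ∈ U, HasPartials K p (A p (K p)) (B p (K p)))
    (hN : ∀ p ∈ U, HasPartials N p (A p (N p) - μ p • N p) (B p (N p) - ν p • N p))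
    (hℓ : ∀ p ∈ U, ℓ (N p) = 1) {p₀ : 𝕜 × 𝕜} (hp₀ : p₀ ∈ U) (h0 : K p₀ = ℓ (K p₀) • N p₀) :
    ∀ p ∈ U, K p = ℓ (K p) • N p := by
  have hNc : ContinuousOn N U := fun p hp =>
    (hN p hp).differentiableAt.continuousAt.continuousWithinAt
  have hcont {L : 𝕜 × 𝕜 → E →L[𝕜] E} (hL : ContinuousOn L U) :
      ContinuousOn (fun p => L p - (ℓ ∘L L p).smulRight (N p)) U :=
    hL.sub (((ContinuousLinearMap.smulRightL 𝕜 E E).continuous₂.comp_continuousOn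
      (((ContinuousLinearMap.compL 𝕜 E E 𝕜 ℓ).continuous.comp_continuousOn hL).prodMk hNc)))
  have hμν : ∀ p ∈ U, ℓ (A p (N p)) = μ p ∧ ℓ (B p (N p)) = ν p := fun p hp => by
    have hd := HasDirDerivs.eq_of_eqOn hU hp hℓ ((hN p hp).clm ℓ) (.const 1)
    simpa only [map_sub, map_smul, hℓ p hp, smul_eq_mul, mul_one, sub_eq_zero] using hd
  have hY := eq_zero_of_hasPartials_linear (Y := fun p => K p - ℓ (K p) • N p) hU hUc (hcont hA)
    (hcont hB) (fun p hp => ?_) hp₀ (sub_eq_zero.2 h0)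
  · exact fun p hp => sub_eq_zero.1 (hY p hp)
  · refine ((hK p hp).sub (((hK p hp).clm ℓ).smul (hN p hp))).congr ?_ ?_
    · simp only [sub_apply, ContinuousLinearMap.smulRight_apply,
        ContinuousLinearMap.comp_apply, map_sub, map_smul, (hμν p hp).1]
      module
    · simp only [sub_apply, ContinuousLinearMap.smulRight_apply,
        ContinuousLinearMap.comp_apply, map_sub, map_smul, (hμν p hp).2]
      module

end UniqueContinuation

section BilinearForms

variable {𝕜 : Type*} [RCLike 𝕜] {ι : Type*} [Fintype ι]

theorem linearIndependent_of_dotProduct_eq_zero {e : ι → ι → 𝕜}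
    (h : ∀ x : ι → 𝕜, (∀ i, e i ⬝ᵥ x = 0) → x = 0) : LinearIndependent 𝕜 e := by
  classical
  refine Matrix.linearIndependent_rows_iff_isUnit (A := Matrix.of e) |>.2
    (Matrix.mulVec_injective_iff_isUnit.1 ?_)
  exact (injective_iff_map_eq_zero (Matrix.of e).mulVecLin).2 fun x hx => h x (congrFun hx)

theorem eq_zero_of_dotProduct_eq_zero {e : ι → ι → 𝕜} (he : LinearIndependent 𝕜 e) {x : ι → 𝕜}
    (hx : ∀ i, e i ⬝ᵥ x = 0) : x = 0 := by
  classical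
  have hW : IsUnit (Matrix.of e) := Matrix.linearIndependent_rows_iff_isUnit.1 he
  exact Matrix.mulVec_injective_iff_isUnit.2 hW
    ((funext hx : (Matrix.of e).mulVec x = 0).trans (Matrix.mulVec_zero _).symm)

variable [DecidableEq ι]

/-- The bilinear form with matrix `M`. -/
noncomputable def form (M : Matrix ι ι 𝕜) : (ι → 𝕜) →L[𝕜] (ι → 𝕜) →L[𝕜] 𝕜 :=
  (Matrix.toLinearMap₂' 𝕜 M).toContinuousBilinearMap

theorem form_apply (M : Matrix ι ι 𝕜) (x y : ι → 𝕜) : form M x y = x ⬝ᵥ M.mulVec y := by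
  rw [form, LinearMap.toContinuousBilinearMap_apply, Matrix.toLinearMap₂'_apply']

theorem form_comm {M : Matrix ι ι 𝕜} (hM : M.IsSymm) (x y : ι → 𝕜) :
    form M x y = form M y x := by
  rw [form_apply, form_apply, Matrix.dotProduct_mulVec, ← Matrix.mulVec_transpose, hM.eq,
    dotProduct_comm]

theorem eq_zero_of_form_eq_zero {M : Matrix ι ι 𝕜} (hM : M.det ≠ 0) {e : ι → ι → 𝕜}
    (he : LinearIndependent 𝕜 e) {x : ι → 𝕜} (hx : ∀ i, form M (e i) x = 0) : x = 0 :=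
  Matrix.eq_zero_of_mulVec_eq_zero hM
    (eq_zero_of_dotProduct_eq_zero he fun i => (form_apply M (e i) x).symm.trans (hx i))

theorem exists_isSymm_form_eq {e : ι → ι → 𝕜} (he : LinearIndependent 𝕜 e) {N : Matrix ι ι 𝕜}
    (hN : N.IsSymm) (hdet : N.det ≠ 0) :
    ∃ M : Matrix ι ι 𝕜, M.IsSymm ∧ M.det ≠ 0 ∧ ∀ i j, form M (e i) (e j) = N i j := by
  set W : Matrix ι ι 𝕜 := Matrix.of e
  have hW : IsUnit W.det :=
    (Matrix.isUnit_iff_isUnit_det _).1 (Matrix.linearIndependent_rows_iff_isUnit.1 he)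
  set M := W⁻¹ * N * W⁻¹.transpose with hM
  have hMW : W * M * W.transpose = N := by
    have hWt : W⁻¹.transpose * W.transpose = 1 := by
      rw [← Matrix.transpose_mul, Matrix.mul_nonsing_inv _ hW, Matrix.transpose_one]
    calc W * M * W.transpose = (W * W⁻¹) * N * (W⁻¹.transpose * W.transpose) := by
          simp only [hM, Matrix.mul_assoc]
      _ = N := by rw [hWt, Matrix.mul_nonsing_inv _ hW, Matrix.one_mul, Matrix.mul_one]
  refine ⟨M, ?_, fun h0 => hdet ?_, fun i j => ?_⟩
  · rw [Matrix.IsSymm, hM, Matrix.transpose_mul, Matrix.transpose_mul,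
      Matrix.transpose_transpose, hN.eq, Matrix.mul_assoc]
  · rw [← hMW, Matrix.det_mul, Matrix.det_mul, h0, mul_zero, zero_mul]
  · rw [← hMW, form_apply, Matrix.mul_assoc]
    rfl

end BilinearForms

section TotalSystems

open scoped Matrix.Norms.Elementwise

variable {𝕜 : Type*} [RCLike 𝕜] {ι : Type*} [Fintype ι]

/-- The functions `y i` solve on `U` the total differential system
`∂₁ yᵢ = ∑ⱼ Pᵢⱼ yⱼ`, `∂₂ yᵢ = ∑ⱼ Qᵢⱼ yⱼ` with continuous coefficients. -/
structure IsTotalSystem {E : Type*} [NormedAddCommGroup E] [NormedSpace 𝕜 E] (U : Set (𝕜 × 𝕜))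
    (P Q : 𝕜 × 𝕜 → Matrix ι ι 𝕜) (y : ι → 𝕜 × 𝕜 → E) : Prop where
  continuousOn_fst : ContinuousOn P U
  continuousOn_snd : ContinuousOn Q U
  hasPartials : ∀ p ∈ U, ∀ i,
    HasPartials (y i) p (∑ j, P p i j • y j p) (∑ j, Q p i j • y j p)

/-- The derivation `N ↦ P N + N Pᵀ`: the derivative of the Gram matrix, for a constant bilinear
form, of a frame whose derivative has matrix `P`. -/
noncomputable def gramDeriv : Matrix ι ι 𝕜 →L[𝕜] Matrix ι ι 𝕜 →L[𝕜] Matrix ι ι 𝕜 :=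
  (LinearMap.mul 𝕜 (Matrix ι ι 𝕜) + (LinearMap.mul 𝕜 (Matrix ι ι 𝕜)).flip ∘ₗ
    (Matrix.transposeLinearEquiv ι ι 𝕜 𝕜).toLinearMap).toContinuousBilinearMap

theorem gramDeriv_apply (P N : Matrix ι ι 𝕜) (i j : ι) :
    gramDeriv P N i j = ∑ k, P i k * N k j + ∑ k, P j k * N i k := by
  change (P * N + N * P.transpose) i j = _
  simp only [Matrix.add_apply, Matrix.mul_apply, Matrix.transpose_apply, mul_comm]

variable {U : Set (𝕜 × 𝕜)} {P Q : 𝕜 × 𝕜 → Matrix ι ι 𝕜} {y : ι → 𝕜 × 𝕜 → (ι → 𝕜)}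

namespace IsTotalSystem

theorem linearIndependent (h : IsTotalSystem U P Q y) (hU : IsOpen U) (hUc : IsPreconnected U)
    {i₀ : ι} (hi : LinearIndependent 𝕜 (fun (i : ι) (p : U) => y i₀ p i)) {p : 𝕜 × 𝕜}
    (hp : p ∈ U) : LinearIndependent 𝕜 (fun i => y i p) := by
  classical
  refine linearIndependent_of_dotProduct_eq_zero fun x hx => ?_
  let L : (ι → 𝕜) →L[𝕜] 𝕜 := (form 1).flip x
  have hL (z : ι → 𝕜) : L z = z ⬝ᵥ x := by simp [L, form_apply]
  have hmulVec := (Matrix.mulVecBilin 𝕜 𝕜 :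
    Matrix ι ι 𝕜 →ₗ[𝕜] (ι → 𝕜) →ₗ[𝕜] (ι → 𝕜)).toContinuousBilinearMap.continuous
  have hz := eq_zero_of_hasPartials_linear (Y := fun q i => L (y i q)) hU hUc
    (hmulVec.comp_continuousOn h.continuousOn_fst)
    (hmulVec.comp_continuousOn h.continuousOn_snd)
    (fun q hq => .pi fun i => ((h.hasPartials q hq i).clm L).congr
      (by simp [Matrix.mulVec, dotProduct]) (by simp [Matrix.mulVec, dotProduct])) hp
    (funext fun i => (hL _).trans (hx i))
  refine funext (Fintype.linearIndependent_iff.1 hi x (funext fun q => ?_))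
  have hq := (hL _).symm.trans (congrFun (hz q q.2) i₀)
  simpa [dotProduct, mul_comm] using hq

variable [DecidableEq ι]

theorem hasPartials_gram (h : IsTotalSystem U P Q y) (M : Matrix ι ι 𝕜) {p : 𝕜 × 𝕜}
    (hp : p ∈ U) :
    HasPartials (fun p => Matrix.of fun i j => form M (y i p) (y j p)) p
      (gramDeriv (P p) (Matrix.of fun i j => form M (y i p) (y j p)))
      (gramDeriv (Q p) (Matrix.of fun i j => form M (y i p) (y j p))) := by
  refine .pi fun i => .pi fun j =>
    ((h.hasPartials p hp i).bilin (form M) (h.hasPartials p hp j)).congr ?_ ?_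
  all_goals
    rw [gramDeriv_apply]
    simp

theorem exists_form_eq_smul (h : IsTotalSystem U P Q y) (hU : IsOpen U)
    (hUc : IsPreconnected U) {p₀ : 𝕜 × 𝕜} (hp₀ : p₀ ∈ U)
    (hi : LinearIndependent 𝕜 (fun i => y i p₀)) {N : 𝕜 × 𝕜 → Matrix ι ι 𝕜} {μ ν : 𝕜 × 𝕜 → 𝕜}
    (hsymm : (N p₀).IsSymm) (hdet : (N p₀).det ≠ 0) (ℓ : Matrix ι ι 𝕜 →L[𝕜] 𝕜)
    (hℓ : ∀ p ∈ U, ℓ (N p) = 1)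
    (hN : ∀ p ∈ U, HasPartials N p (gramDeriv (P p) (N p) - μ p • N p)
      (gramDeriv (Q p) (N p) - ν p • N p)) :
    ∃ M : Matrix ι ι 𝕜, M.IsSymm ∧ M.det ≠ 0 ∧
      ∀ p ∈ U, ∃ c : 𝕜, ∀ i j, form M (y i p) (y j p) = c * N p i j := by
  obtain ⟨M, hM, hMdet, hform⟩ := exists_isSymm_form_eq hi hsymm hdet
  have hK₀ : Matrix.of (fun i j => form M (y i p₀) (y j p₀)) = N p₀ := Matrix.ext hform
  have hℓ₀ : ℓ (N p₀) • N p₀ = N p₀ :=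
    (congrArg (· • N p₀) (hℓ p₀ hp₀)).trans (one_smul _ _)
  have hK := eq_smul_of_hasPartials_conformal ℓ hU hUc
    (gramDeriv.continuous.comp_continuousOn h.continuousOn_fst)
    (gramDeriv.continuous.comp_continuousOn h.continuousOn_snd)
    (fun p hp => h.hasPartials_gram M hp) hN hℓ hp₀ (hK₀.symm ▸ hℓ₀.symm)
  exact ⟨M, hM, hMdet, fun p hp => ⟨_, fun i j => congrFun (congrFun (hK p hp) i) j⟩⟩

theorem isQuadricOn {P Q : 𝕜 × 𝕜 → Matrix (Fin 4) (Fin 4) 𝕜} {y : Fin 4 → 𝕜 × 𝕜 → (Fin 4 → 𝕜)}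
    (h : IsTotalSystem U P Q y) (hU : IsOpen U) (hUc : IsPreconnected U) {p₀ : 𝕜 × 𝕜}
    (hp₀ : p₀ ∈ U) (hi : LinearIndependent 𝕜 (fun i => y i p₀))
    {N : 𝕜 × 𝕜 → Matrix (Fin 4) (Fin 4) 𝕜} {μ ν : 𝕜 × 𝕜 → 𝕜} (hsymm : (N p₀).IsSymm)
    (hdet : (N p₀).det ≠ 0) (h00 : ∀ p ∈ U, N p 0 0 = 0) (h03 : ∀ p ∈ U, N p 0 3 = -1)
    (hN : ∀ p ∈ U, HasPartials N p (gramDeriv (P p) (N p) - μ p • N p)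
      (gramDeriv (Q p) (N p) - ν p • N p)) : IsQuadricOn U (y 0) := by
  let ℓ : Matrix (Fin 4) (Fin 4) 𝕜 →L[𝕜] 𝕜 :=
    -LinearMap.toContinuousLinearMap (Matrix.entryLinearMap 𝕜 𝕜 0 3)
  have hℓ (A : Matrix (Fin 4) (Fin 4) 𝕜) : ℓ A = -A 0 3 := rfl
  obtain ⟨M, hM, hMdet, hform⟩ := h.exists_form_eq_smul hU hUc hp₀ hi hsymm hdet ℓ
    (fun p hp => by rw [hℓ, h03 p hp, neg_neg]) hN
  refine ⟨M, hM, hMdet, fun p hp => ?_⟩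
  obtain ⟨c, hc⟩ := hform p hp
  rw [← form_apply, hc, h00 p hp, mul_zero]

end IsTotalSystem

end TotalSystems

section ConjugateNets

variable {𝕜 : Type*} [RCLike 𝕜] {U : Set (𝕜 × 𝕜)} {z : 𝕜 × 𝕜 → (Fin 4 → 𝕜)}
  {C : ConjugateCoeffs 𝕜} {v w : 𝕜 × 𝕜} {M : Matrix (Fin 4) (Fin 4) 𝕜}

/-- A smooth solution of a conjugate system with respect to arbitrary directions `v`, `w` in place
of the coordinate axes, so that the two families of parameter curves can be exchanged. -/
structure IsConjugateNet (v w : 𝕜 × 𝕜) (U : Set (𝕜 × 𝕜)) (z : 𝕜 × 𝕜 → (Fin 4 → 𝕜))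
    (C : ConjugateCoeffs 𝕜) : Prop where
  isOpen : IsOpen U
  smooth : ContDiffOn 𝕜 ∞ z U
  smooth_a : ContDiffOn 𝕜 ∞ C.a U
  smooth_b : ContDiffOn 𝕜 ∞ C.b U
  smooth_c : ContDiffOn 𝕜 ∞ C.c U
  smooth_q : ContDiffOn 𝕜 ∞ C.q U
  q_ne_zero : ∀ p ∈ U, C.q p ≠ 0
  frame : ∀ p ∈ U,
    LinearIndependent 𝕜 ![z p, dirDeriv v z p, dirDeriv w z p, dirDeriv v (dirDeriv v z) p]
  hyperbolic : ∀ p ∈ U, dirDeriv w (dirDeriv v z) p + C.a p • dirDeriv v z p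
    + C.b p • dirDeriv w z p + C.c p • z p = 0
  second : ∀ p ∈ U, dirDeriv w (dirDeriv w z) p + C.q p • dirDeriv v (dirDeriv v z) p
    + C.m p • dirDeriv v z p + C.n p • dirDeriv w z p + C.r p • z p = 0

theorem IsConjugateSystem.isConjugateNet (h : IsConjugateSystem U z C) (hU : IsOpen U)
    (hz : ContDiffOn 𝕜 ∞ z U) : IsConjugateNet (1, 0) (0, 1) U z C :=
  ⟨hU, hz, h.smooth_a, h.smooth_b, h.smooth_c, h.smooth_q, h.q_ne_zero, h.frame, h.hyperbolic,
    h.second⟩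

/-- The coefficients of a conjugate system after the exchange of the two coordinates. -/
noncomputable def swapCoeffs (C : ConjugateCoeffs 𝕜) : ConjugateCoeffs 𝕜 where
  a := C.b
  b := C.a
  c := C.c
  q := fun p => (C.q p)⁻¹
  m := fun p => (C.q p)⁻¹ * C.n p
  n := fun p => (C.q p)⁻¹ * C.m p
  r := fun p => (C.q p)⁻¹ * C.r p

/-- The Laplace transform `z_w + a z`, the second focal surface of the congruence of tangent lines
to the `w`-curves. -/
noncomputable def laplaceTransform (w : 𝕜 × 𝕜) (C : ConjugateCoeffs 𝕜) (z : 𝕜 × 𝕜 → (Fin 4 → 𝕜))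
    (p : 𝕜 × 𝕜) : Fin 4 → 𝕜 :=
  dirDeriv w z p + C.a p • z p

/-- The Laplace invariant `a b + a_v - c`. -/
noncomputable def laplaceInvariant (v : 𝕜 × 𝕜) (C : ConjugateCoeffs 𝕜) (p : 𝕜 × 𝕜) : 𝕜 :=
  C.a p * C.b p + dirDeriv v C.a p - C.c p

theorem contDiffOn_form (M : Matrix (Fin 4) (Fin 4) 𝕜) {f g : 𝕜 × 𝕜 → (Fin 4 → 𝕜)}
    (hf : ContDiffOn 𝕜 ∞ f U) (hg : ContDiffOn 𝕜 ∞ g U) :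
    ContDiffOn 𝕜 ∞ (fun p => form M (f p) (g p)) U :=
  ((form M).contDiff.comp_contDiffOn hf).clm_apply hg

theorem IsQuadricOn.exists_form_eq_zero (h : IsQuadricOn U z) :
    ∃ M : Matrix (Fin 4) (Fin 4) 𝕜, M.IsSymm ∧ M.det ≠ 0 ∧ ∀ p ∈ U, form M (z p) (z p) = 0 := by
  simpa only [IsQuadricOn, form_apply] using h

theorem IsQuadricOn.mono (h : IsQuadricOn U z) {V : Set (𝕜 × 𝕜)} (hVU : V ⊆ U) :
    IsQuadricOn V z :=
  h.imp fun _ hM => ⟨hM.1, hM.2.1, fun p hp => hM.2.2 p (hVU hp)⟩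

theorem dirDeriv_eq_of_logarithmic (hU : IsOpen U) {A φ ψ : 𝕜 × 𝕜 → 𝕜}
    (hA : ContDiffOn 𝕜 ∞ A U) (hφ : ContDiffOn 𝕜 ∞ φ U) (hψ : ContDiffOn 𝕜 ∞ ψ U)
    (hAv : ∀ p ∈ U, dirDeriv v A p = φ p * A p) (hAw : ∀ p ∈ U, dirDeriv w A p = ψ p * A p)
    {p : 𝕜 × 𝕜} (hp : p ∈ U) (h0 : A p ≠ 0) : dirDeriv w φ p = dirDeriv v ψ p := by
  have hA' := HasDirDerivs.of_contDiffOn (v := v) (w := w) hU hA hp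
  have hvw := (HasDirDerivs.eq_of_eqOn hU hp hAv
    (HasDirDerivs.of_contDiffOn (v := v) (w := w) hU (contDiffOn_dirDeriv hU hA) hp)
    ((HasDirDerivs.of_contDiffOn hU hφ hp).mul hA')).2
  have hwv := (HasDirDerivs.eq_of_eqOn hU hp hAw
    (HasDirDerivs.of_contDiffOn (v := v) (w := w) hU (contDiffOn_dirDeriv hU hA) hp)
    ((HasDirDerivs.of_contDiffOn hU hψ hp).mul hA')).1
  have hcomm := dirDeriv_comm (v := v) (w := w) hU hA hp
  rw [hvw, hwv, hAv p hp, hAw p hp] at hcomm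
  exact mul_right_cancel₀ h0 (by linear_combination -hcomm)

namespace IsConjugateNet

variable {p : 𝕜 × 𝕜}

theorem mono (h : IsConjugateNet v w U z C) {V : Set (𝕜 × 𝕜)} (hV : IsOpen V) (hVU : V ⊆ U) :
    IsConjugateNet v w V z C :=
  ⟨hV, h.smooth.mono hVU, h.smooth_a.mono hVU, h.smooth_b.mono hVU, h.smooth_c.mono hVU,
    h.smooth_q.mono hVU, fun p hp => h.q_ne_zero p (hVU hp), fun p hp => h.frame p (hVU hp),
    fun p hp => h.hyperbolic p (hVU hp), fun p hp => h.second p (hVU hp)⟩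

theorem swap (h : IsConjugateNet v w U z C) : IsConjugateNet w v U z (swapCoeffs C) where
  isOpen := h.isOpen
  smooth := h.smooth
  smooth_a := h.smooth_b
  smooth_b := h.smooth_a
  smooth_c := h.smooth_c
  smooth_q := h.smooth_q.inv h.q_ne_zero
  q_ne_zero := fun p hp => inv_ne_zero (h.q_ne_zero p hp)
  frame := fun p hp => by
    refine linearIndependent_of_dotProduct_eq_zero fun x hx =>
      eq_zero_of_dotProduct_eq_zero (h.frame p hp) ?_
    have hz : z p ⬝ᵥ x = 0 := hx 0
    have hw : dirDeriv w z p ⬝ᵥ x = 0 := hx 1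
    have hv : dirDeriv v z p ⬝ᵥ x = 0 := hx 2
    have hww : dirDeriv w (dirDeriv w z) p ⬝ᵥ x = 0 := hx 3
    have hvv := congrArg (· ⬝ᵥ x) (h.second p hp)
    simp only [add_dotProduct, smul_dotProduct, hz, hv, hw, hww, zero_dotProduct, mul_zero,
      zero_add, add_zero, smul_eq_mul, mul_eq_zero, h.q_ne_zero p hp, false_or] at hvv
    simp [Fin.forall_fin_succ, hz, hv, hw, hvv]
  hyperbolic := fun p hp => by
    rw [← h.hyperbolic p hp, dirDeriv_comm h.isOpen h.smooth hp]
    simp only [swapCoeffs]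
    abel
  second := fun p hp => by
    have hsecond := congrArg ((C.q p)⁻¹ • ·) (h.second p hp)
    simp only [smul_add, smul_smul, inv_mul_cancel₀ (h.q_ne_zero p hp), one_smul, smul_zero]
      at hsecond
    rw [← hsecond]
    simp only [swapCoeffs]
    abel

theorem hasDirDerivs (h : IsConjugateNet v w U z C) (hp : p ∈ U) :
    HasDirDerivs v w z p (dirDeriv v z p) (dirDeriv w z p) :=
  .of_contDiffOn h.isOpen h.smooth hp

theorem hasDirDerivs_fst (h : IsConjugateNet v w U z C) (hp : p ∈ U) :
    HasDirDerivs v w (dirDeriv v z) p (dirDeriv v (dirDeriv v z) p)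
      (dirDeriv w (dirDeriv v z) p) :=
  .of_contDiffOn h.isOpen (contDiffOn_dirDeriv h.isOpen h.smooth) hp

theorem hasDirDerivs_snd (h : IsConjugateNet v w U z C) (hp : p ∈ U) :
    HasDirDerivs v w (dirDeriv w z) p (dirDeriv w (dirDeriv v z) p)
      (dirDeriv w (dirDeriv w z) p) :=
  (HasDirDerivs.of_contDiffOn h.isOpen (contDiffOn_dirDeriv h.isOpen h.smooth) hp).congr
    (dirDeriv_comm h.isOpen h.smooth hp) rfl

theorem map_hyperbolic (h : IsConjugateNet v w U z C) (hp : p ∈ U) (L : (Fin 4 → 𝕜) →L[𝕜] 𝕜) :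
    L (dirDeriv w (dirDeriv v z) p) = -C.a p * L (dirDeriv v z p) - C.b p * L (dirDeriv w z p)
      - C.c p * L (z p) := by
  have hL := congrArg L (h.hyperbolic p hp)
  simp only [map_add, map_smul, smul_eq_mul, map_zero] at hL
  linear_combination hL

theorem map_second (h : IsConjugateNet v w U z C) (hp : p ∈ U) (L : (Fin 4 → 𝕜) →L[𝕜] 𝕜) :
    L (dirDeriv w (dirDeriv w z) p) = -C.q p * L (dirDeriv v (dirDeriv v z) p)
      - C.m p * L (dirDeriv v z p) - C.n p * L (dirDeriv w z p) - C.r p * L (z p) := by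
  have hL := congrArg L (h.second p hp)
  simp only [map_add, map_smul, smul_eq_mul, map_zero] at hL
  linear_combination hL

theorem contDiffOn_laplaceInvariant (h : IsConjugateNet v w U z C) :
    ContDiffOn 𝕜 ∞ (laplaceInvariant v C) U :=
  ((h.smooth_a.mul h.smooth_b).add (contDiffOn_dirDeriv h.isOpen h.smooth_a)).sub h.smooth_c

theorem form_fst (h : IsConjugateNet v w U z C) (hM : M.IsSymm)
    (hz : ∀ p ∈ U, form M (z p) (z p) = 0) (hp : p ∈ U) : form M (z p) (dirDeriv v z p) = 0 := by
  have hd := (HasDirDerivs.eq_of_eqOn h.isOpen hp hz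
    ((h.hasDirDerivs hp).bilin (form M) (h.hasDirDerivs hp)) (.const 0)).1
  rw [form_comm hM (dirDeriv v z p)] at hd
  linear_combination hd / 2

theorem form_snd (h : IsConjugateNet v w U z C) (hM : M.IsSymm)
    (hz : ∀ p ∈ U, form M (z p) (z p) = 0) (hp : p ∈ U) : form M (z p) (dirDeriv w z p) = 0 :=
  h.swap.form_fst hM hz hp

theorem form_fst_fst (h : IsConjugateNet v w U z C) (hM : M.IsSymm)
    (hz : ∀ p ∈ U, form M (z p) (z p) = 0) (hp : p ∈ U) :
    form M (z p) (dirDeriv v (dirDeriv v z) p) = -form M (dirDeriv v z p) (dirDeriv v z p) := by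
  have hd := (HasDirDerivs.eq_of_eqOn h.isOpen hp (fun p hp => h.form_fst hM hz hp)
    ((h.hasDirDerivs hp).bilin (form M) (h.hasDirDerivs_fst hp)) (.const 0)).1
  linear_combination hd

theorem form_fst_snd (h : IsConjugateNet v w U z C) (hM : M.IsSymm)
    (hz : ∀ p ∈ U, form M (z p) (z p) = 0) (hp : p ∈ U) :
    form M (dirDeriv v z p) (dirDeriv w z p) = 0 := by
  have hd := (HasDirDerivs.eq_of_eqOn h.isOpen hp (fun p hp => h.form_snd hM hz hp)
    ((h.hasDirDerivs hp).bilin (form M) (h.hasDirDerivs_snd hp)) (.const 0)).1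
  have hvw := h.map_hyperbolic hp (form M (z p))
  rw [h.form_fst hM hz hp, h.form_snd hM hz hp, hz p hp] at hvw
  linear_combination hd - hvw

theorem form_snd_snd (h : IsConjugateNet v w U z C) (hM : M.IsSymm)
    (hz : ∀ p ∈ U, form M (z p) (z p) = 0) (hp : p ∈ U) :
    form M (dirDeriv w z p) (dirDeriv w z p) =
      -C.q p * form M (dirDeriv v z p) (dirDeriv v z p) := by
  have hww := h.map_second hp (form M (z p))
  rw [h.swap.form_fst_fst hM hz hp, h.form_fst_fst hM hz hp, h.form_fst hM hz hp,
    h.form_snd hM hz hp, hz p hp] at hww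
  linear_combination -hww

theorem form_fst_self_ne_zero (h : IsConjugateNet v w U z C) (hM : M.IsSymm) (hdet : M.det ≠ 0)
    (hz : ∀ p ∈ U, form M (z p) (z p) = 0) (hp : p ∈ U) :
    form M (dirDeriv v z p) (dirDeriv v z p) ≠ 0 := fun h0 => by
  refine (h.frame p hp).ne_zero 0 (eq_zero_of_form_eq_zero hdet (h.frame p hp) fun i => ?_)
  rw [form_comm hM]
  revert i
  simp [Fin.forall_fin_succ, hz p hp, h.form_fst hM hz hp, h.form_snd hM hz hp,
    h.form_fst_fst hM hz hp, h0]

theorem hasDirDerivs_form_fst_self (h : IsConjugateNet v w U z C) (hM : M.IsSymm)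
    (hz : ∀ p ∈ U, form M (z p) (z p) = 0) (hp : p ∈ U) :
    HasDirDerivs v w (fun p => form M (dirDeriv v z p) (dirDeriv v z p)) p
      (2 * form M (dirDeriv v z p) (dirDeriv v (dirDeriv v z) p))
      (-2 * C.a p * form M (dirDeriv v z p) (dirDeriv v z p)) := by
  refine ((h.hasDirDerivs_fst hp).bilin (form M) (h.hasDirDerivs_fst hp)).congr ?_ ?_
  · rw [form_comm hM _ (dirDeriv v z p)]; ring
  · rw [form_comm hM _ (dirDeriv v z p), h.map_hyperbolic hp, h.form_fst_snd hM hz hp,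
      form_comm hM _ (z p), h.form_fst hM hz hp]
    ring

theorem q_mul_form_fst_fst (h : IsConjugateNet v w U z C) (hM : M.IsSymm)
    (hz : ∀ p ∈ U, form M (z p) (z p) = 0) (hp : p ∈ U) :
    C.q p * form M (dirDeriv v z p) (dirDeriv v (dirDeriv v z) p) =
      (C.b p * C.q p - C.m p) * form M (dirDeriv v z p) (dirDeriv v z p) := by
  have hd := (HasDirDerivs.eq_of_eqOn h.isOpen hp (fun p hp => h.form_fst_snd hM hz hp)
    ((h.hasDirDerivs_fst hp).bilin (form M) (h.hasDirDerivs_snd hp)) (.const 0)).2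
  have hvw := h.map_hyperbolic hp (form M (dirDeriv w z p))
  have hww := h.map_second hp (form M (dirDeriv v z p))
  rw [form_comm hM _ (z p), h.form_snd hM hz hp, form_comm hM _ (dirDeriv v z p),
    h.form_fst_snd hM hz hp, h.form_snd_snd hM hz hp] at hvw
  rw [form_comm hM _ (z p), h.form_fst hM hz hp, h.form_fst_snd hM hz hp] at hww
  rw [form_comm hM _ (dirDeriv w z p)] at hd
  linear_combination -hd + hvw + hww

theorem dirDeriv_q_mul_form_fst_self (h : IsConjugateNet v w U z C) (hM : M.IsSymm)
    (hz : ∀ p ∈ U, form M (z p) (z p) = 0) (hp : p ∈ U) :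
    dirDeriv v C.q p * form M (dirDeriv v z p) (dirDeriv v z p) +
        2 * C.q p * form M (dirDeriv v z p) (dirDeriv v (dirDeriv v z) p) =
      -2 * C.b p * C.q p * form M (dirDeriv v z p) (dirDeriv v z p) := by
  have hd := (HasDirDerivs.eq_of_eqOn h.isOpen hp (fun p hp => h.form_snd_snd hM hz hp)
    ((h.hasDirDerivs_snd hp).bilin (form M) (h.hasDirDerivs_snd hp))
    ((HasDirDerivs.of_contDiffOn h.isOpen h.smooth_q hp).neg.mul
      (h.hasDirDerivs_form_fst_self hM hz hp))).1
  have hvw := h.map_hyperbolic hp (form M (dirDeriv w z p))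
  rw [form_comm hM _ (z p), h.form_snd hM hz hp, form_comm hM _ (dirDeriv v z p),
    h.form_fst_snd hM hz hp, h.form_snd_snd hM hz hp] at hvw
  rw [form_comm hM _ (dirDeriv w z p)] at hd
  linear_combination hd - 2 * hvw

theorem two_mul_m_eq (h : IsConjugateNet v w U z C) (hq : IsQuadricOn U z) (hp : p ∈ U) :
    2 * C.m p = 4 * C.b p * C.q p + dirDeriv v C.q p := by
  obtain ⟨M, hM, hdet, hz⟩ := hq.exists_form_eq_zero
  refine mul_right_cancel₀ (h.form_fst_self_ne_zero hM hdet hz hp) ?_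
  linear_combination
    2 * h.q_mul_form_fst_fst hM hz hp - h.dirDeriv_q_mul_form_fst_self hM hz hp

/-- Equality of the mixed second derivatives of `log ⟨z_v, z_v⟩`. -/
theorem dirDeriv_a_eq_dirDeriv_b (h : IsConjugateNet v w U z C) (hq : IsQuadricOn U z)
    {μ : 𝕜 × 𝕜 → 𝕜} (hμ : ContDiffOn 𝕜 ∞ μ U) (hqμ : ∀ p ∈ U, dirDeriv v C.q p = μ p * C.q p)
    (hμw : ∀ p ∈ U, dirDeriv w μ p = 0) (hp : p ∈ U) : dirDeriv v C.a p = dirDeriv w C.b p := by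
  obtain ⟨M, hM, hdet, hz⟩ := hq.exists_form_eq_zero
  have hU := h.isOpen
  have hφ := ((HasDirDerivs.const (v := v) (w := w) (-2 : 𝕜)).mul
    (.of_contDiffOn hU h.smooth_b hp)).sub (.of_contDiffOn hU hμ hp)
  have hψ := (HasDirDerivs.const (v := v) (w := w) (-2 : 𝕜)).mul
    (.of_contDiffOn hU h.smooth_a hp)
  have hv_smooth : ContDiffOn 𝕜 ∞ (dirDeriv v z) U := contDiffOn_dirDeriv hU h.smooth
  have hcross := dirDeriv_eq_of_logarithmic (v := v) (φ := fun p => -2 * C.b p - μ p)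
    (ψ := fun p => -2 * C.a p) hU (contDiffOn_form M hv_smooth hv_smooth)
    ((contDiffOn_const.mul h.smooth_b).sub hμ) (contDiffOn_const.mul h.smooth_a)
    (fun p hp => ?_) (fun p hp => (h.hasDirDerivs_form_fst_self hM hz hp).snd) hp
    (h.form_fst_self_ne_zero hM hdet hz hp)
  · rw [hφ.snd, hψ.fst, hμw p hp] at hcross
    linear_combination hcross / 2
  · have hAv := h.dirDeriv_q_mul_form_fst_self hM hz hp
    rw [hqμ p hp] at hAv
    rw [(h.hasDirDerivs_form_fst_self hM hz hp).fst]
    exact mul_left_cancel₀ (h.q_ne_zero p hp) (by linear_combination hAv)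

theorem hasDirDerivs_laplaceTransform (h : IsConjugateNet v w U z C) (hp : p ∈ U) :
    HasDirDerivs v w (laplaceTransform w C z) p
      (-C.b p • laplaceTransform w C z p + laplaceInvariant v C p • z p)
      (dirDeriv w (dirDeriv w z) p + (dirDeriv w C.a p • z p + C.a p • dirDeriv w z p)) := by
  refine ((h.hasDirDerivs_snd hp).add
    ((HasDirDerivs.of_contDiffOn h.isOpen h.smooth_a hp).smul (h.hasDirDerivs hp))).congr ?_ rfl
  have hvw : dirDeriv w (dirDeriv v z) p =
      -C.a p • dirDeriv v z p - C.b p • dirDeriv w z p - C.c p • z p := by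
    rw [← sub_eq_zero, ← h.hyperbolic p hp]; module
  rw [hvw, laplaceTransform, laplaceInvariant]
  module

section LaplaceTransform

variable (h : IsConjugateNet v w U z C) (hM : M.IsSymm)
  (hX : ∀ p ∈ U, form M (laplaceTransform w C z p) (laplaceTransform w C z p) = 0)
  (hne : ∀ p ∈ U, laplaceInvariant v C p ≠ 0)

include h hM hX hne

theorem form_laplaceTransform (hp : p ∈ U) : form M (laplaceTransform w C z p) (z p) = 0 := by
  have hd := (HasDirDerivs.eq_of_eqOn h.isOpen hp hX ((h.hasDirDerivs_laplaceTransform hp).bilin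
    (form M) (h.hasDirDerivs_laplaceTransform hp)) (.const 0)).1
  rw [form_comm hM _ (laplaceTransform w C z p)] at hd
  simp only [map_add, map_smul, smul_eq_mul, hX p hp] at hd
  exact mul_left_cancel₀ (hne p hp) (by linear_combination hd / 2)

theorem form_laplaceTransform_snd (hp : p ∈ U) :
    form M (laplaceTransform w C z p) (dirDeriv w z p) = 0 := by
  have hw : dirDeriv w z p = laplaceTransform w C z p - C.a p • z p := by simp [laplaceTransform]
  rw [hw, map_sub, map_smul, hX p hp, h.form_laplaceTransform hM hX hne hp, smul_zero, sub_zero]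

theorem form_laplaceTransform_snd_snd (hp : p ∈ U) :
    form M (laplaceTransform w C z p) (dirDeriv w (dirDeriv w z) p) = 0 := by
  have hd := (HasDirDerivs.eq_of_eqOn h.isOpen hp hX ((h.hasDirDerivs_laplaceTransform hp).bilin
    (form M) (h.hasDirDerivs_laplaceTransform hp)) (.const 0)).2
  rw [form_comm hM _ (laplaceTransform w C z p)] at hd
  simp only [map_add, map_smul, smul_eq_mul, h.form_laplaceTransform hM hX hne hp,
    h.form_laplaceTransform_snd hM hX hne hp] at hd
  linear_combination hd / 2

theorem form_laplaceTransform_fst (hp : p ∈ U) :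
    form M (laplaceTransform w C z p) (dirDeriv v z p) =
      -laplaceInvariant v C p * form M (z p) (z p) := by
  have hd := (HasDirDerivs.eq_of_eqOn h.isOpen hp
    (fun p hp => h.form_laplaceTransform hM hX hne hp)
    ((h.hasDirDerivs_laplaceTransform hp).bilin (form M) (h.hasDirDerivs hp)) (.const 0)).1
  simp only [map_add, map_smul, add_apply, smul_apply, smul_eq_mul,
    h.form_laplaceTransform hM hX hne hp] at hd
  linear_combination hd

theorem q_mul_form_laplaceTransform_fst_fst (hp : p ∈ U) :
    C.q p * form M (laplaceTransform w C z p) (dirDeriv v (dirDeriv v z) p) =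
      C.m p * laplaceInvariant v C p * form M (z p) (z p) := by
  have hww := h.map_second hp (form M (laplaceTransform w C z p))
  rw [h.form_laplaceTransform_snd_snd hM hX hne hp, h.form_laplaceTransform_snd hM hX hne hp,
    h.form_laplaceTransform hM hX hne hp, h.form_laplaceTransform_fst hM hX hne hp] at hww
  linear_combination hww

theorem hasDirDerivs_form_self (hp : p ∈ U) :
    HasDirDerivs v w (fun p => form M (z p) (z p)) p (2 * form M (z p) (dirDeriv v z p))
      (-2 * C.a p * form M (z p) (z p)) := by
  have hw : dirDeriv w z p = laplaceTransform w C z p - C.a p • z p := by simp [laplaceTransform]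
  refine ((h.hasDirDerivs hp).bilin (form M) (h.hasDirDerivs hp)).congr ?_ ?_
  · rw [form_comm hM _ (z p)]; ring
  · rw [form_comm hM _ (z p), hw, map_sub, map_smul, form_comm hM _ (laplaceTransform w C z p),
      h.form_laplaceTransform hM hX hne hp, smul_eq_mul]
    ring

theorem form_laplaceTransform_fst_fst (hp : p ∈ U) :
    form M (laplaceTransform w C z p) (dirDeriv v (dirDeriv v z) p) =
      -dirDeriv v (laplaceInvariant v C) p * form M (z p) (z p)
        - 3 * laplaceInvariant v C p * form M (z p) (dirDeriv v z p)
        - C.b p * laplaceInvariant v C p * form M (z p) (z p) := by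
  have hd := (HasDirDerivs.eq_of_eqOn h.isOpen hp
    (fun p hp => h.form_laplaceTransform_fst hM hX hne hp)
    ((h.hasDirDerivs_laplaceTransform hp).bilin (form M) (h.hasDirDerivs_fst hp))
    ((HasDirDerivs.of_contDiffOn h.isOpen h.contDiffOn_laplaceInvariant hp).neg.mul
      (h.hasDirDerivs_form_self hM hX hne hp))).1
  simp only [map_add, map_smul, add_apply, smul_apply, smul_eq_mul,
    h.form_laplaceTransform_fst hM hX hne hp] at hd
  linear_combination hd

theorem form_self_ne_zero (hdet : M.det ≠ 0) (hp : p ∈ U) : form M (z p) (z p) ≠ 0 := fun h0 => by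
  have hvv := h.q_mul_form_laplaceTransform_fst_fst hM hX hne hp
  rw [h0, mul_zero] at hvv
  have hX0 : laplaceTransform w C z p = 0 := by
    refine eq_zero_of_form_eq_zero hdet (h.frame p hp) fun i => ?_
    rw [form_comm hM]
    revert i
    simp [Fin.forall_fin_succ, h.form_laplaceTransform hM hX hne hp,
      h.form_laplaceTransform_fst hM hX hne hp, h.form_laplaceTransform_snd hM hX hne hp, h0,
      (mul_eq_zero.1 hvv).resolve_left (h.q_ne_zero p hp)]
  have hcoeff := Fintype.linearIndependent_iff.1 (h.frame p hp) ![C.a p, 0, 1, 0] (by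
    simpa [Fin.sum_univ_four, laplaceTransform, add_comm] using hX0) 2
  simp at hcoeff

theorem dirDeriv_form_self (hq : IsQuadricOn U z) {μ : 𝕜 × 𝕜 → 𝕜}
    (hqμ : ∀ p ∈ U, dirDeriv v C.q p = μ p * C.q p) (hp : p ∈ U) :
    dirDeriv v (fun p => form M (z p) (z p)) p =
      ((-2 / 3) * (dirDeriv v (laplaceInvariant v C) p / laplaceInvariant v C p)
        + (-2) * C.b p + (-1 / 3) * μ p) * form M (z p) (z p) := by
  have hm := h.two_mul_m_eq hq hp
  have hlog := div_mul_cancel₀ (dirDeriv v (laplaceInvariant v C) p) (hne p hp)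
  rw [hqμ p hp] at hm
  rw [(h.hasDirDerivs_form_self hM hX hne hp).fst]
  refine mul_left_cancel₀ (mul_ne_zero (hne p hp) (h.q_ne_zero p hp)) ?_
  linear_combination (-2 / 3) * h.q_mul_form_laplaceTransform_fst_fst hM hX hne hp
    + 2 / 3 * C.q p * h.form_laplaceTransform_fst_fst hM hX hne hp
    - 1 / 3 * laplaceInvariant v C p * form M (z p) (z p) * hm
    + 2 / 3 * C.q p * form M (z p) (z p) * hlog

end LaplaceTransform

/-- If `(log q)_vw = 0`, equality of the mixed second derivatives of `log ⟨z, z⟩` in the form of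
the second quadric reads `(log h)_vw = 0`, stated here without division by `h`. -/
theorem laplaceInvariant_mul_dirDeriv (h : IsConjugateNet v w U z C) (hq : IsQuadricOn U z)
    (hq' : IsQuadricOn U (laplaceTransform w C z)) {μ : 𝕜 × 𝕜 → 𝕜} (hμ : ContDiffOn 𝕜 ∞ μ U)
    (hqμ : ∀ p ∈ U, dirDeriv v C.q p = μ p * C.q p) (hμw : ∀ p ∈ U, dirDeriv w μ p = 0)
    (hne : ∀ p ∈ U, laplaceInvariant v C p ≠ 0) (hp : p ∈ U) :
    dirDeriv w (dirDeriv v (laplaceInvariant v C)) p * laplaceInvariant v C p =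
      dirDeriv v (laplaceInvariant v C) p * dirDeriv w (laplaceInvariant v C) p := by
  obtain ⟨M, hM, hdet, hX⟩ := hq'.exists_form_eq_zero
  have hU := h.isOpen
  have hk := h.contDiffOn_laplaceInvariant
  have hkv : ContDiffOn 𝕜 ∞ (dirDeriv v (laplaceInvariant v C)) U := contDiffOn_dirDeriv hU hk
  have hcross := dirDeriv_eq_of_logarithmic hU (contDiffOn_form M h.smooth h.smooth)
    (((contDiffOn_const.mul (hkv.div hk hne)).add (contDiffOn_const.mul h.smooth_b)).add
      (contDiffOn_const.mul hμ)) (contDiffOn_const.mul h.smooth_a)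
    (fun p hp => h.dirDeriv_form_self hM hX hne hq hqμ hp)
    (fun p hp => (h.hasDirDerivs_form_self hM hX hne hp).snd) hp
    (h.form_self_ne_zero hM hX hne hdet hp)
  have hφ := (((HasDirDerivs.const (v := v) (w := w) (-2 / 3 : 𝕜)).mul
    ((HasDirDerivs.of_contDiffOn hU hkv hp).div (.of_contDiffOn hU hk hp) (hne p hp))).add
    ((HasDirDerivs.const (-2 : 𝕜)).mul (.of_contDiffOn hU h.smooth_b hp))).add
    ((HasDirDerivs.const (-1 / 3 : 𝕜)).mul (.of_contDiffOn hU hμ hp))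
  have hψ := (HasDirDerivs.const (v := v) (w := w) (-2 : 𝕜)).mul
    (.of_contDiffOn hU h.smooth_a hp)
  replace hcross := hφ.snd.symm.trans (hcross.trans hψ.fst)
  rw [hμw p hp, h.dirDeriv_a_eq_dirDeriv_b hq hμ hqμ hμw hp] at hcross
  have hquot : (dirDeriv w (dirDeriv v (laplaceInvariant v C)) p * laplaceInvariant v C p -
      dirDeriv v (laplaceInvariant v C) p * dirDeriv w (laplaceInvariant v C) p) /
        laplaceInvariant v C p ^ 2 = 0 := by
    linear_combination (-3 / 2) * hcross
  exact sub_eq_zero.1 ((div_eq_zero_iff.1 hquot).resolve_right (pow_ne_zero 2 (hne p hp)))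

theorem laplaceInvariant_mul_dirDeriv_of_ne_zero (h : IsConjugateNet v w U z C)
    (hq : IsQuadricOn U z) (hq' : IsQuadricOn U (laplaceTransform w C z)) {μ : 𝕜 × 𝕜 → 𝕜}
    (hμ : ContDiffOn 𝕜 ∞ μ U) (hqμ : ∀ p ∈ U, dirDeriv v C.q p = μ p * C.q p)
    (hμw : ∀ p ∈ U, dirDeriv w μ p = 0) (hp : p ∈ U) (hne : laplaceInvariant v C p ≠ 0) :
    dirDeriv w (dirDeriv v (laplaceInvariant v C)) p * laplaceInvariant v C p =
      dirDeriv v (laplaceInvariant v C) p * dirDeriv w (laplaceInvariant v C) p := by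
  have hVU : U ∩ {p | laplaceInvariant v C p ≠ 0} ⊆ U := Set.inter_subset_left
  exact (h.mono (h.contDiffOn_laplaceInvariant.continuousOn.isOpen_inter_preimage h.isOpen
    isOpen_ne) hVU).laplaceInvariant_mul_dirDeriv (hq.mono hVU) (hq'.mono hVU) (hμ.mono hVU)
    (fun p hp => hqμ p hp.1) (fun p hp => hμw p hp.1) (fun p hp => hp.2) ⟨hp, hne⟩

end IsConjugateNet

end ConjugateNets

section Gauge

variable {𝕜 : Type*} [RCLike 𝕜] {U : Set (𝕜 × 𝕜)} {z y : 𝕜 × 𝕜 → (Fin 4 → 𝕜)}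
  {C C' : ConjugateCoeffs 𝕜} {f : 𝕜 × 𝕜 → 𝕜} {p : 𝕜 × 𝕜}

/-- The coefficients of the conjugate system satisfied by `f • y`, where `y` solves the conjugate
system with coefficients `C`. -/
noncomputable def gaugeCoeffs (C : ConjugateCoeffs 𝕜) (f : 𝕜 × 𝕜 → 𝕜) : ConjugateCoeffs 𝕜 where
  a := fun p => C.a p - pd₂ f p / f p
  b := fun p => C.b p - pd₁ f p / f p
  c := fun p => C.c p - C.a p * (pd₁ f p / f p) - C.b p * (pd₂ f p / f p)
    + 2 * (pd₁ f p / f p) * (pd₂ f p / f p) - pd₂ (pd₁ f) p / f p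
  q := C.q
  m := fun p => C.m p - 2 * C.q p * (pd₁ f p / f p)
  n := fun p => C.n p - 2 * (pd₂ f p / f p)
  r := fun p => C.r p - C.m p * (pd₁ f p / f p) - C.n p * (pd₂ f p / f p)
    + 2 * (pd₂ f p / f p) ^ 2 - pd₂ (pd₂ f) p / f p
    + C.q p * (2 * (pd₁ f p / f p) ^ 2 - pd₁ (pd₁ f) p / f p)

section Derivatives

variable (hU : IsOpen U) (hf : ContDiffOn 𝕜 ∞ f U) (hy : ContDiffOn 𝕜 ∞ y U)
  (hz : ∀ p ∈ U, z p = f p • y p)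

include hU hf hy hz

theorem hasPartials_of_eq_smul (hp : p ∈ U) :
    HasPartials z p (pd₁ f p • y p + f p • pd₁ y p) (pd₂ f p • y p + f p • pd₂ y p) :=
  ((HasPartials.of_contDiffOn hU hf hp).smul (HasPartials.of_contDiffOn hU hy hp)).congr_of_eqOn
    hU hp fun p hp => (hz p hp).symm

theorem hasPartials_pd₁_of_eq_smul (hp : p ∈ U) :
    HasPartials (pd₁ z) p
      (pd₁ (pd₁ f) p • y p + (2 * pd₁ f p) • pd₁ y p + f p • pd₁ (pd₁ y) p)
      (pd₂ (pd₁ f) p • y p + pd₁ f p • pd₂ y p + pd₂ f p • pd₁ y p + f p • pd₂ (pd₁ y) p) := by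
  refine (HasDirDerivs.congr_of_eqOn
    (((HasPartials.of_contDiffOn hU (contDiffOn_pd₁ hU hf) hp).smul (.of_contDiffOn hU hy hp)).add
      ((HasPartials.of_contDiffOn hU hf hp).smul (.of_contDiffOn hU (contDiffOn_pd₁ hU hy) hp)))
    hU hp fun p hp => (hasPartials_of_eq_smul hU hf hy hz hp).fst.symm).congr ?_ ?_ <;>
  simp only [pd₁, pd₂, dirDeriv] <;> module

theorem hasPartials_pd₂_of_eq_smul (hp : p ∈ U) :
    HasPartials (pd₂ z) p
      (pd₁ (pd₂ f) p • y p + pd₁ f p • pd₂ y p + pd₂ f p • pd₁ y p + f p • pd₁ (pd₂ y) p)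
      (pd₂ (pd₂ f) p • y p + (2 * pd₂ f p) • pd₂ y p + f p • pd₂ (pd₂ y) p) := by
  refine (HasDirDerivs.congr_of_eqOn
    (((HasPartials.of_contDiffOn hU (contDiffOn_pd₂ hU hf) hp).smul (.of_contDiffOn hU hy hp)).add
      ((HasPartials.of_contDiffOn hU hf hp).smul (.of_contDiffOn hU (contDiffOn_pd₂ hU hy) hp)))
    hU hp fun p hp => (hasPartials_of_eq_smul hU hf hy hz hp).snd.symm).congr ?_ ?_ <;>
  simp only [pd₁, pd₂, dirDeriv] <;> module

end Derivatives

theorem gaugeCoeffs_h (hU : IsOpen U) (ha : ContDiffOn 𝕜 ∞ C.a U) (hf : ContDiffOn 𝕜 ∞ f U)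
    (hf0 : ∀ p ∈ U, f p ≠ 0) (hp : p ∈ U) : (gaugeCoeffs C f).h p = C.h p := by
  have hfp := hf0 p hp
  have ha₁ : pd₁ (gaugeCoeffs C f).a p = _ := ((HasPartials.of_contDiffOn hU ha hp).sub
    ((HasPartials.of_contDiffOn hU (contDiffOn_pd₂ hU hf) hp).div
      (HasPartials.of_contDiffOn hU hf hp) hfp)).fst
  rw [ConjugateCoeffs.h, ha₁, ConjugateCoeffs.h, pd₁_pd₂_comm hU hf hp]
  simp only [gaugeCoeffs]
  field_simp
  ring

theorem gaugeCoeffs_k (hU : IsOpen U) (hb : ContDiffOn 𝕜 ∞ C.b U) (hf : ContDiffOn 𝕜 ∞ f U)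
    (hf0 : ∀ p ∈ U, f p ≠ 0) (hp : p ∈ U) : (gaugeCoeffs C f).k p = C.k p := by
  have hfp := hf0 p hp
  have hb₂ : pd₂ (gaugeCoeffs C f).b p = _ := ((HasPartials.of_contDiffOn hU hb hp).sub
    ((HasPartials.of_contDiffOn hU (contDiffOn_pd₁ hU hf) hp).div
      (HasPartials.of_contDiffOn hU hf hp) hfp)).snd
  rw [ConjugateCoeffs.k, hb₂, ConjugateCoeffs.k]
  simp only [gaugeCoeffs]
  field_simp
  ring

theorem IsQuadricOn.of_smul (h : IsQuadricOn U z) (hf0 : ∀ p ∈ U, f p ≠ 0)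
    (hz : ∀ p ∈ U, z p = f p • y p) : IsQuadricOn U y := by
  obtain ⟨M, hM, hdet, hzM⟩ := h
  refine ⟨M, hM, hdet, fun p hp => ?_⟩
  have hzp := hzM p hp
  rw [hz p hp, Matrix.mulVec_smul, smul_dotProduct, dotProduct_smul] at hzp
  simpa [hf0 p hp] using hzp

theorem linearIndependent_smul_triangular {c : 𝕜} {e u : Fin 4 → (Fin 4 → 𝕜)}
    {a₁ a₂ a₃ b₃ : 𝕜} (hu : LinearIndependent 𝕜 u) (hc : c ≠ 0) (h₀ : e 0 = c • u 0)
    (h₁ : e 1 = a₁ • u 0 + c • u 1) (h₂ : e 2 = a₂ • u 0 + c • u 2)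
    (h₃ : e 3 = a₃ • u 0 + b₃ • u 1 + c • u 3) : LinearIndependent 𝕜 e := by
  refine linearIndependent_of_dotProduct_eq_zero fun x hx =>
    eq_zero_of_dotProduct_eq_zero hu ?_
  have hx₀ : u 0 ⬝ᵥ x = 0 := by simpa [h₀, hc] using hx 0
  have hx₁ : u 1 ⬝ᵥ x = 0 := by simpa [h₁, hc, hx₀] using hx 1
  have hx₂ : u 2 ⬝ᵥ x = 0 := by simpa [h₂, hc, hx₀] using hx 2
  have hx₃ : u 3 ⬝ᵥ x = 0 := by simpa [h₃, hc, hx₀, hx₁] using hx 3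
  exact Fin.forall_fin_succ.2 ⟨hx₀, by simp [Fin.forall_fin_succ, hx₁, hx₂, hx₃]⟩

/-- A conjugate net with second fundamental form `ds² - q dt²` is isothermally conjugate if
`(log q)_st = 0`. The condition is stated through the logarithmic derivatives of `q`, so that no
branch of the logarithm is needed. -/
structure IsIsothermallyConjugate (U : Set (𝕜 × 𝕜)) (q : 𝕜 × 𝕜 → 𝕜) : Prop where
  exists_fst : ∃ μ : 𝕜 × 𝕜 → 𝕜, ContDiffOn 𝕜 ∞ μ U ∧ (∀ p ∈ U, pd₁ q p = μ p * q p) ∧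
    ∀ p ∈ U, pd₂ μ p = 0
  exists_snd : ∃ ν : 𝕜 × 𝕜 → 𝕜, ContDiffOn 𝕜 ∞ ν U ∧ (∀ p ∈ U, pd₂ q p = ν p * q p) ∧
    ∀ p ∈ U, pd₁ ν p = 0

theorem IsIsothermallyConjugate.of_separable {φ ψ : 𝕜 → 𝕜} (hφ : ContDiff 𝕜 ∞ φ)
    (hψ : ContDiff 𝕜 ∞ ψ) (hφ0 : ∀ p ∈ U, φ p.1 ≠ 0) (hψ0 : ∀ p ∈ U, ψ p.2 ≠ 0) :
    IsIsothermallyConjugate U fun p => φ p.1 / ψ p.2 := by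
  have hφ' := (contDiff_infty_iff_deriv.1 hφ).2
  have hψ' := (contDiff_infty_iff_deriv.1 hψ).2
  have hd {f : 𝕜 → 𝕜} (hf : ContDiff 𝕜 ∞ f) : Differentiable 𝕜 f := hf.differentiable (by simp)
  have hq : ∀ p ∈ U, _ := fun p hp => ((HasDirDerivs.comp_fst (hd hφ p.1)).div
    (.comp_snd (hd hψ p.2)) (hψ0 p hp))
  refine ⟨⟨fun p => deriv φ p.1 / φ p.1, ?_, fun p hp => ?_, fun p hp => ?_⟩,
    ⟨fun p => -(deriv ψ p.2 / ψ p.2), ?_, fun p hp => ?_, fun p hp => ?_⟩⟩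
  · exact (hφ'.comp contDiff_fst).contDiffOn.div (hφ.comp contDiff_fst).contDiffOn hφ0
  · have hφp := hφ0 p hp
    have hψp := hψ0 p hp
    rw [show pd₁ _ p = _ from (hq p hp).fst]
    field_simp
    simp
  · exact ((HasDirDerivs.comp_fst (hd hφ' p.1)).div (.comp_fst (hd hφ p.1)) (hφ0 p hp)).snd.trans
      (by simp)
  · exact ((hψ'.comp contDiff_snd).contDiffOn.div (hψ.comp contDiff_snd).contDiffOn hψ0).neg
  · have hψp := hψ0 p hp
    rw [show pd₂ _ p = _ from (hq p hp).snd]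
    field_simp
    simp
  · exact ((HasDirDerivs.comp_snd (hd hψ' p.2)).div (.comp_snd (hd hψ p.2))
      (hψ0 p hp)).neg.fst.trans (by simp)

namespace IsConjugateSystem

theorem mono (h : IsConjugateSystem U z C) {V : Set (𝕜 × 𝕜)} (hVU : V ⊆ U) :
    IsConjugateSystem V z C :=
  ⟨h.smooth_a.mono hVU, h.smooth_b.mono hVU, h.smooth_c.mono hVU, h.smooth_q.mono hVU,
    h.smooth_m.mono hVU, h.smooth_n.mono hVU, h.smooth_r.mono hVU,
    fun p hp => h.q_ne_zero p (hVU hp), fun p hp => h.frame p (hVU hp),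
    fun p hp => h.hyperbolic p (hVU hp), fun p hp => h.second p (hVU hp)⟩

theorem gauge (h : IsConjugateSystem U y C) (hU : IsOpen U) (hy : ContDiffOn 𝕜 ∞ y U)
    (hf : ContDiffOn 𝕜 ∞ f U) (hf0 : ∀ p ∈ U, f p ≠ 0) (hz : ∀ p ∈ U, z p = f p • y p) :
    IsConjugateSystem U z (gaugeCoeffs C f) := by
  have h₁ := (contDiffOn_pd₁ hU hf).div hf hf0
  have h₂ := (contDiffOn_pd₂ hU hf).div hf hf0
  have h₁₁ := (contDiffOn_pd₁ hU (contDiffOn_pd₁ hU hf)).div hf hf0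
  have h₁₂ := (contDiffOn_pd₂ hU (contDiffOn_pd₁ hU hf)).div hf hf0
  have h₂₂ := (contDiffOn_pd₂ hU (contDiffOn_pd₂ hU hf)).div hf hf0
  refine ⟨h.smooth_a.sub h₂, h.smooth_b.sub h₁, ?_, h.smooth_q,
    h.smooth_m.sub ((contDiffOn_const.mul h.smooth_q).mul h₁),
    h.smooth_n.sub (contDiffOn_const.mul h₂), ?_, h.q_ne_zero, fun p hp => ?_, fun p hp => ?_,
    fun p hp => ?_⟩
  · exact (((h.smooth_c.sub (h.smooth_a.mul h₁)).sub (h.smooth_b.mul h₂)).add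
      ((contDiffOn_const.mul h₁).mul h₂)).sub h₁₂
  · exact ((((h.smooth_r.sub (h.smooth_m.mul h₁)).sub (h.smooth_n.mul h₂)).add
      (contDiffOn_const.mul (h₂.pow 2))).sub h₂₂).add
      (h.smooth_q.mul ((contDiffOn_const.mul (h₁.pow 2)).sub h₁₁))
  all_goals
    have hfp := hf0 p hp
    have hz₁ : pd₁ z p = _ := (hasPartials_of_eq_smul hU hf hy hz hp).fst
    have hz₂ : pd₂ z p = _ := (hasPartials_of_eq_smul hU hf hy hz hp).snd
    have hz₁₁ : pd₁ (pd₁ z) p = _ := (hasPartials_pd₁_of_eq_smul hU hf hy hz hp).fst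
  · exact linearIndependent_smul_triangular (h.frame p hp) hfp (hz p hp) hz₁ hz₂ hz₁₁
  · have hz₁₂ : pd₂ (pd₁ z) p = _ := (hasPartials_pd₁_of_eq_smul hU hf hy hz hp).snd
    rw [hz₁, hz₂, hz₁₂, hz p hp]
    refine Eq.trans ?_ ((congrArg (f p • ·) (h.hyperbolic p hp)).trans (smul_zero _))
    simp only [gaugeCoeffs]
    match_scalars <;> field_simp <;> ring
  · have hz₂₂ : pd₂ (pd₂ z) p = _ := (hasPartials_pd₂_of_eq_smul hU hf hy hz hp).snd
    rw [hz₁, hz₂, hz₁₁, hz₂₂, hz p hp]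
    refine Eq.trans ?_ ((congrArg (f p • ·) (h.second p hp)).trans (smul_zero _))
    simp only [gaugeCoeffs]
    match_scalars <;> field_simp <;> ring

theorem coeff_unique (h : IsConjugateSystem U z C) (h' : IsConjugateSystem U z C')
    (hp : p ∈ U) : C.a p = C'.a p ∧ C.b p = C'.b p ∧ C.c p = C'.c p := by
  have hli := Fintype.linearIndependent_iff.1 (h.frame p hp)
    ![C.c p - C'.c p, C.a p - C'.a p, C.b p - C'.b p, 0] (by
      simp only [Fin.sum_univ_four, Matrix.cons_val_zero, Matrix.cons_val_one, Matrix.cons_val]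
      rw [← sub_eq_zero.2 ((h.hyperbolic p hp).trans (h'.hyperbolic p hp).symm)]
      module)
  exact ⟨sub_eq_zero.1 (hli 1), sub_eq_zero.1 (hli 2), sub_eq_zero.1 (hli 0)⟩

theorem h_eq (h : IsConjugateSystem U z C) (h' : IsConjugateSystem U z C') (hU : IsOpen U)
    (hp : p ∈ U) : C.h p = C'.h p := by
  obtain ⟨ha, hb, hc⟩ := h.coeff_unique h' hp
  rw [ConjugateCoeffs.h, ConjugateCoeffs.h, ha, hb, hc,
    pd₁_congr hU hp fun p hp => (h.coeff_unique h' hp).1]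

theorem k_eq (h : IsConjugateSystem U z C) (h' : IsConjugateSystem U z C') (hU : IsOpen U)
    (hp : p ∈ U) : C.k p = C'.k p := by
  obtain ⟨ha, hb, hc⟩ := h.coeff_unique h' hp
  rw [ConjugateCoeffs.k, ConjugateCoeffs.k, ha, hb, hc,
    pd₂_congr hU hp fun p hp => (h.coeff_unique h' hp).2.1]

theorem pd₁_a_eq_pd₂_b (h : IsConjugateSystem U z C) (hU : IsOpen U) (hz : ContDiffOn 𝕜 ∞ z U)
    (hq : IsIsothermallyConjugate U C.q) (hQ : IsQuadricOn U z) (hp : p ∈ U) :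
    pd₁ C.a p = pd₂ C.b p := by
  obtain ⟨μ, hμ, hqμ, hμ₂⟩ := hq.exists_fst
  exact (h.isConjugateNet hU hz).dirDeriv_a_eq_dirDeriv_b hQ hμ hqμ hμ₂ hp

theorem pd₂_pd₁_h_mul_h (h : IsConjugateSystem U z C) (hU : IsOpen U) (hz : ContDiffOn 𝕜 ∞ z U)
    (hq : IsIsothermallyConjugate U C.q) (hQ : PosFocalQuadrics U z C) (hp : p ∈ U)
    (hne : C.h p ≠ 0) : pd₂ (pd₁ C.h) p * C.h p = pd₁ C.h p * pd₂ C.h p := by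
  obtain ⟨μ, hμ, hqμ, hμ₂⟩ := hq.exists_fst
  exact (h.isConjugateNet hU hz).laplaceInvariant_mul_dirDeriv_of_ne_zero hQ.1 hQ.2 hμ hqμ hμ₂ hp
    hne

theorem pd₂_pd₁_k_mul_k (h : IsConjugateSystem U z C) (hU : IsOpen U) (hz : ContDiffOn 𝕜 ∞ z U)
    (hq : IsIsothermallyConjugate U C.q) (hQ : NegFocalQuadrics U z C) (hp : p ∈ U)
    (hne : C.k p ≠ 0) : pd₂ (pd₁ C.k) p * C.k p = pd₁ C.k p * pd₂ C.k p := by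
  obtain ⟨ν, hν, hqν, hν₁⟩ := hq.exists_snd
  have hnet := (h.isConjugateNet hU hz).swap
  have hk : laplaceInvariant (0, 1) (swapCoeffs C) = C.k :=
    funext fun p => congrArg (· + pd₂ C.b p - C.c p) (mul_comm (C.b p) (C.a p))
  have hlog := hnet.laplaceInvariant_mul_dirDeriv_of_ne_zero (p := p) hQ.1 hQ.2 hν.neg
    (fun p hp => ?_) (fun p hp => ?_) hp (hk.symm ▸ hne)
  · rw [hk] at hlog
    rw [← pd₁_pd₂_comm hU (hk ▸ hnet.contDiffOn_laplaceInvariant) hp, mul_comm (pd₁ C.k p)]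
    exact hlog
  · have hq0 := h.q_ne_zero p hp
    refine ((HasPartials.of_contDiffOn hU h.smooth_q hp).inv hq0).snd.trans ?_
    rw [hqν p hp]
    simp only [swapCoeffs]
    field_simp
  · exact (HasPartials.of_contDiffOn hU hν hp).neg.fst.trans (neg_eq_zero.2 (hν₁ p hp))

end IsConjugateSystem

namespace IsGaugedPullback

variable {T : 𝕜 × 𝕜 → 𝕜 × 𝕜} {V : Set (𝕜 × 𝕜)} {F : 𝕜 × 𝕜 → (Fin 4 → 𝕜)}

theorem exists_isConjugateSystem (hg : IsGaugedPullback T V F U z)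
    (hy : ContDiffOn 𝕜 ∞ (fun p => F (T p)) U) (h : IsConjugateSystem U (fun p => F (T p)) C) :
    ∃ C', IsConjugateSystem U z C' := by
  obtain ⟨f, hf, hf0, hz⟩ := hg.gauge
  exact ⟨_, h.gauge hg.isOpen hy hf hf0 hz⟩

theorem h_eq_zero (hg : IsGaugedPullback T V F U z) (hy : ContDiffOn 𝕜 ∞ (fun p => F (T p)) U)
    (h : IsConjugateSystem U (fun p => F (T p)) C)
    (hpos : PosFocalQuadrics U (fun p => F (T p)) C → ∀ p ∈ U, C.h p = 0)
    (h' : IsConjugateSystem U z C') (hQ : PosFocalQuadrics U z C') (hp : p ∈ U) :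
    C'.h p = 0 := by
  have hU := hg.isOpen
  obtain ⟨f, hf, hf0, hz⟩ := hg.gauge
  have hgauge := h.gauge hU hy hf hf0 hz
  rw [h'.h_eq hgauge hU hp, gaugeCoeffs_h hU h.smooth_a hf hf0 hp]
  refine hpos ⟨hQ.1.of_smul hf0 hz, hQ.2.of_smul hf0 fun p hp => ?_⟩ p hp
  have hz₂ : pd₂ z p = _ := (hasPartials_of_eq_smul hU hf hy hz hp).snd
  have hfp := hf0 p hp
  rw [laplacePos, laplacePos, hz₂, hz p hp, (h'.coeff_unique hgauge hp).1]
  simp only [gaugeCoeffs]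
  match_scalars <;> field_simp
  ring

theorem k_eq_zero (hg : IsGaugedPullback T V F U z) (hy : ContDiffOn 𝕜 ∞ (fun p => F (T p)) U)
    (h : IsConjugateSystem U (fun p => F (T p)) C)
    (hneg : NegFocalQuadrics U (fun p => F (T p)) C → ∀ p ∈ U, C.k p = 0)
    (h' : IsConjugateSystem U z C') (hQ : NegFocalQuadrics U z C') (hp : p ∈ U) :
    C'.k p = 0 := by
  have hU := hg.isOpen
  obtain ⟨f, hf, hf0, hz⟩ := hg.gauge
  have hgauge := h.gauge hU hy hf hf0 hz
  rw [h'.k_eq hgauge hU hp, gaugeCoeffs_k hU h.smooth_b hf hf0 hp]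
  refine hneg ⟨hQ.1.of_smul hf0 hz, hQ.2.of_smul hf0 fun p hp => ?_⟩ p hp
  have hz₁ : pd₁ z p = _ := (hasPartials_of_eq_smul hU hf hy hz hp).fst
  have hfp := hf0 p hp
  rw [laplaceNeg, laplaceNeg, hz₁, hz p hp, (h'.coeff_unique hgauge hp).2.1]
  simp only [gaugeCoeffs]
  match_scalars <;> field_simp
  ring

end IsGaugedPullback

end Gauge

section AdaptedGramMatrices

variable {𝕜 : Type*} [RCLike 𝕜]

/-- The shape of the Gram matrix of a frame `(z, e₁, e₂, e₃)`, with `e₁`, `e₂` tangent to the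
surface `z`, for a quadratic form vanishing on `z`, normalized by `⟨z, e₃⟩ = -1`. -/
def adaptedGram (e g h a b c : 𝕜) : Matrix (Fin 4) (Fin 4) 𝕜 :=
  !![0, 0, 0, -1; 0, e, g, a; 0, g, h, b; -1, a, b, c]

theorem det_adaptedGram (e g h a b c : 𝕜) : (adaptedGram e g h a b c).det = g ^ 2 - e * h := by
  rw [adaptedGram, Matrix.det_succ_row_zero]
  simp [Fin.sum_univ_four, Matrix.det_fin_three, Matrix.submatrix, Fin.succAbove]
  ring

theorem isSymm_adaptedGram (e g h a b c : 𝕜) : (adaptedGram e g h a b c).IsSymm := by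
  ext i j
  fin_cases i <;> fin_cases j <;> simp [adaptedGram]

open scoped Matrix.Norms.Elementwise in
theorem hasPartials_adaptedGram {e g h a b c : 𝕜 × 𝕜 → 𝕜} {p : 𝕜 × 𝕜}
    {e₁ e₂ g₁ g₂ h₁ h₂ a₁ a₂ b₁ b₂ c₁ c₂ : 𝕜} (he : HasPartials e p e₁ e₂)
    (hg : HasPartials g p g₁ g₂) (hh : HasPartials h p h₁ h₂) (ha : HasPartials a p a₁ a₂)
    (hb : HasPartials b p b₁ b₂) (hc : HasPartials c p c₁ c₂) :
    HasPartials (fun p => adaptedGram (e p) (g p) (h p) (a p) (b p) (c p)) p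
      !![0, 0, 0, 0; 0, e₁, g₁, a₁; 0, g₁, h₁, b₁; 0, a₁, b₁, c₁]
      !![0, 0, 0, 0; 0, e₂, g₂, a₂; 0, g₂, h₂, b₂; 0, a₂, b₂, c₂] := by
  refine .pi fun i => .pi fun j => ?_
  fin_cases i <;> fin_cases j
  all_goals first | exact .const _ | assumption

end AdaptedGramMatrices

section InverseSquares

variable {𝕜 : Type*} [RCLike 𝕜] {U : Set (𝕜 × 𝕜)} {φ : 𝕜 × 𝕜 → 𝕜} {p : 𝕜 × 𝕜}

theorem hasPartials_add : HasPartials (fun p : 𝕜 × 𝕜 => p.1 + p.2) p 1 1 :=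
  (HasDirDerivs.coord₁.add .coord₂).congr (by simp) (by simp)

theorem hasPartials_sub : HasPartials (fun p : 𝕜 × 𝕜 => p.1 - p.2) p 1 (-1) :=
  (HasDirDerivs.coord₁.sub .coord₂).congr (by simp) (by simp)

theorem eq_zero_of_log_inv_sq (hU : IsOpen U) (hd : ∀ p ∈ U, p.1 - p.2 ≠ 0) {c : 𝕜}
    (hφ : ∀ p ∈ U, φ p = c / (p.1 - p.2) ^ 2)
    (h : ∀ p ∈ U, φ p ≠ 0 → pd₂ (pd₁ φ) p * φ p = pd₁ φ p * pd₂ φ p) (hp : p ∈ U) :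
    φ p = 0 := by
  have hφ' : ∀ p ∈ U, HasPartials φ p (-2 * c / (p.1 - p.2) ^ 3) (2 * c / (p.1 - p.2) ^ 3) :=
    fun p hp => ((hasPartials_sub.const_div_pow (hd p hp) c 2).congr_of_eqOn hU hp
      fun p hp => (hφ p hp).symm).congr (by simp) (by simp)
  have hφ'' := (hasPartials_sub.const_div_pow (hd p hp) (-2 * c) 3).congr_of_eqOn hU hp
    fun p hp => (hφ' p hp).fst.symm
  have hdp := hd p hp
  by_contra hne
  have hlog := h p hp hne
  rw [show pd₂ (pd₁ φ) p = _ from hφ''.snd, show pd₁ φ p = _ from (hφ' p hp).fst,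
    show pd₂ φ p = _ from (hφ' p hp).snd, hφ p hp] at hlog
  have hc : c ≠ 0 := fun hc => hne (by rw [hφ p hp, hc, zero_div])
  field_simp at hlog
  norm_num at hlog
  exact hdp hlog

theorem infinite_antidiagonal_slice (hU : IsOpen U) (hp : p ∈ U) :
    {u : 𝕜 | ((u + (p.1 - p.2)) / 2, (u - (p.1 - p.2)) / 2) ∈ U}.Infinite := by
  have hc : Continuous fun u : 𝕜 => ((u + (p.1 - p.2)) / 2, (u - (p.1 - p.2)) / 2) := by
    fun_prop
  refine infinite_of_mem_nhds (p.1 + p.2) (hc.continuousAt.preimage_mem_nhds (hU.mem_nhds ?_))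
  convert hp using 1
  ext <;> simp

open Polynomial in
theorem eq_zero_of_infinite_sextic {P R c : 𝕜} (hc : c ≠ 0) {S : Set 𝕜} (hS : S.Infinite)
    (h : ∀ u ∈ S, R ^ 2 * u ^ 6 + 3 * P * R * c * u ^ 4 - 3 * P * R * c ^ 2 * u ^ 2
      - P ^ 2 * c ^ 3 = 0) : P = 0 ∧ R = 0 := by
  have hpoly : (C (R ^ 2) * X ^ 6 + C (3 * P * R * c) * X ^ 4 - C (3 * P * R * c ^ 2) * X ^ 2
      - C (P ^ 2 * c ^ 3) : 𝕜[X]) = 0 := by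
    refine Polynomial.eq_zero_of_infinite_isRoot _ (hS.mono fun u hu => ?_)
    simpa [IsRoot.def] using h u hu
  have hcoeff₀ := congrArg (coeff · 0) hpoly
  have hcoeff₆ := congrArg (coeff · 6) hpoly
  simp only [coeff_sub, coeff_add, coeff_C_mul, coeff_X_pow, coeff_C] at hcoeff₀ hcoeff₆
  exact ⟨by simpa [hc] using hcoeff₀, by simpa using hcoeff₆⟩

theorem eq_zero_of_log_sum_inv_sq (hU : IsOpen U) (hu : ∀ p ∈ U, p.1 + p.2 ≠ 0)
    (hv : ∀ p ∈ U, p.1 - p.2 ≠ 0) {P R : 𝕜}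
    (hφ : ∀ p ∈ U, φ p = P / (p.1 + p.2) ^ 2 + R / (p.1 - p.2) ^ 2)
    (h : ∀ p ∈ U, φ p ≠ 0 → pd₂ (pd₁ φ) p * φ p = pd₁ φ p * pd₂ φ p) (hp : p ∈ U) :
    φ p = 0 := by
  have hφ' : ∀ p ∈ U, HasPartials φ p (-2 * P / (p.1 + p.2) ^ 3 + -2 * R / (p.1 - p.2) ^ 3)
      (-2 * P / (p.1 + p.2) ^ 3 + 2 * R / (p.1 - p.2) ^ 3) := fun p hp =>
    (((hasPartials_add.const_div_pow (hu p hp) P 2).add (hasPartials_sub.const_div_pow (hv p hp)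
      R 2)).congr_of_eqOn hU hp fun p hp => (hφ p hp).symm).congr (by simp) (by simp)
  have hφ'' : ∀ p ∈ U, pd₂ (pd₁ φ) p = 6 * P / (p.1 + p.2) ^ 4 - 6 * R / (p.1 - p.2) ^ 4 :=
    fun p hp => (((hasPartials_add.const_div_pow (hu p hp) (-2 * P) 3).add
      (hasPartials_sub.const_div_pow (hv p hp) (-2 * R) 3)).congr_of_eqOn hU hp
        fun p hp => (hφ' p hp).fst.symm).snd.trans (by norm_num; ring)
  have hφc : ContinuousOn φ U := fun p hp =>
    (hφ' p hp).differentiableAt.continuousAt.continuousWithinAt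
  by_contra hne
  obtain ⟨hP, hR⟩ := eq_zero_of_infinite_sextic (P := P) (R := R) (pow_ne_zero 2 (hv p hp))
    (infinite_antidiagonal_slice (hφc.isOpen_inter_preimage hU isOpen_ne) ⟨hp, hne⟩)
    fun u hpu => by
      have hlog := h _ hpu.1 hpu.2
      have hu0 := hu _ hpu.1
      have hv0 := hv p hp
      rw [hφ'' _ hpu.1, show pd₁ φ _ = _ from (hφ' _ hpu.1).fst,
        show pd₂ φ _ = _ from (hφ' _ hpu.1).snd, hφ _ hpu.1] at hlog
      have hadd : (u + (p.1 - p.2)) / 2 + (u - (p.1 - p.2)) / 2 = u := by ring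
      have hsub : (u + (p.1 - p.2)) / 2 - (u - (p.1 - p.2)) / 2 = p.1 - p.2 := by ring
      simp only [hadd, hsub] at hlog hu0
      generalize p.1 - p.2 = v at hlog hv0 ⊢
      field_simp at hlog
      linear_combination -hlog / 2
  exact hne (by rw [hφ p hp, hP, hR, zero_div, zero_div, add_zero])

theorem infinite_horizontal_slice (hU : IsOpen U) (hp : p ∈ U) :
    {x : 𝕜 | (x, p.2) ∈ U}.Infinite :=
  infinite_of_mem_nhds p.1
    ((Continuous.prodMk_left p.2).continuousAt.preimage_mem_nhds (hU.mem_nhds hp))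

end InverseSquares

section SystemF₂

variable {𝕜 : Type*} [RCLike 𝕜] {E : Type*} [NormedAddCommGroup E] [NormedSpace 𝕜 E]
  {U V : Set (𝕜 × 𝕜)} {p : 𝕜 × 𝕜}

/-- The conjugate equations of `IsConjugateSystem` for a smooth function `w` on an open set,
without any condition on the coefficients or on the frame. -/
structure SolvesConjugate (C : ConjugateCoeffs 𝕜) (U : Set (𝕜 × 𝕜)) (w : 𝕜 × 𝕜 → E) : Prop where
  isOpen : IsOpen U
  smooth : ContDiffOn 𝕜 ∞ w U
  hyperbolic : ∀ p ∈ U,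
    pd₂ (pd₁ w) p + C.a p • pd₁ w p + C.b p • pd₂ w p + C.c p • w p = 0
  second : ∀ p ∈ U,
    pd₂ (pd₂ w) p + C.q p • pd₁ (pd₁ w) p + C.m p • pd₁ w p + C.n p • pd₂ w p + C.r p • w p = 0

/-- The complement, in the coordinates `(s, t)` of `T₂`, of the singular locus of the `F₂`
system. -/
structure IsRegularST₂ (p : 𝕜 × 𝕜) : Prop where
  fst_ne_zero : p.1 ≠ 0
  fst_sub_one_ne_zero : p.1 - 1 ≠ 0
  snd_ne_zero : p.2 ≠ 0
  snd_sub_one_ne_zero : p.2 - 1 ≠ 0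
  sub_ne_zero : p.1 - p.2 ≠ 0

theorem isRegularST₂_of_T₂_mem (h : T₂ p ∈ regularF₂ 𝕜) : IsRegularST₂ p := by
  obtain ⟨hx, hy, hx1, hy1, hxy⟩ := h
  simp only [T₂] at hx hy hx1 hy1 hxy
  have hs : p.1 ≠ 0 := fun h => hx (by rw [h, div_zero])
  refine ⟨hs, fun h => hx1 ?_, fun h => hy1 ?_, fun h => hxy ?_, fun h => hy ?_⟩
  · rw [sub_eq_zero.1 h]; simp
  · rw [h]; simp
  · rw [sub_eq_zero.1 h]; ring
  · rw [← sub_eq_zero.1 h, div_self hs, sub_self]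

/-- The coefficient `ℓ₁` of `w_s` in the form
`t (t - 1) w_tt + ℓ₂ w_t + α (α + 1 - γ₁) w + s (s - 1) ∂_s w₁ + (ℓ₁ - (s - 1) α) w₁ = 0`,
`w₁ = w_s - (α / s) w`, of the second conjugate equation of `S_{F₂}`. -/
noncomputable def sepCoeff₁ (α β₁ β₂ γ₁ : 𝕜) (p : 𝕜 × 𝕜) : 𝕜 :=
  β₂ * (2 * p.1 * p.2 - p.1 - p.2) / (p.1 - p.2) + ((2 * α + 2 - γ₁) * p.1 - (α - β₁ + 1))

/-- The coefficient `ℓ₂` of `w_t` in the form of the second conjugate equation of `S_{F₂}`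
described at `sepCoeff₁`. -/
noncomputable def sepCoeff₂ (α β₁ β₂ γ₁ γ₂ : 𝕜) (p : 𝕜 × 𝕜) : 𝕜 :=
  -(γ₂ - β₂) * (2 * p.1 * p.2 - p.1 - p.2) / (p.1 - p.2)
    + ((2 * α + 2 - γ₁) * p.2 - (α - β₁ + 1))

/-- The coefficients of the conjugate system of `S_{F₂}`. -/
noncomputable def coeffsF₂ (α β₁ β₂ γ₁ γ₂ : 𝕜) : ConjugateCoeffs 𝕜 where
  a := fun p => -β₂ / (p.1 - p.2)
  b := fun p => (γ₂ - β₂) / (p.1 - p.2) - α / p.1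
  c := fun p => α * β₂ / (p.1 * (p.1 - p.2))
  q := fun p => (p.1 * (p.1 - 1)) / (p.2 * (p.2 - 1))
  m := fun p => (sepCoeff₁ α β₁ β₂ γ₁ p - 2 * (p.1 - 1) * α) / (p.2 * (p.2 - 1))
  n := fun p => sepCoeff₂ α β₁ β₂ γ₁ γ₂ p / (p.2 * (p.2 - 1))
  r := fun p => (α * (α + 1 - γ₁) + (p.1 - 1) * (α * (α + 1)) / p.1
    - sepCoeff₁ α β₁ β₂ γ₁ p * (α / p.1)) / (p.2 * (p.2 - 1))

theorem hasPartials_comp_T₂ {g : 𝕜 × 𝕜 → E} (hV : IsOpen V) (hg : ContDiffOn 𝕜 ∞ g V)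
    (hp : T₂ p ∈ V) (hs : p.1 ≠ 0) :
    HasPartials (fun p => g (T₂ p)) p
      ((-1 / p.1 ^ 2) • pd₁ g (T₂ p) + (p.2 / p.1 ^ 2) • pd₂ g (T₂ p))
      ((-1 / p.1) • pd₂ g (T₂ p)) := by
  refine (HasDirDerivs.comp (S := fun p => 1 / p.1) (T := fun p => 1 - p.2 / p.1)
    (HasPartials.of_contDiffOn hV hg hp) ((HasDirDerivs.const 1).div .coord₁ hs)
    ((HasDirDerivs.const 1).sub (HasDirDerivs.coord₂.div .coord₁ hs))).congr ?_ ?_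
  all_goals
    rw [← T₂]
    match_scalars <;> field_simp <;> ring

theorem contDiffOn_T₂ (hU : ∀ p ∈ U, p.1 ≠ 0) : ContDiffOn 𝕜 ∞ (T₂ (𝕜 := 𝕜)) U :=
  (contDiffOn_const.div contDiffOn_fst hU).prodMk
    (contDiffOn_const.sub (contDiffOn_snd.div contDiffOn_fst hU))

variable {α β₁ β₂ γ₁ γ₂ : 𝕜}

theorem pd_pd_comp_T₂ {F : 𝕜 × 𝕜 → E} (hV : IsOpen V) (hF : ContDiffOn 𝕜 ∞ F V)
    (hU : IsOpen U) (hUV : Set.MapsTo T₂ U V) (h0 : ∀ p ∈ U, p.1 ≠ 0) (hp : p ∈ U) :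
    pd₁ (pd₁ fun p => F (T₂ p)) p
        = (1 / p.1 ^ 4) • pd₁ (pd₁ F) (T₂ p) - (2 * p.2 / p.1 ^ 4) • pd₂ (pd₁ F) (T₂ p)
          + (p.2 ^ 2 / p.1 ^ 4) • pd₂ (pd₂ F) (T₂ p) + (2 / p.1 ^ 3) • pd₁ F (T₂ p)
          - (2 * p.2 / p.1 ^ 3) • pd₂ F (T₂ p) ∧
      pd₂ (pd₁ fun p => F (T₂ p)) p
        = (1 / p.1 ^ 3) • pd₂ (pd₁ F) (T₂ p) - (p.2 / p.1 ^ 3) • pd₂ (pd₂ F) (T₂ p)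
          + (1 / p.1 ^ 2) • pd₂ F (T₂ p) ∧
      pd₂ (pd₂ fun p => F (T₂ p)) p = (1 / p.1 ^ 2) • pd₂ (pd₂ F) (T₂ p) := by
  have hs := h0 p hp
  have hFx := hasPartials_comp_T₂ hV (contDiffOn_pd₁ hV hF) (hUV hp) hs
  have hFy := hasPartials_comp_T₂ hV (contDiffOn_pd₂ hV hF) (hUV hp) hs
  have hinv := (HasDirDerivs.coord₁ (p := p)).const_div_pow hs (-1) 2
  have hw₁ := ((hinv.smul hFx).add (((HasDirDerivs.coord₂.mul hinv).neg).smul hFy)).congr_of_eqOn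
    hU hp (g := pd₁ fun p => F (T₂ p)) fun p hp => by
      refine Eq.trans ?_ (hasPartials_comp_T₂ hV hF (hUV hp) (h0 p hp)).fst.symm
      match_scalars <;> ring
  have hw₂ := (((HasDirDerivs.const (-1)).div .coord₁ hs).smul hFy).congr_of_eqOn hU hp
    fun p hp => (hasPartials_comp_T₂ hV hF (hUV hp) (h0 p hp)).snd.symm
  refine ⟨hw₁.fst.trans ?_, hw₁.snd.trans ?_, hw₂.snd.trans ?_⟩
  · rw [pd₁_pd₂_comm hV hF (hUV hp)]
    match_scalars <;> field_simp <;> ring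
  · match_scalars <;> field_simp <;> ring
  · match_scalars
    · ring
    · field_simp

theorem IsSurfaceF₂.solvesConjugate {F : 𝕜 × 𝕜 → (Fin 4 → 𝕜)}
    (h : IsSurfaceF₂ α β₁ β₂ γ₁ γ₂ V F) (hU : IsOpen U) (hUV : Set.MapsTo T₂ U V) :
    SolvesConjugate (coeffsF₂ α β₁ β₂ γ₁ γ₂) U fun p => F (T₂ p) := by
  obtain ⟨⟨hV, -, hVreg, hF, -⟩, hsys⟩ := h
  have hreg : ∀ p ∈ U, IsRegularST₂ p := fun p hp => isRegularST₂_of_T₂_mem (hVreg (hUV hp))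
  have h0 : ∀ p ∈ U, p.1 ≠ 0 := fun p hp => (hreg p hp).fst_ne_zero
  refine ⟨hU, hF.comp (contDiffOn_T₂ h0) hUV, fun p hp => ?_, fun p hp => ?_⟩
  all_goals
    obtain ⟨h₁, h₂⟩ := hsys _ (hUV hp)
    obtain ⟨hss, hst, htt⟩ := pd_pd_comp_T₂ hV hF hU hUV h0 hp
    have hw := hasPartials_comp_T₂ hV hF (hUV hp) (h0 p hp)
    obtain ⟨hs, _, ht, ht1, hd⟩ := hreg p hp
    simp only [T₂] at h₁ h₂
  · rw [hst, show pd₁ _ p = _ from hw.fst, show pd₂ _ p = _ from hw.snd]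
    simp only [T₂, coeffsF₂]
    linear_combination (norm := skip) (-1 / (p.1 * (p.1 - p.2))) • h₂
    match_scalars <;> field_simp <;> ring
  · rw [hss, htt, show pd₁ _ p = _ from hw.fst, show pd₂ _ p = _ from hw.snd]
    simp only [T₂, coeffsF₂, sepCoeff₁, sepCoeff₂]
    linear_combination (norm := skip) (1 / (p.1 * (p.2 * (p.2 - 1)))) • h₁
      + ((2 * p.1 * p.2 - p.1 - p.2) / (p.2 * (p.2 - 1) * (p.1 * (p.1 - p.2)))) • h₂
    match_scalars <;> field_simp <;> ring

theorem contDiffOn_sepCoeff₁ (hd : ∀ p ∈ U, p.1 - p.2 ≠ 0) :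
    ContDiffOn 𝕜 ∞ (sepCoeff₁ α β₁ β₂ γ₁) U := by
  unfold sepCoeff₁
  fun_prop (disch := assumption)

theorem contDiffOn_sepCoeff₂ (hd : ∀ p ∈ U, p.1 - p.2 ≠ 0) :
    ContDiffOn 𝕜 ∞ (sepCoeff₂ α β₁ β₂ γ₁ γ₂) U := by
  unfold sepCoeff₂
  fun_prop (disch := assumption)

theorem SolvesConjugate.isConjugateSystem_coeffsF₂ {w : 𝕜 × 𝕜 → (Fin 4 → 𝕜)}
    (h : SolvesConjugate (coeffsF₂ α β₁ β₂ γ₁ γ₂) U w) (hreg : ∀ p ∈ U, IsRegularST₂ p)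
    (hframe : ∀ p ∈ U, LinearIndependent 𝕜 ![w p, pd₁ w p, pd₂ w p, pd₁ (pd₁ w) p]) :
    IsConjugateSystem U w (coeffsF₂ α β₁ β₂ γ₁ γ₂) := by
  have hs : ∀ p ∈ U, p.1 ≠ 0 := fun p hp => (hreg p hp).fst_ne_zero
  have hd : ∀ p ∈ U, p.1 - p.2 ≠ 0 := fun p hp => (hreg p hp).sub_ne_zero
  have hsd : ∀ p ∈ U, p.1 * (p.1 - p.2) ≠ 0 := fun p hp => mul_ne_zero (hs p hp) (hd p hp)
  have htt : ∀ p ∈ U, p.2 * (p.2 - 1) ≠ 0 := fun p hp =>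
    mul_ne_zero (hreg p hp).snd_ne_zero (hreg p hp).snd_sub_one_ne_zero
  have hℓ₁ := contDiffOn_sepCoeff₁ (α := α) (β₁ := β₁) (β₂ := β₂) (γ₁ := γ₁) hd
  have hℓ₂ := contDiffOn_sepCoeff₂ (α := α) (β₁ := β₁) (β₂ := β₂) (γ₁ := γ₁) (γ₂ := γ₂) hd
  refine ⟨?_, ?_, ?_, ?_, ?_, ?_, ?_, fun p hp => ?_, hframe, h.hyperbolic, h.second⟩
  case refine_8 =>
    exact div_ne_zero (mul_ne_zero (hs p hp) (hreg p hp).fst_sub_one_ne_zero) (htt p hp)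
  all_goals
    unfold coeffsF₂
    fun_prop (disch := assumption)

end SystemF₂

section TotalSystemF₂

variable {𝕜 : Type*} [RCLike 𝕜] {E : Type*} [NormedAddCommGroup E] [NormedSpace 𝕜 E]
  {U : Set (𝕜 × 𝕜)} {p : 𝕜 × 𝕜} {α β₁ β₂ γ₁ γ₂ : 𝕜}

theorem hasPartials_sepCoeff₁ (hd : p.1 - p.2 ≠ 0) :
    HasPartials (sepCoeff₁ α β₁ β₂ γ₁) p
      (-2 * β₂ * (p.2 * (p.2 - 1)) / (p.1 - p.2) ^ 2 + (2 * α + 2 - γ₁))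
      (2 * β₂ * (p.1 * (p.1 - 1)) / (p.1 - p.2) ^ 2) := by
  refine (((((HasDirDerivs.const β₂).mul ((((HasDirDerivs.const 2).mul .coord₁).mul
    .coord₂).sub .coord₁ |>.sub .coord₂)).div hasPartials_sub hd)).add
      (((HasDirDerivs.const (2 * α + 2 - γ₁)).mul .coord₁).sub
        (.const (α - β₁ + 1)))).congr ?_ ?_ <;> field_simp <;> ring

theorem hasPartials_sepCoeff₂ (hd : p.1 - p.2 ≠ 0) :
    HasPartials (sepCoeff₂ α β₁ β₂ γ₁ γ₂) p
      (2 * (γ₂ - β₂) * (p.2 * (p.2 - 1)) / (p.1 - p.2) ^ 2)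
      (-2 * (γ₂ - β₂) * (p.1 * (p.1 - 1)) / (p.1 - p.2) ^ 2 + (2 * α + 2 - γ₁)) := by
  refine (((((HasDirDerivs.const (-(γ₂ - β₂))).mul ((((HasDirDerivs.const 2).mul .coord₁).mul
    .coord₂).sub .coord₁ |>.sub .coord₂)).div hasPartials_sub hd)).add
      (((HasDirDerivs.const (2 * α + 2 - γ₁)).mul .coord₂).sub
        (.const (α - β₁ + 1)))).congr ?_ ?_ <;> field_simp <;> ring

/-- The tangent vector `w_s - (α / s) w` of the moving frame of `S_{F₂}`. -/
noncomputable def tangentF₂ (α : 𝕜) (w : 𝕜 × 𝕜 → E) (p : 𝕜 × 𝕜) : E :=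
  pd₁ w p - (α / p.1) • w p

/-- The transversal vector `-(t (t - 1) w_tt + ℓ₂ w_t + α (α + 1 - γ₁) w)` of the moving frame of
`S_{F₂}`; the second conjugate equation expresses it by derivatives in `s` as well. -/
noncomputable def transversalF₂ (α β₁ β₂ γ₁ γ₂ : 𝕜) (w : 𝕜 × 𝕜 → E) (p : 𝕜 × 𝕜) : E :=
  -((p.2 * (p.2 - 1)) • pd₂ (pd₂ w) p + sepCoeff₂ α β₁ β₂ γ₁ γ₂ p • pd₂ w p
    + (α * (α + 1 - γ₁)) • w p)

/-- The moving frame of `S_{F₂}` in the coordinates `(s, t)`. -/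
noncomputable def frameF₂ (α β₁ β₂ γ₁ γ₂ : 𝕜) (w : 𝕜 × 𝕜 → E) : Fin 4 → 𝕜 × 𝕜 → E :=
  ![w, tangentF₂ α w, pd₂ w, transversalF₂ α β₁ β₂ γ₁ γ₂ w]

/-- The matrix of `∂_s` on the moving frame `frameF₂`. -/
noncomputable def totalP₂ (α β₁ β₂ γ₁ γ₂ : 𝕜) (p : 𝕜 × 𝕜) : Matrix (Fin 4) (Fin 4) 𝕜 :=
  !![α / p.1, 1, 0, 0;
    0, α / p.1 - sepCoeff₁ α β₁ β₂ γ₁ p / (p.1 * (p.1 - 1)), 0, 1 / (p.1 * (p.1 - 1));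
    0, β₂ / (p.1 - p.2), α / p.1 - (γ₂ - β₂) / (p.1 - p.2), 0;
    -(γ₂ - β₂) * (α * (α + 1 - γ₁)) / (p.1 - p.2),
      -(α * (α + 1 - γ₁)) - p.2 * (p.2 - 1) * (β₂ * (1 + β₂)) / (p.1 - p.2) ^ 2
        - sepCoeff₂ α β₁ β₂ γ₁ γ₂ p * β₂ / (p.1 - p.2),
      p.2 * (p.2 - 1) * ((γ₂ - β₂) * (β₂ - 1)) / (p.1 - p.2) ^ 2,
      α / p.1 - (γ₂ - β₂) / (p.1 - p.2)]

/-- The matrix of `∂_t` on the moving frame `frameF₂`. -/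
noncomputable def totalQ₂ (α β₁ β₂ γ₁ γ₂ : 𝕜) (p : 𝕜 × 𝕜) : Matrix (Fin 4) (Fin 4) 𝕜 :=
  !![0, 0, 1, 0;
    0, β₂ / (p.1 - p.2), -(γ₂ - β₂) / (p.1 - p.2), 0;
    -(α * (α + 1 - γ₁)) / (p.2 * (p.2 - 1)), 0,
      -sepCoeff₂ α β₁ β₂ γ₁ γ₂ p / (p.2 * (p.2 - 1)), -1 / (p.2 * (p.2 - 1));
    0, p.1 * (p.1 - 1) * (β₂ * (1 - (γ₂ - β₂))) / (p.1 - p.2) ^ 2,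
      p.1 * (p.1 - 1) * ((γ₂ - β₂) * (1 + (γ₂ - β₂))) / (p.1 - p.2) ^ 2
        - sepCoeff₁ α β₁ β₂ γ₁ p * (γ₂ - β₂) / (p.1 - p.2),
      β₂ / (p.1 - p.2)]

open scoped Matrix.Norms.Elementwise in
theorem continuousOn_totalP₂ (hreg : ∀ p ∈ U, IsRegularST₂ p) :
    ContinuousOn (totalP₂ α β₁ β₂ γ₁ γ₂) U := by
  have hs : ∀ p ∈ U, p.1 ≠ 0 := fun p hp => (hreg p hp).fst_ne_zero
  have hss : ∀ p ∈ U, p.1 * (p.1 - 1) ≠ 0 := fun p hp =>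
    mul_ne_zero (hs p hp) (hreg p hp).fst_sub_one_ne_zero
  have hd : ∀ p ∈ U, p.1 - p.2 ≠ 0 := fun p hp => (hreg p hp).sub_ne_zero
  have hdd : ∀ p ∈ U, (p.1 - p.2) ^ 2 ≠ 0 := fun p hp => pow_ne_zero 2 (hd p hp)
  have hℓ₁ := (contDiffOn_sepCoeff₁ (α := α) (β₁ := β₁) (β₂ := β₂) (γ₁ := γ₁) hd).continuousOn
  have hℓ₂ := (contDiffOn_sepCoeff₂ (α := α) (β₁ := β₁) (β₂ := β₂) (γ₁ := γ₁) (γ₂ := γ₂)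
    hd).continuousOn
  refine continuousOn_pi.2 fun i => continuousOn_pi.2 fun j => ?_
  unfold totalP₂
  fin_cases i <;> fin_cases j <;> simp only [Fin.zero_eta, Fin.mk_one, Fin.reduceFinMk,
    Matrix.of_apply, Matrix.cons_val', Matrix.cons_val] <;> fun_prop (disch := assumption)

open scoped Matrix.Norms.Elementwise in
theorem continuousOn_totalQ₂ (hreg : ∀ p ∈ U, IsRegularST₂ p) :
    ContinuousOn (totalQ₂ α β₁ β₂ γ₁ γ₂) U := by
  have htt : ∀ p ∈ U, p.2 * (p.2 - 1) ≠ 0 := fun p hp =>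
    mul_ne_zero (hreg p hp).snd_ne_zero (hreg p hp).snd_sub_one_ne_zero
  have hd : ∀ p ∈ U, p.1 - p.2 ≠ 0 := fun p hp => (hreg p hp).sub_ne_zero
  have hdd : ∀ p ∈ U, (p.1 - p.2) ^ 2 ≠ 0 := fun p hp => pow_ne_zero 2 (hd p hp)
  have hℓ₁ := (contDiffOn_sepCoeff₁ (α := α) (β₁ := β₁) (β₂ := β₂) (γ₁ := γ₁) hd).continuousOn
  have hℓ₂ := (contDiffOn_sepCoeff₂ (α := α) (β₁ := β₁) (β₂ := β₂) (γ₁ := γ₁) (γ₂ := γ₂)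
    hd).continuousOn
  refine continuousOn_pi.2 fun i => continuousOn_pi.2 fun j => ?_
  unfold totalQ₂
  fin_cases i <;> fin_cases j <;> simp only [Fin.zero_eta, Fin.mk_one, Fin.reduceFinMk,
    Matrix.of_apply, Matrix.cons_val', Matrix.cons_val] <;> fun_prop (disch := assumption)

namespace SolvesConjugate

variable {w : 𝕜 × 𝕜 → E}

theorem contDiffOn_tangentF₂ {C : ConjugateCoeffs 𝕜} (h : SolvesConjugate C U w)
    (hs : ∀ p ∈ U, p.1 ≠ 0) : ContDiffOn 𝕜 ∞ (tangentF₂ α w) U :=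
  (contDiffOn_pd₁ h.isOpen h.smooth).sub
    ((contDiffOn_const.div contDiffOn_fst hs).smul h.smooth)

variable (h : SolvesConjugate (coeffsF₂ α β₁ β₂ γ₁ γ₂) U w) (hreg : ∀ p ∈ U, IsRegularST₂ p)

include h hreg

theorem hasPartials_tangentF₂ (hp : p ∈ U) :
    HasPartials (tangentF₂ α w) p
      ((α / p.1 - sepCoeff₁ α β₁ β₂ γ₁ p / (p.1 * (p.1 - 1))) • tangentF₂ α w p
        + (1 / (p.1 * (p.1 - 1))) • transversalF₂ α β₁ β₂ γ₁ γ₂ w p)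
      ((β₂ / (p.1 - p.2)) • tangentF₂ α w p + (-(γ₂ - β₂) / (p.1 - p.2)) • pd₂ w p) := by
  have hhyp := h.hyperbolic p hp
  have hsec := h.second p hp
  obtain ⟨hs, hs1, ht, ht1, hd⟩ := hreg p hp
  simp only [coeffsF₂] at hhyp hsec
  refine ((HasPartials.of_contDiffOn h.isOpen (contDiffOn_pd₁ h.isOpen h.smooth) hp).sub
    (((HasDirDerivs.const α).div .coord₁ hs).smul
      (HasPartials.of_contDiffOn h.isOpen h.smooth hp))).congr ?_ ?_
  · simp only [tangentF₂, transversalF₂]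
    linear_combination (norm := skip) ((p.2 * (p.2 - 1)) / (p.1 * (p.1 - 1))) • hsec
    match_scalars <;> field_simp <;> ring
  · simp only [tangentF₂]
    linear_combination (norm := skip) (1 : 𝕜) • hhyp
    match_scalars <;> field_simp <;> ring

theorem hasPartials_pd₂_F₂ (hp : p ∈ U) :
    HasPartials (pd₂ w) p
      ((β₂ / (p.1 - p.2)) • tangentF₂ α w p + (α / p.1 - (γ₂ - β₂) / (p.1 - p.2)) • pd₂ w p)
      ((-(α * (α + 1 - γ₁)) / (p.2 * (p.2 - 1))) • w p
        + (-sepCoeff₂ α β₁ β₂ γ₁ γ₂ p / (p.2 * (p.2 - 1))) • pd₂ w p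
        + (-1 / (p.2 * (p.2 - 1))) • transversalF₂ α β₁ β₂ γ₁ γ₂ w p) := by
  have hhyp := h.hyperbolic p hp
  obtain ⟨hs, -, ht, ht1, hd⟩ := hreg p hp
  simp only [coeffsF₂] at hhyp
  refine (HasPartials.of_contDiffOn h.isOpen (contDiffOn_pd₂ h.isOpen h.smooth) hp).congr ?_ ?_
  · rw [pd₁_pd₂_comm h.isOpen h.smooth hp]
    simp only [tangentF₂]
    linear_combination (norm := skip) (1 : 𝕜) • hhyp
    match_scalars <;> field_simp <;> ring
  · simp only [transversalF₂]
    match_scalars <;> field_simp <;> ring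

theorem transversalF₂_eq (hp : p ∈ U) :
    transversalF₂ α β₁ β₂ γ₁ γ₂ w p = (p.1 * (p.1 - 1)) • pd₁ (tangentF₂ α w) p
      + (sepCoeff₁ α β₁ β₂ γ₁ p - (p.1 - 1) * α) • tangentF₂ α w p := by
  rw [show pd₁ (tangentF₂ α w) p = _ from (h.hasPartials_tangentF₂ hreg hp).fst]
  obtain ⟨hs, hs1, -⟩ := hreg p hp
  match_scalars <;> field_simp
  ring

theorem pd₁_transversalF₂ (hp : p ∈ U) :
    pd₁ (transversalF₂ α β₁ β₂ γ₁ γ₂ w) p =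
      (-(γ₂ - β₂) * (α * (α + 1 - γ₁)) / (p.1 - p.2)) • w p
        + (-(α * (α + 1 - γ₁)) - p.2 * (p.2 - 1) * (β₂ * (1 + β₂)) / (p.1 - p.2) ^ 2
          - sepCoeff₂ α β₁ β₂ γ₁ γ₂ p * β₂ / (p.1 - p.2)) • tangentF₂ α w p
        + (p.2 * (p.2 - 1) * ((γ₂ - β₂) * (β₂ - 1)) / (p.1 - p.2) ^ 2) • pd₂ w p
        + (α / p.1 - (γ₂ - β₂) / (p.1 - p.2)) • transversalF₂ α β₁ β₂ γ₁ γ₂ w p := by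
  obtain ⟨hs, -, ht, ht1, hd⟩ := hreg p hp
  have hU := h.isOpen
  have smooth_pd₂ := contDiffOn_pd₂ hU h.smooth
  have mixed : pd₁ (pd₂ (pd₂ w)) p = _ := (pd₁_pd₂_comm hU smooth_pd₂ hp).trans
    (HasDirDerivs.eq_of_eqOn hU hp (fun p hp => (h.hasPartials_pd₂_F₂ hreg hp).fst)
      (HasPartials.of_contDiffOn hU (contDiffOn_pd₁ hU smooth_pd₂) hp)
      ((((HasDirDerivs.const β₂).div hasPartials_sub hd).smul
        (h.hasPartials_tangentF₂ hreg hp)).add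
      ((((HasDirDerivs.const α).div .coord₁ hs).sub
        ((HasDirDerivs.const (γ₂ - β₂)).div hasPartials_sub hd)).smul
        (h.hasPartials_pd₂_F₂ hreg hp)))).2
  refine (((((HasDirDerivs.coord₂.mul (.sub .coord₂ (.const 1))).smul
    (HasPartials.of_contDiffOn hU (contDiffOn_pd₂ hU smooth_pd₂) hp)).add
      ((hasPartials_sepCoeff₂ hd).smul (HasPartials.of_contDiffOn hU smooth_pd₂ hp))).add
      ((HasDirDerivs.const (α * (α + 1 - γ₁))).smul
        (HasPartials.of_contDiffOn hU h.smooth hp))).neg).fst.trans ?_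
  rw [mixed, show pd₁ (pd₂ w) p = _ from (h.hasPartials_pd₂_F₂ hreg hp).fst,
    show pd₂ (pd₂ w) p = _ from (h.hasPartials_pd₂_F₂ hreg hp).snd,
    show pd₁ w p = tangentF₂ α w p + (α / p.1) • w p by simp [tangentF₂]]
  match_scalars <;> field_simp <;> ring

theorem pd₂_transversalF₂ (hp : p ∈ U) :
    pd₂ (transversalF₂ α β₁ β₂ γ₁ γ₂ w) p =
      (p.1 * (p.1 - 1) * (β₂ * (1 - (γ₂ - β₂))) / (p.1 - p.2) ^ 2) • tangentF₂ α w p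
        + (p.1 * (p.1 - 1) * ((γ₂ - β₂) * (1 + (γ₂ - β₂))) / (p.1 - p.2) ^ 2
          - sepCoeff₁ α β₁ β₂ γ₁ p * (γ₂ - β₂) / (p.1 - p.2)) • pd₂ w p
        + (β₂ / (p.1 - p.2)) • transversalF₂ α β₁ β₂ γ₁ γ₂ w p := by
  have hU := h.isOpen
  have smooth_tangent := h.contDiffOn_tangentF₂ (α := α) fun p hp => (hreg p hp).fst_ne_zero
  obtain ⟨hs, hs1, -, -, hd⟩ := hreg p hp
  have mixed : pd₂ (pd₁ (tangentF₂ α w)) p = _ := (pd₁_pd₂_comm hU smooth_tangent hp).symm.trans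
    (HasDirDerivs.eq_of_eqOn hU hp (fun p hp => (h.hasPartials_tangentF₂ hreg hp).snd)
      (HasPartials.of_contDiffOn hU (contDiffOn_pd₂ hU smooth_tangent) hp)
      ((((HasDirDerivs.const β₂).div hasPartials_sub hd).smul
        (h.hasPartials_tangentF₂ hreg hp)).add
      (((HasDirDerivs.const (-(γ₂ - β₂))).div hasPartials_sub hd).smul
        (h.hasPartials_pd₂_F₂ hreg hp)))).1
  refine ((((HasDirDerivs.coord₁.mul (.sub .coord₁ (.const 1))).smul
    (HasPartials.of_contDiffOn hU (contDiffOn_pd₁ hU smooth_tangent) hp)).add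
      (((hasPartials_sepCoeff₁ hd).sub
        ((HasDirDerivs.sub .coord₁ (.const 1)).mul (.const α))).smul
        (h.hasPartials_tangentF₂ hreg hp))).congr_of_eqOn hU hp
        fun p hp => (h.transversalF₂_eq hreg hp).symm).snd.trans ?_
  rw [mixed, show pd₁ (tangentF₂ α w) p = _ from (h.hasPartials_tangentF₂ hreg hp).fst]
  match_scalars <;> field_simp <;> ring

theorem contDiffOn_transversalF₂ : ContDiffOn 𝕜 ∞ (transversalF₂ α β₁ β₂ γ₁ γ₂ w) U := by
  have smooth_pd₂ := contDiffOn_pd₂ h.isOpen h.smooth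
  exact ((((contDiffOn_snd.mul (contDiffOn_snd.sub contDiffOn_const)).smul
    (contDiffOn_pd₂ h.isOpen smooth_pd₂)).add
      ((contDiffOn_sepCoeff₂ fun p hp => (hreg p hp).sub_ne_zero).smul smooth_pd₂)).add
      (contDiffOn_const.smul h.smooth)).neg

theorem isTotalSystem_F₂ : IsTotalSystem U (totalP₂ α β₁ β₂ γ₁ γ₂) (totalQ₂ α β₁ β₂ γ₁ γ₂)
    (frameF₂ α β₁ β₂ γ₁ γ₂ w) where
  continuousOn_fst := continuousOn_totalP₂ hreg
  continuousOn_snd := continuousOn_totalQ₂ hreg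
  hasPartials p hp i := by
    fin_cases i
    · refine (HasPartials.of_contDiffOn h.isOpen h.smooth hp).congr ?_ ?_ <;>
      simp [Fin.sum_univ_four, totalP₂, totalQ₂, frameF₂, tangentF₂]
    · refine (h.hasPartials_tangentF₂ hreg hp).congr ?_ ?_ <;>
      simp [Fin.sum_univ_four, totalP₂, totalQ₂, frameF₂]
    · refine (h.hasPartials_pd₂_F₂ hreg hp).congr ?_ ?_ <;>
      simp [Fin.sum_univ_four, totalP₂, totalQ₂, frameF₂]
    · refine (HasPartials.of_contDiffOn h.isOpen (h.contDiffOn_transversalF₂ hreg) hp).congr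
        ((h.pd₁_transversalF₂ hreg hp).trans ?_) ((h.pd₂_transversalF₂ hreg hp).trans ?_) <;>
      simp [Fin.sum_univ_four, totalP₂, totalQ₂, frameF₂]

end SolvesConjugate

end TotalSystemF₂

section QuadricF₂

variable {𝕜 : Type*} [RCLike 𝕜] {α β₁ β₂ γ₁ γ₂ : 𝕜} {U V : Set (𝕜 × 𝕜)} {p : 𝕜 × 𝕜}

theorem SolvesConjugate.linearIndependent_jet_F₂ {w : 𝕜 × 𝕜 → (Fin 4 → 𝕜)}
    (h : SolvesConjugate (coeffsF₂ α β₁ β₂ γ₁ γ₂) U w) (hp : p ∈ U)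
    (hi : LinearIndependent 𝕜 fun i => frameF₂ α β₁ β₂ γ₁ γ₂ w i p) :
    LinearIndependent 𝕜 ![w p, pd₁ w p, pd₂ w p, pd₁ (pd₁ w) p] := by
  refine linearIndependent_of_dotProduct_eq_zero fun x hx =>
    eq_zero_of_dotProduct_eq_zero hi ?_
  obtain ⟨hw, hw₁, hw₂, hw₁₁⟩ : w p ⬝ᵥ x = 0 ∧ pd₁ w p ⬝ᵥ x = 0 ∧ pd₂ w p ⬝ᵥ x = 0 ∧
      pd₁ (pd₁ w) p ⬝ᵥ x = 0 := ⟨hx 0, hx 1, hx 2, hx 3⟩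
  have hw₂₂ : pd₂ (pd₂ w) p ⬝ᵥ x = 0 := by
    simpa [add_dotProduct, hw, hw₁, hw₂, hw₁₁] using congrArg (· ⬝ᵥ x) (h.second p hp)
  simp [Fin.forall_fin_succ, frameF₂, tangentF₂, transversalF₂, add_dotProduct, sub_dotProduct,
    hw, hw₁, hw₂, hw₂₂]

/-- The Gram matrix of the frame `frameF₂` for the quadric containing `S_{F₂}`, up to a scalar
function, in the case `α = β₁ + β₂ - 1 / 2`, `γ₁ = 2 * β₁`, `γ₂ = 2 * β₂`. -/
noncomputable def gramF₂ (β₁ β₂ : 𝕜) (p : 𝕜 × 𝕜) : Matrix (Fin 4) (Fin 4) 𝕜 :=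
  adaptedGram (1 / (p.1 * (p.1 - 1))) 0 (-1 / (p.2 * (p.2 - 1))) (β₂ / (p.1 - p.2))
    (-β₂ / (p.1 - p.2))
    (β₂ ^ 2 - (β₁ - 1 / 2) ^ 2 + β₂ ^ 2 * (p.1 + p.2 - 1) / (p.1 - p.2))

theorem det_gramF₂_ne_zero (hp : IsRegularST₂ p) : (gramF₂ β₁ β₂ p).det ≠ 0 := by
  obtain ⟨hs, hs1, ht, ht1, -⟩ := hp
  rw [gramF₂, det_adaptedGram]
  simp [hs, hs1, ht, ht1]

theorem gramDeriv_totalP₂_sub (hp : IsRegularST₂ p) :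
    gramDeriv (totalP₂ (β₁ + β₂ - 1 / 2) β₁ β₂ (2 * β₁) (2 * β₂) p) (gramF₂ β₁ β₂ p)
        - ((2 * β₁ + 2 * β₂ - 1) / p.1 - 2 * β₂ / (p.1 - p.2)) • gramF₂ β₁ β₂ p =
      !![0, 0, 0, 0;
        0, -(2 * p.1 - 1) / (p.1 * (p.1 - 1)) ^ 2, 0, -β₂ / (p.1 - p.2) ^ 2;
        0, 0, 0, β₂ / (p.1 - p.2) ^ 2;
        0, -β₂ / (p.1 - p.2) ^ 2, β₂ / (p.1 - p.2) ^ 2,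
          -β₂ ^ 2 * (2 * p.2 - 1) / (p.1 - p.2) ^ 2] := by
  obtain ⟨hs, hs1, ht, ht1, hd⟩ := hp
  ext i j
  simp only [Matrix.sub_apply, Matrix.smul_apply, gramDeriv_apply, Fin.sum_univ_four]
  fin_cases i <;> fin_cases j <;> simp [gramF₂, adaptedGram, totalP₂, sepCoeff₁, sepCoeff₂]
  all_goals
    try field_simp
    try ring

theorem gramDeriv_totalQ₂_sub (hp : IsRegularST₂ p) :
    gramDeriv (totalQ₂ (β₁ + β₂ - 1 / 2) β₁ β₂ (2 * β₁) (2 * β₂) p) (gramF₂ β₁ β₂ p)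
        - (2 * β₂ / (p.1 - p.2)) • gramF₂ β₁ β₂ p =
      !![0, 0, 0, 0;
        0, 0, 0, β₂ / (p.1 - p.2) ^ 2;
        0, 0, (2 * p.2 - 1) / (p.2 * (p.2 - 1)) ^ 2, -β₂ / (p.1 - p.2) ^ 2;
        0, β₂ / (p.1 - p.2) ^ 2, -β₂ / (p.1 - p.2) ^ 2,
          β₂ ^ 2 * (2 * p.1 - 1) / (p.1 - p.2) ^ 2] := by
  obtain ⟨hs, hs1, ht, ht1, hd⟩ := hp
  ext i j
  simp only [Matrix.sub_apply, Matrix.smul_apply, gramDeriv_apply, Fin.sum_univ_four]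
  fin_cases i <;> fin_cases j <;> simp [gramF₂, adaptedGram, totalQ₂, sepCoeff₁, sepCoeff₂]
  all_goals
    try field_simp
    try ring

open scoped Matrix.Norms.Elementwise in
theorem hasPartials_gramF₂ (hp : IsRegularST₂ p) :
    HasPartials (gramF₂ β₁ β₂) p
      (gramDeriv (totalP₂ (β₁ + β₂ - 1 / 2) β₁ β₂ (2 * β₁) (2 * β₂) p) (gramF₂ β₁ β₂ p)
        - ((2 * β₁ + 2 * β₂ - 1) / p.1 - 2 * β₂ / (p.1 - p.2)) • gramF₂ β₁ β₂ p)
      (gramDeriv (totalQ₂ (β₁ + β₂ - 1 / 2) β₁ β₂ (2 * β₁) (2 * β₂) p) (gramF₂ β₁ β₂ p)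
        - (2 * β₂ / (p.1 - p.2)) • gramF₂ β₁ β₂ p) := by
  rw [gramDeriv_totalP₂_sub hp, gramDeriv_totalQ₂_sub hp]
  obtain ⟨hs, hs1, ht, ht1, hd⟩ := hp
  refine hasPartials_adaptedGram
    (((HasDirDerivs.const 1).div (.mul .coord₁ (.sub .coord₁ (.const 1)))
      (mul_ne_zero hs hs1)).congr ?_ ?_)
    (.const 0)
    (((HasDirDerivs.const (-1)).div (.mul .coord₂ (.sub .coord₂ (.const 1)))
      (mul_ne_zero ht ht1)).congr ?_ ?_)
    (((HasDirDerivs.const _).div hasPartials_sub hd).congr ?_ ?_)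
    (((HasDirDerivs.const _).div hasPartials_sub hd).congr ?_ ?_)
    (((HasDirDerivs.const _).add (((HasDirDerivs.const _).mul
      (hasPartials_add.sub (.const 1))).div hasPartials_sub hd)).congr ?_ ?_)
  all_goals ring

end QuadricF₂

section SurfaceF₂

variable {𝕜 : Type*} [RCLike 𝕜] {α β₁ β₂ γ₁ γ₂ : 𝕜} {U V : Set (𝕜 × 𝕜)} {p : 𝕜 × 𝕜}

theorem isIsothermallyConjugate_coeffsF₂ (hreg : ∀ p ∈ U, IsRegularST₂ p) :
    IsIsothermallyConjugate U (coeffsF₂ α β₁ β₂ γ₁ γ₂).q :=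
  .of_separable (φ := fun x => x * (x - 1)) (ψ := fun x => x * (x - 1)) (by fun_prop)
    (by fun_prop)
    (fun p hp => mul_ne_zero (hreg p hp).fst_ne_zero (hreg p hp).fst_sub_one_ne_zero)
    (fun p hp => mul_ne_zero (hreg p hp).snd_ne_zero (hreg p hp).snd_sub_one_ne_zero)

theorem pd₁_q_F₂ (hp : IsRegularST₂ p) :
    pd₁ (coeffsF₂ α β₁ β₂ γ₁ γ₂).q p = (2 * p.1 - 1) / (p.2 * (p.2 - 1)) := by
  refine ((HasDirDerivs.mul .coord₁ (.sub .coord₁ (.const 1))).div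
    (.mul .coord₂ (.sub .coord₂ (.const 1)))
    (mul_ne_zero hp.snd_ne_zero hp.snd_sub_one_ne_zero)).fst.trans ?_
  obtain ⟨-, -, ht, ht1, -⟩ := hp
  field_simp
  ring

theorem pd₁_a_F₂ (hp : IsRegularST₂ p) :
    pd₁ (coeffsF₂ α β₁ β₂ γ₁ γ₂).a p = β₂ / (p.1 - p.2) ^ 2 :=
  ((HasDirDerivs.const (-β₂)).div hasPartials_sub hp.sub_ne_zero).fst.trans (by ring)

theorem pd₂_b_F₂ (hp : IsRegularST₂ p) :
    pd₂ (coeffsF₂ α β₁ β₂ γ₁ γ₂).b p = (γ₂ - β₂) / (p.1 - p.2) ^ 2 :=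
  (((HasDirDerivs.const (γ₂ - β₂)).div hasPartials_sub hp.sub_ne_zero).sub
    ((HasDirDerivs.const α).div .coord₁ hp.fst_ne_zero)).snd.trans (by ring)

theorem h_coeffsF₂ (hp : IsRegularST₂ p) :
    (coeffsF₂ α β₁ β₂ γ₁ γ₂).h p = β₂ * (1 + β₂ - γ₂) / (p.1 - p.2) ^ 2 := by
  rw [ConjugateCoeffs.h, pd₁_a_F₂ hp]
  obtain ⟨hs, -, -, -, hd⟩ := hp
  simp only [coeffsF₂]
  field_simp
  ring

theorem k_coeffsF₂ (hp : IsRegularST₂ p) :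
    (coeffsF₂ α β₁ β₂ γ₁ γ₂).k p = (1 - β₂) * (γ₂ - β₂) / (p.1 - p.2) ^ 2 := by
  rw [ConjugateCoeffs.k, pd₂_b_F₂ hp]
  obtain ⟨hs, -, -, -, hd⟩ := hp
  simp only [coeffsF₂]
  field_simp
  ring

namespace IsConjugateSystem

variable {w : 𝕜 × 𝕜 → (Fin 4 → 𝕜)} (h : IsConjugateSystem U w (coeffsF₂ α β₁ β₂ γ₁ γ₂))
  (hU : IsOpen U) (hreg : ∀ p ∈ U, IsRegularST₂ p) (hw : ContDiffOn 𝕜 ∞ w U)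

include h hU hreg hw

theorem h_eq_zero_F₂ (hQ : PosFocalQuadrics U w (coeffsF₂ α β₁ β₂ γ₁ γ₂)) (hp : p ∈ U) :
    (coeffsF₂ α β₁ β₂ γ₁ γ₂).h p = 0 :=
  eq_zero_of_log_inv_sq hU (fun p hp => (hreg p hp).sub_ne_zero)
    (fun p hp => h_coeffsF₂ (hreg p hp))
    (fun _ => h.pd₂_pd₁_h_mul_h hU hw (isIsothermallyConjugate_coeffsF₂ hreg) hQ) hp

theorem k_eq_zero_F₂ (hQ : NegFocalQuadrics U w (coeffsF₂ α β₁ β₂ γ₁ γ₂)) (hp : p ∈ U) :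
    (coeffsF₂ α β₁ β₂ γ₁ γ₂).k p = 0 :=
  eq_zero_of_log_inv_sq hU (fun p hp => (hreg p hp).sub_ne_zero)
    (fun p hp => k_coeffsF₂ (hreg p hp))
    (fun _ => h.pd₂_pd₁_k_mul_k hU hw (isIsothermallyConjugate_coeffsF₂ hreg) hQ) hp

variable (hQ : IsQuadricOn U w)

include hQ

theorem γ₂_eq_of_isQuadricOn_F₂ (hp : p ∈ U) : γ₂ = 2 * β₂ := by
  have hab := h.pd₁_a_eq_pd₂_b hU hw (isIsothermallyConjugate_coeffsF₂ hreg) hQ hp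
  rw [pd₁_a_F₂ (hreg p hp), pd₂_b_F₂ (hreg p hp)] at hab
  have hd := (hreg p hp).sub_ne_zero
  field_simp at hab
  linear_combination -hab

theorem linear_relation_of_isQuadricOn_F₂ (hp : p ∈ U) :
    (2 * α + 1 - γ₁ - 2 * β₂) * p.1 + (β₂ + β₁ - α - 1 / 2) = 0 := by
  have hγ₂ := h.γ₂_eq_of_isQuadricOn_F₂ hU hreg hw hQ hp
  have hm := (h.isConjugateNet hU hw).two_mul_m_eq hQ hp
  rw [show dirDeriv _ _ p = _ from pd₁_q_F₂ (hreg p hp)] at hm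
  obtain ⟨hs, -, ht, ht1, hd⟩ := hreg p hp
  simp only [coeffsF₂, sepCoeff₁, hγ₂] at hm
  field_simp at hm
  refine mul_left_cancel₀ (mul_ne_zero two_ne_zero hd) ?_
  linear_combination hm

theorem params_eq_of_isQuadricOn_F₂ (hne : U.Nonempty) :
    α = β₁ + β₂ - 1 / 2 ∧ γ₁ = 2 * β₁ ∧ γ₂ = 2 * β₂ := by
  obtain ⟨p, hp⟩ := hne
  obtain ⟨x, hx, hxp⟩ := (infinite_horizontal_slice hU hp).exists_notMem_finset {p.1}
  have hlin := h.linear_relation_of_isQuadricOn_F₂ hU hreg hw hQ hp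
  have hlin' := h.linear_relation_of_isQuadricOn_F₂ hU hreg hw hQ hx
  have hslope : 2 * α + 1 - γ₁ - 2 * β₂ = 0 :=
    mul_right_cancel₀ (sub_ne_zero.2 (Finset.notMem_singleton.1 hxp))
      (by linear_combination hlin' - hlin)
  have hα : α = β₁ + β₂ - 1 / 2 := by linear_combination p.1 * hslope - hlin
  exact ⟨hα, by linear_combination 2 * hα - hslope, h.γ₂_eq_of_isQuadricOn_F₂ hU hreg hw hQ hp⟩

end IsConjugateSystem

/-- The inverse of the coordinate change `T₂`. -/
noncomputable def T₂Inv (p : 𝕜 × 𝕜) : 𝕜 × 𝕜 := (1 / p.1, (1 - p.2) / p.1)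

theorem T₂_T₂Inv (hx : p.1 ≠ 0) : T₂ (T₂Inv p) = p := by
  ext <;> simp only [T₂, T₂Inv] <;> field_simp
  ring

theorem T₂Inv_T₂ (hs : p.1 ≠ 0) : T₂Inv (T₂ p) = p := by
  ext <;> simp only [T₂, T₂Inv] <;> field_simp
  ring

theorem isPreconnected_preimage_T₂ (hV : V ⊆ regularF₂ 𝕜) (hc : IsPreconnected V) :
    IsPreconnected (T₂ ⁻¹' V) := by
  have h0 : ∀ p ∈ V, p.1 ≠ 0 := fun p hp => (hV hp).1
  have himage : T₂ ⁻¹' V = T₂Inv '' V :=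
    Set.Subset.antisymm
      (fun p hp => ⟨T₂ p, hp, T₂Inv_T₂ (isRegularST₂_of_T₂_mem (hV hp)).fst_ne_zero⟩)
      (Set.image_subset_iff.2 fun q hq => by
        rwa [Set.mem_preimage, Set.mem_preimage, T₂_T₂Inv (h0 q hq)])
  rw [himage]
  exact hc.image _ ((continuousOn_const.div continuousOn_fst h0).prodMk
    ((continuousOn_const.sub continuousOn_snd).div continuousOn_fst h0))

theorem isOpen_preimage_T₂ (hV : V ⊆ regularF₂ 𝕜) (ho : IsOpen V) : IsOpen (T₂ ⁻¹' V) := by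
  have hsub : T₂ ⁻¹' V ⊆ {p : 𝕜 × 𝕜 | p.1 ≠ 0} := fun p hp =>
    (isRegularST₂_of_T₂_mem (hV hp)).fst_ne_zero
  rw [← Set.inter_eq_right.2 hsub]
  exact (contDiffOn_T₂ fun _ hp => hp).continuousOn.isOpen_inter_preimage
    (isOpen_ne.preimage continuous_fst) ho

namespace IsSurfaceF₂

variable {F : 𝕜 × 𝕜 → (Fin 4 → 𝕜)} (h : IsSurfaceF₂ α β₁ β₂ γ₁ γ₂ V F)

include h

theorem isRegularST₂ (hp : T₂ p ∈ V) : IsRegularST₂ p :=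
  isRegularST₂_of_T₂_mem (h.1.subset_regular hp)

theorem T₂_T₂Inv_of_mem (hp : p ∈ V) : T₂ (T₂Inv p) = p :=
  T₂_T₂Inv (h.1.subset_regular hp).1

theorem solvesConjugate_preimage :
    SolvesConjugate (coeffsF₂ α β₁ β₂ γ₁ γ₂) (T₂ ⁻¹' V) fun p => F (T₂ p) :=
  h.solvesConjugate (isOpen_preimage_T₂ h.1.subset_regular h.1.isOpen) (Set.mapsTo_preimage _ _)

theorem isTotalSystem : IsTotalSystem (T₂ ⁻¹' V) (totalP₂ α β₁ β₂ γ₁ γ₂)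
    (totalQ₂ α β₁ β₂ γ₁ γ₂) (frameF₂ α β₁ β₂ γ₁ γ₂ fun p => F (T₂ p)) :=
  h.solvesConjugate_preimage.isTotalSystem_F₂ fun _ => h.isRegularST₂

theorem linearIndependent_frameF₂ (hp : T₂ p ∈ V) :
    LinearIndependent 𝕜 fun i => frameF₂ α β₁ β₂ γ₁ γ₂ (fun p => F (T₂ p)) i p := by
  refine h.isTotalSystem.linearIndependent (i₀ := 0) h.solvesConjugate_preimage.isOpen
    (isPreconnected_preimage_T₂ h.1.subset_regular h.1.isConnected.isPreconnected) ?_ hp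
  have hF := h.1.independent
  rw [Fintype.linearIndependent_iff] at hF ⊢
  refine fun g hg => hF g (funext fun q => ?_)
  have hT := h.T₂_T₂Inv_of_mem q.2
  simpa [frameF₂, hT] using congrFun hg ⟨T₂Inv q, by simp [hT]⟩

theorem isConjugateSystem :
    IsConjugateSystem (T₂ ⁻¹' V) (fun p => F (T₂ p)) (coeffsF₂ α β₁ β₂ γ₁ γ₂) :=
  h.solvesConjugate_preimage.isConjugateSystem_coeffsF₂ (fun _ => h.isRegularST₂) fun _ hp =>
    h.solvesConjugate_preimage.linearIndependent_jet_F₂ hp (h.linearIndependent_frameF₂ hp)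

theorem isQuadricOn_comp_T₂_iff : IsQuadricOn (T₂ ⁻¹' V) (fun p => F (T₂ p)) ↔ IsQuadricOn V F := by
  refine exists_congr fun M => and_congr_right fun _ => and_congr_right fun _ =>
    ⟨fun hM q hq => ?_, fun hM p hp => hM _ hp⟩
  have hT := h.T₂_T₂Inv_of_mem hq
  simpa only [hT] using hM (T₂Inv q) (by rwa [Set.mem_preimage, hT])

theorem isQuadricOn_of_params_eq (hα : α = β₁ + β₂ - 1 / 2) (hγ₁ : γ₁ = 2 * β₁)
    (hγ₂ : γ₂ = 2 * β₂) : IsQuadricOn V F := by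
  subst hα hγ₁ hγ₂
  obtain ⟨q, hq⟩ := h.1.isConnected.nonempty
  have hp : T₂ (T₂Inv q) ∈ V := by rwa [h.T₂_T₂Inv_of_mem hq]
  exact h.isQuadricOn_comp_T₂_iff.1 <| h.isTotalSystem.isQuadricOn
    h.solvesConjugate_preimage.isOpen
    (isPreconnected_preimage_T₂ h.1.subset_regular h.1.isConnected.isPreconnected) hp
    (h.linearIndependent_frameF₂ hp) (isSymm_adaptedGram ..)
    (det_gramF₂_ne_zero (h.isRegularST₂ hp)) (fun _ _ => rfl) (fun _ _ => rfl)
    fun _ hp => hasPartials_gramF₂ (h.isRegularST₂ hp)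

theorem isQuadricOn_iff :
    IsQuadricOn V F ↔ α = β₁ + β₂ - 1 / 2 ∧ γ₁ = 2 * β₁ ∧ γ₂ = 2 * β₂ := by
  refine ⟨fun hQ => ?_, fun ⟨hα, hγ₁, hγ₂⟩ => h.isQuadricOn_of_params_eq hα hγ₁ hγ₂⟩
  obtain ⟨q, hq⟩ := h.1.isConnected.nonempty
  exact h.isConjugateSystem.params_eq_of_isQuadricOn_F₂ h.solvesConjugate_preimage.isOpen
    (fun _ => h.isRegularST₂) h.solvesConjugate_preimage.smooth (h.isQuadricOn_comp_T₂_iff.2 hQ)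
    ⟨T₂Inv q, by rwa [Set.mem_preimage, h.T₂_T₂Inv_of_mem hq]⟩

variable {z : 𝕜 × 𝕜 → (Fin 4 → 𝕜)} {C : ConjugateCoeffs 𝕜} (hg : IsGaugedPullback T₂ V F U z)

include hg

theorem exists_isConjugateSystem : ∃ C, IsConjugateSystem U z C :=
  hg.exists_isConjugateSystem (h.solvesConjugate hg.isOpen hg.mapsTo).smooth
    (h.isConjugateSystem.mono hg.mapsTo)

theorem h_eq_zero (hC : IsConjugateSystem U z C) (hQ : PosFocalQuadrics U z C) (hp : p ∈ U) :
    C.h p = 0 := by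
  have hw := (h.solvesConjugate hg.isOpen hg.mapsTo).smooth
  have hF := h.isConjugateSystem.mono hg.mapsTo
  exact hg.h_eq_zero hw hF (fun hQ _ => hF.h_eq_zero_F₂ hg.isOpen
    (fun _ hp => h.isRegularST₂ (hg.mapsTo hp)) hw hQ) hC hQ hp

theorem k_eq_zero (hC : IsConjugateSystem U z C) (hQ : NegFocalQuadrics U z C) (hp : p ∈ U) :
    C.k p = 0 := by
  have hw := (h.solvesConjugate hg.isOpen hg.mapsTo).smooth
  have hF := h.isConjugateSystem.mono hg.mapsTo
  exact hg.k_eq_zero hw hF (fun hQ _ => hF.k_eq_zero_F₂ hg.isOpen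
    (fun _ hp => h.isRegularST₂ (hg.mapsTo hp)) hw hQ) hC hQ hp

end IsSurfaceF₂

end SurfaceF₂

section SystemF₄

variable {𝕜 : Type*} [RCLike 𝕜] {E : Type*} [NormedAddCommGroup E] [NormedSpace 𝕜 E]
  {V : Set (𝕜 × 𝕜)} {p : 𝕜 × 𝕜} {α β γ₁ γ₂ : 𝕜} {F : 𝕜 × 𝕜 → E}

/-- The discriminant `(1 - x - y)² - 4 x y`. -/
def disc (p : 𝕜 × 𝕜) : 𝕜 := (1 - p.1 - p.2) ^ 2 - 4 * p.1 * p.2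

/-- The transversal vector `x F_xx + γ₁ F_x` of the moving frame of `S_{F₄}`; by the `F₄` system
it equals `y F_yy + γ₂ F_y`. -/
noncomputable def transversalF₄ (γ₁ : 𝕜) (F : 𝕜 × 𝕜 → E) (p : 𝕜 × 𝕜) : E :=
  p.1 • pd₁ (pd₁ F) p + γ₁ • pd₁ F p

/-- The moving frame `F, x F_x, y F_y, x F_xx + γ₁ F_x` of `S_{F₄}`. -/
noncomputable def frameF₄ (γ₁ : 𝕜) (F : 𝕜 × 𝕜 → E) : Fin 4 → 𝕜 × 𝕜 → E :=
  ![F, fun p => p.1 • pd₁ F p, fun p => p.2 • pd₂ F p, transversalF₄ γ₁ F]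

/-- Coefficients of `y T_y - (1 - x - y) / 2 • T_x` in the frame `frameF₄`, where `T` is the
transversal vector. -/
noncomputable def transversalRow₁ (α β γ₁ γ₂ : 𝕜) (p : 𝕜 × 𝕜) : Fin 4 → 𝕜 :=
  let μ₁ := (γ₁ - 1 - α - β) / 2
  let μ₂ := (γ₂ - 1 - α - β) / 2
  ![-(μ₂ + γ₁ - 1) * (α * β) / (2 * p.1),
    (-μ₁ * (γ₁ - 1) - α * β / 2 + (μ₂ + γ₁ - 1) * μ₁) / p.1,
    (μ₂ + γ₁ - 1) * μ₂ / p.1,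
    μ₁ - 1 / 2 + (μ₂ + γ₁ - 1) * ((1 - p.1 - p.2) / 2) / p.1]

/-- Coefficients of `x T_x - (1 - x - y) / 2 • T_y` in the frame `frameF₄`, where `T` is the
transversal vector. -/
noncomputable def transversalRow₂ (α β γ₁ γ₂ : 𝕜) (p : 𝕜 × 𝕜) : Fin 4 → 𝕜 :=
  let μ₁ := (γ₁ - 1 - α - β) / 2
  let μ₂ := (γ₂ - 1 - α - β) / 2
  ![-(μ₁ + γ₂ - 1) * (α * β) / (2 * p.2),
    (μ₁ + γ₂ - 1) * μ₁ / p.2,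
    (-μ₂ * (γ₂ - 1) - α * β / 2 + (μ₁ + γ₂ - 1) * μ₂) / p.2,
    μ₂ - 1 / 2 + (μ₁ + γ₂ - 1) * ((1 - p.1 - p.2) / 2) / p.2]

/-- The matrix of `∂_x` on the moving frame `frameF₄`. -/
noncomputable def totalP₄ (α β γ₁ γ₂ : 𝕜) (p : 𝕜 × 𝕜) : Matrix (Fin 4) (Fin 4) 𝕜 :=
  Matrix.of ![![0, 1 / p.1, 0, 0],
    ![0, -(γ₁ - 1) / p.1, 0, 1],
    ![-(α * β) / (2 * p.1), (γ₁ - 1 - α - β) / (2 * p.1), (γ₂ - 1 - α - β) / (2 * p.1),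
      (1 - p.1 - p.2) / (2 * p.1)],
    fun j => -4 * (p.2 * transversalRow₂ α β γ₁ γ₂ p j
      + (1 - p.1 - p.2) / 2 * transversalRow₁ α β γ₁ γ₂ p j) / disc p]

/-- The matrix of `∂_y` on the moving frame `frameF₄`. -/
noncomputable def totalQ₄ (α β γ₁ γ₂ : 𝕜) (p : 𝕜 × 𝕜) : Matrix (Fin 4) (Fin 4) 𝕜 :=
  Matrix.of ![![0, 0, 1 / p.2, 0],
    ![-(α * β) / (2 * p.2), (γ₁ - 1 - α - β) / (2 * p.2), (γ₂ - 1 - α - β) / (2 * p.2),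
      (1 - p.1 - p.2) / (2 * p.2)],
    ![0, 0, -(γ₂ - 1) / p.2, 1],
    fun j => -4 * (p.1 * transversalRow₁ α β γ₁ γ₂ p j
      + (1 - p.1 - p.2) / 2 * transversalRow₂ α β γ₁ γ₂ p j) / disc p]

theorem continuousOn_transversalRow₁ (hx : ∀ p ∈ V, p.1 ≠ 0) (j : Fin 4) :
    ContinuousOn (fun p => transversalRow₁ α β γ₁ γ₂ p j) V := by
  have hx2 : ∀ p ∈ V, 2 * p.1 ≠ 0 := fun p hp => mul_ne_zero two_ne_zero (hx p hp)
  unfold transversalRow₁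
  fin_cases j <;> simp only [Fin.zero_eta, Fin.mk_one, Fin.reduceFinMk, Matrix.cons_val] <;>
  fun_prop (disch := assumption)

theorem continuousOn_transversalRow₂ (hy : ∀ p ∈ V, p.2 ≠ 0) (j : Fin 4) :
    ContinuousOn (fun p => transversalRow₂ α β γ₁ γ₂ p j) V := by
  have hy2 : ∀ p ∈ V, 2 * p.2 ≠ 0 := fun p hp => mul_ne_zero two_ne_zero (hy p hp)
  unfold transversalRow₂
  fin_cases j <;> simp only [Fin.zero_eta, Fin.mk_one, Fin.reduceFinMk, Matrix.cons_val] <;>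
  fun_prop (disch := assumption)

theorem continuous_disc : Continuous (disc (𝕜 := 𝕜)) := by
  unfold disc
  fun_prop

open scoped Matrix.Norms.Elementwise in
theorem continuousOn_totalP₄ (hV : V ⊆ regularF₄ 𝕜) : ContinuousOn (totalP₄ α β γ₁ γ₂) V := by
  have hx : ∀ p ∈ V, p.1 ≠ 0 := fun p hp => (hV hp).1
  have hx2 : ∀ p ∈ V, 2 * p.1 ≠ 0 := fun p hp => mul_ne_zero two_ne_zero (hx p hp)
  have hD : ∀ p ∈ V, disc p ≠ 0 := fun p hp => (hV hp).2.2
  have hdisc := continuous_disc (𝕜 := 𝕜)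
  have hrow₁ := continuousOn_transversalRow₁ (α := α) (β := β) (γ₁ := γ₁) (γ₂ := γ₂) hx
  have hrow₂ := continuousOn_transversalRow₂ (α := α) (β := β) (γ₁ := γ₁) (γ₂ := γ₂)
    fun p hp => (hV hp).2.1
  refine continuousOn_pi.2 fun i => continuousOn_pi.2 fun j => ?_
  have hrow₁ := hrow₁ j
  have hrow₂ := hrow₂ j
  unfold totalP₄
  fin_cases i
  on_goal 4 =>
    simp only [Fin.reduceFinMk, Matrix.of_apply, Matrix.cons_val]
    fun_prop (disch := assumption)
  all_goals
    fin_cases j <;> simp only [Fin.zero_eta, Fin.mk_one, Fin.reduceFinMk,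
      Matrix.of_apply, Matrix.cons_val] <;> fun_prop (disch := assumption)

open scoped Matrix.Norms.Elementwise in
theorem continuousOn_totalQ₄ (hV : V ⊆ regularF₄ 𝕜) : ContinuousOn (totalQ₄ α β γ₁ γ₂) V := by
  have hy : ∀ p ∈ V, p.2 ≠ 0 := fun p hp => (hV hp).2.1
  have hy2 : ∀ p ∈ V, 2 * p.2 ≠ 0 := fun p hp => mul_ne_zero two_ne_zero (hy p hp)
  have hD : ∀ p ∈ V, disc p ≠ 0 := fun p hp => (hV hp).2.2
  have hdisc := continuous_disc (𝕜 := 𝕜)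
  have hrow₁ := continuousOn_transversalRow₁ (α := α) (β := β) (γ₁ := γ₁) (γ₂ := γ₂)
    fun p hp => (hV hp).1
  have hrow₂ := continuousOn_transversalRow₂ (α := α) (β := β) (γ₁ := γ₁) (γ₂ := γ₂) hy
  refine continuousOn_pi.2 fun i => continuousOn_pi.2 fun j => ?_
  have hrow₁ := hrow₁ j
  have hrow₂ := hrow₂ j
  unfold totalQ₄
  fin_cases i
  on_goal 4 =>
    simp only [Fin.reduceFinMk, Matrix.of_apply, Matrix.cons_val]
    fun_prop (disch := assumption)
  all_goals
    fin_cases j <;> simp only [Fin.zero_eta, Fin.mk_one, Fin.reduceFinMk,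
      Matrix.of_apply, Matrix.cons_val] <;> fun_prop (disch := assumption)

namespace SolvesAppellF₄

variable (h : SolvesAppellF₄ α β γ₁ γ₂ V F)

include h

theorem mul_smul_pd₂_pd₁ (hp : p ∈ V) :
    (p.1 * p.2) • pd₂ (pd₁ F) p = ((1 - p.1 - p.2) / 2) • transversalF₄ γ₁ F p
      + ((γ₁ - 1 - α - β) / 2) • p.1 • pd₁ F p + ((γ₂ - 1 - α - β) / 2) • p.2 • pd₂ F p
      - (α * β / 2) • F p := by
  obtain ⟨h₁, -⟩ := h p hp
  simp only [transversalF₄]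
  linear_combination (norm := skip) (1 / 2 : 𝕜) • h₁
  match_scalars <;> ring

variable (hV : IsOpen V) (hF : ContDiffOn 𝕜 ∞ F V)

include hV hF

/- The difference of the two equations is `x + y - 1` times the asserted one, and the line
`x + y = 1` has empty interior. -/
theorem transversalF₄_eq (hp : p ∈ V) :
    transversalF₄ γ₁ F p = p.2 • pd₂ (pd₂ F) p + γ₂ • pd₂ F p := by
  set R : 𝕜 × 𝕜 → E := fun p => transversalF₄ γ₁ F p - (p.2 • pd₂ (pd₂ F) p + γ₂ • pd₂ F p)
  have hR : ContinuousOn R V := by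
    have hx := contDiffOn_pd₁ hV hF
    have hy := contDiffOn_pd₂ hV hF
    have hx' := hx.continuousOn
    have hy' := hy.continuousOn
    have hxx := (contDiffOn_pd₁ hV hx).continuousOn
    have hyy := (contDiffOn_pd₂ hV hy).continuousOn
    unfold R transversalF₄
    fun_prop
  have hmul : ∀ q ∈ V, (q.1 + q.2 - 1) • R q = 0 := fun q hq => by
    obtain ⟨h₁, h₂⟩ := h q hq
    simp only [R, transversalF₄]
    linear_combination (norm := skip) (1 : 𝕜) • h₁ - (1 : 𝕜) • h₂
    match_scalars <;> ring
  by_contra hne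
  have hpR : p ∈ V ∩ {q | R q ≠ 0} := ⟨hp, sub_ne_zero.2 hne⟩
  have hline : ∀ q ∈ V ∩ {q | R q ≠ 0}, q.1 + q.2 - 1 = 0 := fun q hq =>
    (smul_eq_zero.1 (hmul q hq.1)).resolve_right hq.2
  obtain ⟨x, hx, hxp⟩ := (infinite_horizontal_slice (hR.isOpen_inter_preimage hV isOpen_ne)
    hpR).exists_notMem_finset {p.1}
  refine hxp (Finset.mem_singleton.2 ?_)
  linear_combination hline _ hx - hline p hpR

theorem hasPartials_fst_smul_pd₁ (hx : p.1 ≠ 0) (hy : p.2 ≠ 0) (hp : p ∈ V) :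
    HasPartials (fun p => p.1 • pd₁ F p) p
      ((-(γ₁ - 1) / p.1) • p.1 • pd₁ F p + transversalF₄ γ₁ F p)
      ((-(α * β) / (2 * p.2)) • F p + ((γ₁ - 1 - α - β) / (2 * p.2)) • p.1 • pd₁ F p
        + ((γ₂ - 1 - α - β) / (2 * p.2)) • p.2 • pd₂ F p
        + ((1 - p.1 - p.2) / (2 * p.2)) • transversalF₄ γ₁ F p) := by
  refine (HasDirDerivs.coord₁.smul
    (HasPartials.of_contDiffOn hV (contDiffOn_pd₁ hV hF) hp)).congr ?_ ?_
  · simp only [transversalF₄]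
    match_scalars <;> field_simp
    ring
  · linear_combination (norm := skip) (1 / p.2) • h.mul_smul_pd₂_pd₁ hp
    match_scalars <;> field_simp <;> ring

theorem hasPartials_snd_smul_pd₂ (hx : p.1 ≠ 0) (hy : p.2 ≠ 0) (hp : p ∈ V) :
    HasPartials (fun p => p.2 • pd₂ F p) p
      ((-(α * β) / (2 * p.1)) • F p + ((γ₁ - 1 - α - β) / (2 * p.1)) • p.1 • pd₁ F p
        + ((γ₂ - 1 - α - β) / (2 * p.1)) • p.2 • pd₂ F p
        + ((1 - p.1 - p.2) / (2 * p.1)) • transversalF₄ γ₁ F p)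
      ((-(γ₂ - 1) / p.2) • p.2 • pd₂ F p + transversalF₄ γ₁ F p) := by
  refine (HasDirDerivs.coord₂.smul
    (HasPartials.of_contDiffOn hV (contDiffOn_pd₂ hV hF) hp)).congr ?_ ?_
  · rw [pd₁_pd₂_comm hV hF hp]
    linear_combination (norm := skip) (1 / p.1) • h.mul_smul_pd₂_pd₁ hp
    match_scalars <;> field_simp <;> ring
  · rw [h.transversalF₄_eq hV hF hp]
    match_scalars <;> field_simp
    ring

omit h in
theorem contDiffOn_transversalF₄ : ContDiffOn 𝕜 ∞ (transversalF₄ γ₁ F) V :=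
  (contDiffOn_fst.smul (contDiffOn_pd₁ hV (contDiffOn_pd₁ hV hF))).add
    ((contDiffOn_pd₁ hV hF).const_smul γ₁)

variable (hx : ∀ p ∈ V, p.1 ≠ 0) (hy : ∀ p ∈ V, p.2 ≠ 0)

include hx hy

theorem snd_smul_pd₂_transversalF₄_sub (hp : p ∈ V) :
    p.2 • pd₂ (transversalF₄ γ₁ F) p - ((1 - p.1 - p.2) / 2) • pd₁ (transversalF₄ γ₁ F) p =
      ∑ j, transversalRow₁ α β γ₁ γ₂ p j • frameF₄ γ₁ F j p := by
  have hpx := hx p hp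
  have hpy := hy p hp
  have hy2 : 2 * p.2 ≠ 0 := mul_ne_zero two_ne_zero hpy
  have smooth_tangent : ContDiffOn 𝕜 ∞ (fun p => p.1 • pd₁ F p) V :=
    contDiffOn_fst.smul (contDiffOn_pd₁ hV hF)
  have tangent₁ {q} (hq : q ∈ V) := h.hasPartials_fst_smul_pd₁ hV hF (hx q hq) (hy q hq) hq
  have tangent₂ := h.hasPartials_snd_smul_pd₂ hV hF hpx hpy hp
  have transversal := HasPartials.of_contDiffOn hV (contDiffOn_transversalF₄ (γ₁ := γ₁) hV hF) hp
  have two_y := HasDirDerivs.mul (.const 2) (.coord₂ (p := p))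
  have mixed := HasDirDerivs.eq_of_eqOn hV hp (fun q hq => (tangent₁ hq).fst)
    (HasPartials.of_contDiffOn hV (contDiffOn_pd₁ hV smooth_tangent) hp)
    ((((HasDirDerivs.const (-(γ₁ - 1))).div .coord₁ hpx).smul (tangent₁ hp)).add transversal)
  have mixed' := HasDirDerivs.eq_of_eqOn hV hp (fun q hq => (tangent₁ hq).snd)
    (HasPartials.of_contDiffOn hV (contDiffOn_pd₂ hV smooth_tangent) hp)
    ((((((HasDirDerivs.const _).div two_y hy2).smul (HasPartials.of_contDiffOn hV hF hp)).add
      (((HasDirDerivs.const _).div two_y hy2).smul (tangent₁ hp))).add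
      (((HasDirDerivs.const _).div two_y hy2).smul tangent₂)).add
      ((((HasDirDerivs.const 1).sub .coord₁ |>.sub .coord₂).div two_y hy2).smul transversal))
  have compat := mixed.2.symm.trans ((pd₁_pd₂_comm hV smooth_tangent hp).symm.trans mixed'.1)
  simp only [Fin.sum_univ_four, transversalRow₁, frameF₄, Matrix.cons_val]
  linear_combination (norm := skip) p.2 • compat
  match_scalars <;> field_simp <;> ring

theorem fst_smul_pd₁_transversalF₄_sub (hp : p ∈ V) :
    p.1 • pd₁ (transversalF₄ γ₁ F) p - ((1 - p.1 - p.2) / 2) • pd₂ (transversalF₄ γ₁ F) p =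
      ∑ j, transversalRow₂ α β γ₁ γ₂ p j • frameF₄ γ₁ F j p := by
  have hpx := hx p hp
  have hpy := hy p hp
  have hx2 : 2 * p.1 ≠ 0 := mul_ne_zero two_ne_zero hpx
  have smooth_tangent : ContDiffOn 𝕜 ∞ (fun p => p.2 • pd₂ F p) V :=
    contDiffOn_snd.smul (contDiffOn_pd₂ hV hF)
  have tangent₁ := h.hasPartials_fst_smul_pd₁ hV hF hpx hpy hp
  have tangent₂ {q} (hq : q ∈ V) := h.hasPartials_snd_smul_pd₂ hV hF (hx q hq) (hy q hq) hq
  have transversal := HasPartials.of_contDiffOn hV (contDiffOn_transversalF₄ (γ₁ := γ₁) hV hF) hp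
  have two_x := HasDirDerivs.mul (.const 2) (.coord₁ (p := p))
  have mixed := HasDirDerivs.eq_of_eqOn hV hp (fun q hq => (tangent₂ hq).snd)
    (HasPartials.of_contDiffOn hV (contDiffOn_pd₂ hV smooth_tangent) hp)
    ((((HasDirDerivs.const (-(γ₂ - 1))).div .coord₂ hpy).smul (tangent₂ hp)).add transversal)
  have mixed' := HasDirDerivs.eq_of_eqOn hV hp (fun q hq => (tangent₂ hq).fst)
    (HasPartials.of_contDiffOn hV (contDiffOn_pd₁ hV smooth_tangent) hp)
    ((((((HasDirDerivs.const _).div two_x hx2).smul (HasPartials.of_contDiffOn hV hF hp)).add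
      (((HasDirDerivs.const _).div two_x hx2).smul tangent₁)).add
      (((HasDirDerivs.const _).div two_x hx2).smul (tangent₂ hp))).add
      ((((HasDirDerivs.const 1).sub .coord₁ |>.sub .coord₂).div two_x hx2).smul transversal))
  have compat := mixed.1.symm.trans ((pd₁_pd₂_comm hV smooth_tangent hp).trans mixed'.2)
  simp only [Fin.sum_univ_four, transversalRow₂, frameF₄, Matrix.cons_val]
  linear_combination (norm := skip) p.1 • compat
  match_scalars <;> field_simp <;> ring

end SolvesAppellF₄

end SystemF₄

section TotalSystemF₄

variable {𝕜 : Type*} [RCLike 𝕜] {E : Type*} [NormedAddCommGroup E] [NormedSpace 𝕜 E]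
  {V : Set (𝕜 × 𝕜)} {p : 𝕜 × 𝕜} {α β γ₁ γ₂ : 𝕜} {F : 𝕜 × 𝕜 → E}
namespace SolvesAppellF₄
variable (h : SolvesAppellF₄ α β γ₁ γ₂ V F) (hV : IsOpen V) (hF : ContDiffOn 𝕜 ∞ F V)
include h hV hF
variable (hVr : V ⊆ regularF₄ 𝕜)

include hVr

theorem hasPartials_transversalF₄ (hp : p ∈ V) :
    HasPartials (transversalF₄ γ₁ F) p (∑ j, totalP₄ α β γ₁ γ₂ p 3 j • frameF₄ γ₁ F j p)
      (∑ j, totalQ₄ α β γ₁ γ₂ p 3 j • frameF₄ γ₁ F j p) := by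
  have hD : disc p ≠ 0 := (hVr hp).2.2
  have row₁ := h.snd_smul_pd₂_transversalF₄_sub hV hF (fun p hp => (hVr hp).1)
    (fun p hp => (hVr hp).2.1) hp
  have row₂ := h.fst_smul_pd₁_transversalF₄_sub hV hF (fun p hp => (hVr hp).1)
    (fun p hp => (hVr hp).2.1) hp
  simp only [Fin.sum_univ_four] at row₁ row₂
  refine (HasPartials.of_contDiffOn hV (contDiffOn_transversalF₄ hV hF) hp).congr ?_ ?_ <;>
    simp only [Fin.sum_univ_four, totalP₄, totalQ₄, Matrix.of_apply, Matrix.cons_val]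
  · linear_combination (norm := skip) (-4 * p.2 / disc p) • row₂
      + (-4 * ((1 - p.1 - p.2) / 2) / disc p) • row₁
    match_scalars <;> field_simp <;> simp only [disc] <;> ring
  · linear_combination (norm := skip) (-4 * p.1 / disc p) • row₁
      + (-4 * ((1 - p.1 - p.2) / 2) / disc p) • row₂
    match_scalars <;> field_simp <;> simp only [disc] <;> ring

theorem isTotalSystem_F₄ :
    IsTotalSystem V (totalP₄ α β γ₁ γ₂) (totalQ₄ α β γ₁ γ₂) (frameF₄ γ₁ F) where
  continuousOn_fst := continuousOn_totalP₄ hVr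
  continuousOn_snd := continuousOn_totalQ₄ hVr
  hasPartials p hp i := by
    obtain ⟨hx, hy, -⟩ := hVr hp
    fin_cases i
    · refine (HasPartials.of_contDiffOn hV hF hp).congr ?_ ?_ <;>
      simp [Fin.sum_univ_four, totalP₄, totalQ₄, frameF₄, smul_smul, hx, hy]
    · refine (h.hasPartials_fst_smul_pd₁ hV hF hx hy hp).congr ?_ ?_ <;>
      simp [Fin.sum_univ_four, totalP₄, totalQ₄, frameF₄]
    · refine (h.hasPartials_snd_smul_pd₂ hV hF hx hy hp).congr ?_ ?_ <;>
      simp [Fin.sum_univ_four, totalP₄, totalQ₄, frameF₄]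
    · exact h.hasPartials_transversalF₄ hV hF hVr hp

end SolvesAppellF₄

end TotalSystemF₄

section QuadricF₄

variable {𝕜 : Type*} [RCLike 𝕜] {α β γ₁ γ₂ : 𝕜} {V : Set (𝕜 × 𝕜)} {p : 𝕜 × 𝕜}

theorem hasPartials_disc :
    HasPartials (disc (𝕜 := 𝕜)) p (-2 * (1 - p.1 + p.2)) (-2 * (1 + p.1 - p.2)) := by
  refine (((((HasDirDerivs.const 1).sub .coord₁).sub .coord₂).pow 2).sub
    (((HasDirDerivs.const 4).mul .coord₁).mul .coord₂)).congr ?_ ?_ <;> ring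

/-- The Gram matrix of the frame `frameF₄` for the quadric containing `S_{F₄}`, up to a scalar
function, in the case `γ₂ = α + β - γ₁ + 1`; `κ` stands for `α β`. -/
noncomputable def gramF₄ (κ γ₁ γ₂ : 𝕜) (p : 𝕜 × 𝕜) : Matrix (Fin 4) (Fin 4) 𝕜 :=
  adaptedGram p.1 ((1 - p.1 - p.2) / 2) p.2 (γ₁ / 2 + p.1 * (1 - p.1 + p.2) / disc p)
    (γ₂ / 2 + p.2 * (1 + p.1 - p.2) / disc p)
    ((1 - p.1 - p.2) ^ 2 / disc p ^ 2 - ((γ₁ - 1) ^ 2 * p.2 + (γ₂ - 1) ^ 2 * p.1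
      + (1 - p.1 - p.2) * (2 * κ + 1 - γ₁ * γ₂)) / disc p)

theorem det_gramF₄_ne_zero {κ : 𝕜} (hp : disc p ≠ 0) : (gramF₄ κ γ₁ γ₂ p).det ≠ 0 := by
  rw [gramF₄, det_adaptedGram,
    show ((1 - p.1 - p.2) / 2) ^ 2 - p.1 * p.2 = disc p / 4 by rw [disc]; ring]
  exact div_ne_zero hp (by norm_num)

theorem gramDeriv_totalP₄_sub (hγ : γ₂ = α + β - γ₁ + 1) (hp : p ∈ regularF₄ 𝕜) :
    gramDeriv (totalP₄ α β γ₁ γ₂ p) (gramF₄ (α * β) γ₁ γ₂ p)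
        - (-(γ₁ - 1) / p.1 + 2 * (1 - p.1 + p.2) / disc p) • gramF₄ (α * β) γ₁ γ₂ p =
      !![0, 0, 0, 0;
        0, 1, -1 / 2,
          (1 - 2 * p.1 + p.2) / disc p + 2 * p.1 * (1 - p.1 + p.2) ^ 2 / disc p ^ 2;
        0, -1 / 2, 0,
          p.2 / disc p + 2 * p.2 * (1 - p.1 + p.2) * (1 + p.1 - p.2) / disc p ^ 2;
        0, (1 - 2 * p.1 + p.2) / disc p + 2 * p.1 * (1 - p.1 + p.2) ^ 2 / disc p ^ 2,
          p.2 / disc p + 2 * p.2 * (1 - p.1 + p.2) * (1 + p.1 - p.2) / disc p ^ 2,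
          4 * (1 - p.1 - p.2) ^ 2 * (1 - p.1 + p.2) / disc p ^ 3 - 2 * (1 - p.1 - p.2) / disc p ^ 2
            - ((γ₂ - 1) ^ 2 - (2 * (α * β) + 1 - γ₁ * γ₂)) / disc p
            - 2 * ((γ₁ - 1) ^ 2 * p.2 + (γ₂ - 1) ^ 2 * p.1
              + (1 - p.1 - p.2) * (2 * (α * β) + 1 - γ₁ * γ₂)) * (1 - p.1 + p.2) / disc p ^ 2] := by
  subst hγ
  obtain ⟨hx, hy, hD⟩ := hp
  change disc p ≠ 0 at hD
  ext i j
  simp only [Matrix.sub_apply, Matrix.smul_apply, gramDeriv_apply, Fin.sum_univ_four, gramF₄,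
    adaptedGram, totalP₄, transversalRow₁, transversalRow₂, smul_eq_mul]
  fin_cases i <;> fin_cases j <;> simp only [Matrix.of_apply, Matrix.cons_val', Matrix.cons_val,
    Fin.zero_eta, Fin.mk_one, Fin.reduceFinMk]
  all_goals
    field_simp
    simp only [disc]
    ring

theorem gramDeriv_totalQ₄_sub (hγ : γ₂ = α + β - γ₁ + 1) (hp : p ∈ regularF₄ 𝕜) :
    gramDeriv (totalQ₄ α β γ₁ γ₂ p) (gramF₄ (α * β) γ₁ γ₂ p)
        - (-(γ₂ - 1) / p.2 + 2 * (1 + p.1 - p.2) / disc p) • gramF₄ (α * β) γ₁ γ₂ p =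
      !![0, 0, 0, 0;
        0, 0, -1 / 2,
          p.1 / disc p + 2 * p.1 * (1 - p.1 + p.2) * (1 + p.1 - p.2) / disc p ^ 2;
        0, -1 / 2, 1,
          (1 + p.1 - 2 * p.2) / disc p + 2 * p.2 * (1 + p.1 - p.2) ^ 2 / disc p ^ 2;
        0, p.1 / disc p + 2 * p.1 * (1 - p.1 + p.2) * (1 + p.1 - p.2) / disc p ^ 2,
          (1 + p.1 - 2 * p.2) / disc p + 2 * p.2 * (1 + p.1 - p.2) ^ 2 / disc p ^ 2,
          4 * (1 - p.1 - p.2) ^ 2 * (1 + p.1 - p.2) / disc p ^ 3 - 2 * (1 - p.1 - p.2) / disc p ^ 2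
            - ((γ₁ - 1) ^ 2 - (2 * (α * β) + 1 - γ₁ * γ₂)) / disc p
            - 2 * ((γ₁ - 1) ^ 2 * p.2 + (γ₂ - 1) ^ 2 * p.1
              + (1 - p.1 - p.2) * (2 * (α * β) + 1 - γ₁ * γ₂)) * (1 + p.1 - p.2) / disc p ^ 2] := by
  subst hγ
  obtain ⟨hx, hy, hD⟩ := hp
  change disc p ≠ 0 at hD
  ext i j
  simp only [Matrix.sub_apply, Matrix.smul_apply, gramDeriv_apply, Fin.sum_univ_four, gramF₄,
    adaptedGram, totalQ₄, transversalRow₁, transversalRow₂, smul_eq_mul]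
  fin_cases i <;> fin_cases j <;> simp only [Matrix.of_apply, Matrix.cons_val', Matrix.cons_val,
    Fin.zero_eta, Fin.mk_one, Fin.reduceFinMk]
  all_goals
    field_simp
    simp only [disc]
    ring

open scoped Matrix.Norms.Elementwise in
theorem hasPartials_gramF₄ (hγ : γ₂ = α + β - γ₁ + 1) (hp : p ∈ regularF₄ 𝕜) :
    HasPartials (gramF₄ (α * β) γ₁ γ₂) p
      (gramDeriv (totalP₄ α β γ₁ γ₂ p) (gramF₄ (α * β) γ₁ γ₂ p)
        - (-(γ₁ - 1) / p.1 + 2 * (1 - p.1 + p.2) / disc p) • gramF₄ (α * β) γ₁ γ₂ p)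
      (gramDeriv (totalQ₄ α β γ₁ γ₂ p) (gramF₄ (α * β) γ₁ γ₂ p)
        - (-(γ₂ - 1) / p.2 + 2 * (1 + p.1 - p.2) / disc p) • gramF₄ (α * β) γ₁ γ₂ p) := by
  rw [gramDeriv_totalP₄_sub hγ hp, gramDeriv_totalQ₄_sub hγ hp]
  have hD : disc p ≠ 0 := hp.2.2
  have hG := ((HasDirDerivs.const 1).sub .coord₁).sub (.coord₂ (p := p))
  refine hasPartials_adaptedGram .coord₁ ((hG.div (.const 2) two_ne_zero).congr ?_ ?_) .coord₂
    (((HasDirDerivs.const (γ₁ / 2)).add ((HasDirDerivs.mul .coord₁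
      (((HasDirDerivs.const 1).sub .coord₁).add .coord₂)).div hasPartials_disc hD)).congr ?_ ?_)
    (((HasDirDerivs.const (γ₂ / 2)).add ((HasDirDerivs.mul .coord₂
      (((HasDirDerivs.const 1).add .coord₁).sub .coord₂)).div hasPartials_disc hD)).congr ?_ ?_)
    ((((hG.pow 2).div (hasPartials_disc.pow 2) (pow_ne_zero 2 hD)).sub
      ((((HasDirDerivs.mul (.const _) .coord₂).add (.mul (.const _) .coord₁)).add
        (hG.mul (.const _))).div hasPartials_disc hD)).congr ?_ ?_)
  all_goals
    field_simp
    ring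

end QuadricF₄

section GramSystemF₄

variable {𝕜 : Type*} [RCLike 𝕜] {α β γ₁ γ₂ : 𝕜} {V : Set (𝕜 × 𝕜)} {p : 𝕜 × 𝕜}

open scoped Matrix.Norms.Elementwise in
theorem hasPartials_entry {n : Type*} [Fintype n] {K : 𝕜 × 𝕜 → Matrix n n 𝕜}
    {K₁ K₂ : Matrix n n 𝕜} (h : HasPartials K p K₁ K₂) (i j : n) :
    HasPartials (fun p => K p i j) p (K₁ i j) (K₂ i j) :=
  h.clm (Matrix.entryLinearMap 𝕜 𝕜 i j).toContinuousLinearMap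

variable {K : 𝕜 × 𝕜 → Matrix (Fin 4) (Fin 4) 𝕜} (hV : IsOpen V) (hVr : V ⊆ regularF₄ 𝕜)
  (hK : ∀ p ∈ V, ∀ i j, HasPartials (fun p => K p i j) p
    (gramDeriv (totalP₄ α β γ₁ γ₂ p) (K p) i j) (gramDeriv (totalQ₄ α β γ₁ γ₂ p) (K p) i j))
  (hsymm : ∀ p, (K p).IsSymm) (h00 : ∀ p ∈ V, K p 0 0 = 0)

include hV hVr hK hsymm h00

theorem gram_fst_snd_eq_zero_F₄ (hp : p ∈ V) : K p 0 1 = 0 ∧ K p 0 2 = 0 := by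
  obtain ⟨hx, hy, -⟩ := hVr hp
  obtain ⟨e₁, e₂⟩ := HasDirDerivs.eq_of_eqOn hV hp h00 (hK p hp 0 0) (.const 0)
  simp only [gramDeriv_apply, Fin.sum_univ_four, totalP₄, totalQ₄, Matrix.of_apply,
    Matrix.cons_val, (hsymm p).apply 0 1, (hsymm p).apply 0 2] at e₁ e₂
  field_simp at e₁ e₂
  exact ⟨by linear_combination e₁ / 2, by linear_combination e₂ / 2⟩

theorem gram_tangent_F₄ (hp : p ∈ V) : K p 1 1 = p.1 * -K p 0 3 ∧
    K p 1 2 = (1 - p.1 - p.2) / 2 * -K p 0 3 ∧ K p 2 2 = p.2 * -K p 0 3 := by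
  obtain ⟨hx, hy, -⟩ := hVr hp
  have h0 (q) (hq : q ∈ V) := gram_fst_snd_eq_zero_F₄ hV hVr hK hsymm h00 hq
  obtain ⟨h01, h02⟩ := h0 p hp
  obtain ⟨e₁, e₂⟩ := HasDirDerivs.eq_of_eqOn hV hp (fun q hq => (h0 q hq).1) (hK p hp 0 1)
    (.const 0)
  have e₃ := (HasDirDerivs.eq_of_eqOn hV hp (fun q hq => (h0 q hq).2) (hK p hp 0 2)
    (.const 0)).2
  simp only [gramDeriv_apply, Fin.sum_univ_four, totalP₄, totalQ₄, Matrix.of_apply,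
    Matrix.cons_val, h00 p hp, h01, h02, (hsymm p).apply 1 2] at e₁ e₂ e₃
  field_simp at e₁ e₂ e₃
  exact ⟨by linear_combination e₁, by linear_combination e₂ / 2, by linear_combination e₃⟩

theorem mul_gram_eq_zero_F₄ (hp : p ∈ V) : (γ₁ + γ₂ - 1 - α - β) * K p 0 3 = 0 := by
  obtain ⟨hx, hy, -⟩ := hVr hp
  have htan (q) (hq : q ∈ V) := gram_tangent_F₄ hV hVr hK hsymm h00 hq
  obtain ⟨h01, h02⟩ := gram_fst_snd_eq_zero_F₄ hV hVr hK hsymm h00 hp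
  obtain ⟨h11, h12, h22⟩ := htan p hp
  have dA := (hK p hp 0 3).neg
  generalize gramDeriv (totalP₄ α β γ₁ γ₂ p) (K p) 0 3 = Ax at dA
  generalize gramDeriv (totalQ₄ α β γ₁ γ₂ p) (K p) 0 3 = Ay at dA
  obtain ⟨a₁, a₂⟩ := HasDirDerivs.eq_of_eqOn hV hp (fun q hq => (htan q hq).1) (hK p hp 1 1)
    (HasDirDerivs.coord₁.mul dA)
  obtain ⟨b₁, b₂⟩ := HasDirDerivs.eq_of_eqOn hV hp (fun q hq => (htan q hq).2.1) (hK p hp 1 2)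
    (((((HasDirDerivs.const 1).sub .coord₁).sub .coord₂).div (.const 2) two_ne_zero).mul dA)
  obtain ⟨c₁, c₂⟩ := HasDirDerivs.eq_of_eqOn hV hp (fun q hq => (htan q hq).2.2) (hK p hp 2 2)
    (HasDirDerivs.coord₂.mul dA)
  simp only [gramDeriv_apply, Fin.sum_univ_four, totalP₄, totalQ₄, Matrix.of_apply,
    Matrix.cons_val, zero_mul, mul_zero, one_mul, zero_add, add_zero, zero_sub, h01, h02,
    h11, h12, h22, (hsymm p).apply 0 1, (hsymm p).apply 0 2,
    (hsymm p).apply 1 2, (hsymm p).apply 1 3, (hsymm p).apply 2 3]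
    at a₁ a₂ b₁ b₂ c₁ c₂
  field_simp at a₁ a₂ b₁ b₂ c₁ c₂
  have e₁ : (γ₁ + γ₂ - 1 - α - β) * ((1 + p.1 - p.2) / 2) * -K p 0 3 = 0 := by
    linear_combination b₁ / 4 - (1 - p.1 - p.2) / 2 * a₁ + a₂ / 8 - p.1 * c₂ / 2
  have e₂ : (γ₁ + γ₂ - 1 - α - β) * ((1 - p.1 + p.2) / 2) * -K p 0 3 = 0 := by
    linear_combination b₂ / 4 - (1 - p.1 - p.2) / 2 * c₂ + c₁ / 8 - p.2 * a₁ / 2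
  linear_combination -e₁ - e₂

end GramSystemF₄

section ConjugateF₄

variable {𝕜 : Type*} [RCLike 𝕜] {E : Type*} [NormedAddCommGroup E] [NormedSpace 𝕜 E]
  {α β γ₁ γ₂ : 𝕜} {U V : Set (𝕜 × 𝕜)} {p : 𝕜 × 𝕜}

/-- The complement, in the coordinates `(s, t)` of `T₄`, of the singular locus of the `F₄`
system. -/
structure IsRegularST₄ (p : 𝕜 × 𝕜) : Prop where
  add_ne_zero : p.1 + p.2 ≠ 0
  sub_ne_zero : p.1 - p.2 ≠ 0
  fst_ne : 4 * p.1 ^ 2 - 1 ≠ 0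
  snd_ne : 4 * p.2 ^ 2 - 1 ≠ 0

theorem disc_T₄ (hp : p.1 + p.2 ≠ 0) :
    disc (T₄ p) = (4 * p.1 ^ 2 - 1) * (4 * p.2 ^ 2 - 1) / (p.1 + p.2) ^ 4 := by
  simp only [disc, T₄]
  field_simp
  ring

theorem isRegularST₄_of_T₄_mem (h : T₄ p ∈ regularF₄ 𝕜) : IsRegularST₄ p := by
  obtain ⟨hx, hy, hD⟩ := h
  have hu : p.1 + p.2 ≠ 0 := fun h => hx (by simp [T₄, h])
  change disc (T₄ p) ≠ 0 at hD
  rw [disc_T₄ hu] at hD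
  exact ⟨hu, fun h => hy (by simp [T₄, h]), fun h => hD (by simp [h]), fun h => hD (by simp [h])⟩

/-- The coefficients of the conjugate system of `S_{F₄}`. -/
noncomputable def coeffsF₄ (α β γ₁ γ₂ : 𝕜) : ConjugateCoeffs 𝕜 :=
  let a := fun p : 𝕜 × 𝕜 => (1 / 2 - α - β) / (p.1 + p.2) - (γ₂ - 1 / 2) / (p.1 - p.2)
  let b := fun p : 𝕜 × 𝕜 => (1 / 2 - α - β) / (p.1 + p.2) + (γ₂ - 1 / 2) / (p.1 - p.2)
  let c := fun p : 𝕜 × 𝕜 => 4 * α * β / (p.1 + p.2) ^ 2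
  { a := a
    b := b
    c := c
    q := fun p => (4 * p.1 ^ 2 - 1) / (4 * p.2 ^ 2 - 1)
    m := fun p => (-(8 * p.1 * p.2 + 2) * a p + 4 * (3 - 2 * γ₁) * p.1
      - 4 * (γ₂ - 1 / 2) / (p.1 - p.2)) / (4 * p.2 ^ 2 - 1)
    n := fun p => (-(8 * p.1 * p.2 + 2) * b p + 4 * (3 - 2 * γ₁) * p.2
      + 4 * (γ₂ - 1 / 2) / (p.1 - p.2)) / (4 * p.2 ^ 2 - 1)
    r := fun p => -(8 * p.1 * p.2 + 2) * c p / (4 * p.2 ^ 2 - 1) }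

theorem hasPartials_comp_T₄ {g : 𝕜 × 𝕜 → E} (hV : IsOpen V) (hg : ContDiffOn 𝕜 ∞ g V)
    (hp : T₄ p ∈ V) (hu : p.1 + p.2 ≠ 0) :
    HasPartials (fun p => g (T₄ p)) p
      ((-2 / (p.1 + p.2) ^ 3) • pd₁ g (T₄ p)
        + (4 * (p.1 - p.2) * p.2 / (p.1 + p.2) ^ 3) • pd₂ g (T₄ p))
      ((-2 / (p.1 + p.2) ^ 3) • pd₁ g (T₄ p)
        + (-4 * (p.1 - p.2) * p.1 / (p.1 + p.2) ^ 3) • pd₂ g (T₄ p)) := by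
  have hu2 : (p.1 + p.2) ^ 2 ≠ 0 := pow_ne_zero 2 hu
  refine (HasDirDerivs.comp (S := fun p => 1 / (p.1 + p.2) ^ 2)
    (T := fun p => (p.1 - p.2) ^ 2 / (p.1 + p.2) ^ 2) (HasPartials.of_contDiffOn hV hg hp)
    ((HasDirDerivs.const 1).div (hasPartials_add.pow 2) hu2)
    ((hasPartials_sub.pow 2).div (hasPartials_add.pow 2) hu2)).congr ?_ ?_
  all_goals
    rw [← T₄]
    match_scalars <;> field_simp <;> ring

theorem contDiffOn_T₄ (hU : ∀ p ∈ U, p.1 + p.2 ≠ 0) : ContDiffOn 𝕜 ∞ (T₄ (𝕜 := 𝕜)) U := by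
  have h0 : ∀ p ∈ U, (p.1 + p.2) ^ 2 ≠ 0 := fun p hp => pow_ne_zero 2 (hU p hp)
  unfold T₄
  fun_prop (disch := assumption)

theorem pd_pd_comp_T₄ {F : 𝕜 × 𝕜 → E} (hV : IsOpen V) (hF : ContDiffOn 𝕜 ∞ F V)
    (hU : IsOpen U) (hUV : Set.MapsTo T₄ U V) (h0 : ∀ p ∈ U, p.1 + p.2 ≠ 0) (hp : p ∈ U) :
    pd₁ (pd₁ fun p => F (T₄ p)) p
        = (4 / (p.1 + p.2) ^ 6) • pd₁ (pd₁ F) (T₄ p)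
          - (16 * p.2 * (p.1 - p.2) / (p.1 + p.2) ^ 6) • pd₂ (pd₁ F) (T₄ p)
          + (16 * p.2 ^ 2 * (p.1 - p.2) ^ 2 / (p.1 + p.2) ^ 6) • pd₂ (pd₂ F) (T₄ p)
          + (6 / (p.1 + p.2) ^ 4) • pd₁ F (T₄ p)
          + (8 * p.2 * (2 * p.2 - p.1) / (p.1 + p.2) ^ 4) • pd₂ F (T₄ p) ∧
      pd₂ (pd₁ fun p => F (T₄ p)) p
        = (4 / (p.1 + p.2) ^ 6) • pd₁ (pd₁ F) (T₄ p)
          + (8 * (p.1 - p.2) ^ 2 / (p.1 + p.2) ^ 6) • pd₂ (pd₁ F) (T₄ p)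
          - (16 * p.1 * p.2 * (p.1 - p.2) ^ 2 / (p.1 + p.2) ^ 6) • pd₂ (pd₂ F) (T₄ p)
          + (6 / (p.1 + p.2) ^ 4) • pd₁ F (T₄ p)
          + (4 * (p.1 ^ 2 - 4 * p.1 * p.2 + p.2 ^ 2) / (p.1 + p.2) ^ 4) • pd₂ F (T₄ p) ∧
      pd₂ (pd₂ fun p => F (T₄ p)) p
        = (4 / (p.1 + p.2) ^ 6) • pd₁ (pd₁ F) (T₄ p)
          + (16 * p.1 * (p.1 - p.2) / (p.1 + p.2) ^ 6) • pd₂ (pd₁ F) (T₄ p)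
          + (16 * p.1 ^ 2 * (p.1 - p.2) ^ 2 / (p.1 + p.2) ^ 6) • pd₂ (pd₂ F) (T₄ p)
          + (6 / (p.1 + p.2) ^ 4) • pd₁ F (T₄ p)
          + (8 * p.1 * (2 * p.1 - p.2) / (p.1 + p.2) ^ 4) • pd₂ F (T₄ p) := by
  have hu := h0 p hp
  have hw {p} (hp : p ∈ U) := hasPartials_comp_T₄ hV hF (hUV hp) (h0 p hp)
  have hFx := hasPartials_comp_T₄ hV (contDiffOn_pd₁ hV hF) (hUV hp) hu
  have hFy := hasPartials_comp_T₄ hV (contDiffOn_pd₂ hV hF) (hUV hp) hu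
  have hinv (c : 𝕜) := (hasPartials_add (p := p)).const_div_pow hu c 3
  have hw₁ := (((hinv (-2)).smul hFx).add
    (((hinv 4).mul (hasPartials_sub.mul .coord₂)).smul hFy)).congr_of_eqOn
    hU hp (g := pd₁ fun p => F (T₄ p)) fun p hp => by
      refine Eq.trans ?_ (hw hp).fst.symm
      match_scalars <;> ring
  have hw₂ := (((hinv (-2)).smul hFx).add
    (((hinv (-4)).mul (hasPartials_sub.mul .coord₁)).smul hFy)).congr_of_eqOn
    hU hp (g := pd₂ fun p => F (T₄ p)) fun p hp => by
      refine Eq.trans ?_ (hw hp).snd.symm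
      match_scalars <;> ring
  refine ⟨hw₁.fst.trans ?_, hw₁.snd.trans ?_, hw₂.snd.trans ?_⟩
  all_goals
    rw [pd₁_pd₂_comm hV hF (hUV hp)]
    match_scalars <;> field_simp <;> ring

namespace SolvesAppellF₄

section
variable {F : 𝕜 × 𝕜 → E} (h : SolvesAppellF₄ α β γ₁ γ₂ V F) (hV : IsOpen V)
  (hF : ContDiffOn 𝕜 ∞ F V) (hU : IsOpen U) (hUV : Set.MapsTo T₄ U V)
  (hreg : ∀ p ∈ U, IsRegularST₄ p)

include h hV hF hU hUV hreg

theorem hyperbolic_comp_T₄ (hp : p ∈ U) :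
    pd₂ (pd₁ fun p => F (T₄ p)) p + (coeffsF₄ α β γ₁ γ₂).a p • pd₁ (fun p => F (T₄ p)) p
      + (coeffsF₄ α β γ₁ γ₂).b p • pd₂ (fun p => F (T₄ p)) p
      + (coeffsF₄ α β γ₁ γ₂).c p • F (T₄ p) = 0 := by
  have hxx := h.transversalF₄_eq hV hF (hUV hp)
  have hxy := h.mul_smul_pd₂_pd₁ (hUV hp)
  have hw := hasPartials_comp_T₄ hV hF (hUV hp) (hreg p hp).add_ne_zero
  rw [(pd_pd_comp_T₄ hV hF hU hUV (fun p hp => (hreg p hp).add_ne_zero) hp).2.1,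
    show pd₁ _ p = _ from hw.fst, show pd₂ _ p = _ from hw.snd]
  obtain ⟨hu, hv, -, -⟩ := hreg p hp
  simp only [T₄, transversalF₄] at hxx hxy
  simp only [T₄, coeffsF₄]
  linear_combination (norm := skip) (16 * p.1 * p.2 / (p.1 + p.2) ^ 4) • hxx
    + (8 / (p.1 + p.2) ^ 2) • hxy
  match_scalars <;> field_simp <;> ring

theorem second_comp_T₄ (hp : p ∈ U) :
    pd₂ (pd₂ fun p => F (T₄ p)) p + (coeffsF₄ α β γ₁ γ₂).q p • pd₁ (pd₁ fun p => F (T₄ p)) p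
      + (coeffsF₄ α β γ₁ γ₂).m p • pd₁ (fun p => F (T₄ p)) p
      + (coeffsF₄ α β γ₁ γ₂).n p • pd₂ (fun p => F (T₄ p)) p
      + (coeffsF₄ α β γ₁ γ₂).r p • F (T₄ p) = 0 := by
  have hxx := h.transversalF₄_eq hV hF (hUV hp)
  have hxy := h.mul_smul_pd₂_pd₁ (hUV hp)
  have hw := hasPartials_comp_T₄ hV hF (hUV hp) (hreg p hp).add_ne_zero
  obtain ⟨hss, -, htt⟩ := pd_pd_comp_T₄ hV hF hU hUV (fun p hp => (hreg p hp).add_ne_zero) hp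
  rw [hss, htt, show pd₁ _ p = _ from hw.fst, show pd₂ _ p = _ from hw.snd]
  obtain ⟨hu, hv, -, ht⟩ := hreg p hp
  have ht' : p.2 ^ 2 * 4 - 1 ≠ 0 := by rwa [mul_comm]
  simp only [T₄, transversalF₄] at hxx hxy
  simp only [T₄, coeffsF₄]
  linear_combination (norm := skip)
    (-16 * (p.1 ^ 2 * (4 * p.2 ^ 2 - 1) + (4 * p.1 ^ 2 - 1) * p.2 ^ 2)
      / ((4 * p.2 ^ 2 - 1) * (p.1 + p.2) ^ 4)) • hxx
    + (16 * (4 * p.1 * p.2 + 1) * (p.2 - p.1)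
      / ((4 * p.2 ^ 2 - 1) * ((p.1 - p.2) * (p.1 + p.2) ^ 2))) • hxy
  match_scalars <;> field_simp <;> ring

theorem solvesConjugate : SolvesConjugate (coeffsF₄ α β γ₁ γ₂) U fun p => F (T₄ p) where
  isOpen := hU
  smooth := hF.comp (contDiffOn_T₄ fun p hp => (hreg p hp).add_ne_zero) hUV
  hyperbolic _ := h.hyperbolic_comp_T₄ hV hF hU hUV hreg
  second _ := h.second_comp_T₄ hV hF hU hUV hreg

end

theorem linearIndependent_jet_T₄ {F : 𝕜 × 𝕜 → (Fin 4 → 𝕜)} (h : SolvesAppellF₄ α β γ₁ γ₂ V F)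
    (hV : IsOpen V) (hF : ContDiffOn 𝕜 ∞ F V) (hU : IsOpen U) (hUV : Set.MapsTo T₄ U V)
    (hreg : ∀ p ∈ U, IsRegularST₄ p)
    (hi : LinearIndependent 𝕜 fun i => frameF₄ γ₁ F i (T₄ p)) (hp : p ∈ U) :
    LinearIndependent 𝕜 ![F (T₄ p), pd₁ (fun p => F (T₄ p)) p, pd₂ (fun p => F (T₄ p)) p,
      pd₁ (pd₁ fun p => F (T₄ p)) p] := by
  refine linearIndependent_of_dotProduct_eq_zero fun x hx =>
    eq_zero_of_dotProduct_eq_zero hi ?_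
  have hw := hasPartials_comp_T₄ hV hF (hUV hp) (hreg p hp).add_ne_zero
  have hxx := congrArg (· ⬝ᵥ x) (h.transversalF₄_eq hV hF (hUV hp))
  have hxy := congrArg (· ⬝ᵥ x) (h.mul_smul_pd₂_pd₁ (hUV hp))
  have h0 : F (T₄ p) ⬝ᵥ x = 0 := hx 0
  have hs : pd₁ _ p ⬝ᵥ x = 0 := hx 1
  have ht : pd₂ _ p ⬝ᵥ x = 0 := hx 2
  have hss : pd₁ _ p ⬝ᵥ x = 0 := hx 3
  rw [show pd₁ _ p = _ from hw.fst] at hs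
  rw [show pd₂ _ p = _ from hw.snd] at ht
  rw [(pd_pd_comp_T₄ hV hF hU hUV (fun p hp => (hreg p hp).add_ne_zero) hp).1] at hss
  simp only [transversalF₄, add_dotProduct, sub_dotProduct, smul_dotProduct, smul_eq_mul]
    at hs ht hss hxx hxy
  obtain ⟨hu, hv, -, ht0⟩ := hreg p hp
  have hFy : pd₂ F (T₄ p) ⬝ᵥ x = 0 := by
    field_simp at hs ht
    refine (mul_eq_zero.1 ?_).resolve_left (mul_ne_zero hu hv)
    linear_combination (hs - ht) / 4
  have hFx : pd₁ F (T₄ p) ⬝ᵥ x = 0 := by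
    simpa [hFy, hu] using hs
  have hFxx : pd₁ (pd₁ F) (T₄ p) ⬝ᵥ x = 0 := by
    have hT₁ : (T₄ p).1 = 1 / (p.1 + p.2) ^ 2 := rfl
    have hT₂ : (T₄ p).2 = (p.1 - p.2) ^ 2 / (p.1 + p.2) ^ 2 := rfl
    simp only [h0, hFx, hFy, hT₁, hT₂, mul_zero, add_zero, sub_zero] at hss hxx hxy
    field_simp at hss hxx hxy
    refine (mul_eq_zero.1 ?_).resolve_left (mul_ne_zero hu ht0)
    linear_combination -(p.1 - p.2) / 4 * hss - 4 * p.2 ^ 2 * (p.1 - p.2) * hxx - 2 * p.2 * hxy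
  simp [Fin.forall_fin_succ, frameF₄, transversalF₄, h0, hFx, hFy, hFxx]

end SolvesAppellF₄

theorem SolvesConjugate.isConjugateSystem_coeffsF₄ {w : 𝕜 × 𝕜 → (Fin 4 → 𝕜)}
    (h : SolvesConjugate (coeffsF₄ α β γ₁ γ₂) U w) (hreg : ∀ p ∈ U, IsRegularST₄ p)
    (hframe : ∀ p ∈ U, LinearIndependent 𝕜 ![w p, pd₁ w p, pd₂ w p, pd₁ (pd₁ w) p]) :
    IsConjugateSystem U w (coeffsF₄ α β γ₁ γ₂) := by
  have hu : ∀ p ∈ U, p.1 + p.2 ≠ 0 := fun p hp => (hreg p hp).add_ne_zero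
  have hu2 : ∀ p ∈ U, (p.1 + p.2) ^ 2 ≠ 0 := fun p hp => pow_ne_zero 2 (hu p hp)
  have hv : ∀ p ∈ U, p.1 - p.2 ≠ 0 := fun p hp => (hreg p hp).sub_ne_zero
  have ht : ∀ p ∈ U, 4 * p.2 ^ 2 - 1 ≠ 0 := fun p hp => (hreg p hp).snd_ne
  refine ⟨?_, ?_, ?_, ?_, ?_, ?_, ?_, fun p hp => div_ne_zero (hreg p hp).fst_ne (ht p hp),
    hframe, h.hyperbolic, h.second⟩
  all_goals
    simp only [coeffsF₄]
    fun_prop (disch := assumption)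

end ConjugateF₄

section SurfaceF₄

variable {𝕜 : Type*} [RCLike 𝕜] {α β γ₁ γ₂ : 𝕜} {U V : Set (𝕜 × 𝕜)} {p : 𝕜 × 𝕜}

theorem isIsothermallyConjugate_coeffsF₄ (hreg : ∀ p ∈ U, IsRegularST₄ p) :
    IsIsothermallyConjugate U (coeffsF₄ α β γ₁ γ₂).q :=
  .of_separable (φ := fun x => 4 * x ^ 2 - 1) (ψ := fun x => 4 * x ^ 2 - 1) (by fun_prop)
    (by fun_prop) (fun p hp => (hreg p hp).fst_ne) (fun p hp => (hreg p hp).snd_ne)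

theorem h_coeffsF₄ (hp : IsRegularST₄ p) :
    (coeffsF₄ α β γ₁ γ₂).h p = ((α - β) ^ 2 - 1 / 4) / (p.1 + p.2) ^ 2
      + (1 / 4 - (γ₂ - 1) ^ 2) / (p.1 - p.2) ^ 2 := by
  obtain ⟨hu, hv, -, -⟩ := hp
  have ha := ((HasDirDerivs.const (1 / 2 - α - β)).div hasPartials_add hu).sub
    ((HasDirDerivs.const (γ₂ - 1 / 2)).div hasPartials_sub hv)
  rw [ConjugateCoeffs.h, show pd₁ (coeffsF₄ α β γ₁ γ₂).a p = _ from ha.fst]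
  simp only [coeffsF₄]
  field_simp
  ring

theorem k_coeffsF₄ (hp : IsRegularST₄ p) :
    (coeffsF₄ α β γ₁ γ₂).k p = ((α - β) ^ 2 - 1 / 4) / (p.1 + p.2) ^ 2
      + (1 / 4 - (γ₂ - 1) ^ 2) / (p.1 - p.2) ^ 2 := by
  obtain ⟨hu, hv, -, -⟩ := hp
  have hb := ((HasDirDerivs.const (1 / 2 - α - β)).div hasPartials_add hu).add
    ((HasDirDerivs.const (γ₂ - 1 / 2)).div hasPartials_sub hv)
  rw [ConjugateCoeffs.k, show pd₂ (coeffsF₄ α β γ₁ γ₂).b p = _ from hb.snd]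
  simp only [coeffsF₄]
  field_simp
  ring

namespace IsConjugateSystem

variable {w : 𝕜 × 𝕜 → (Fin 4 → 𝕜)} (h : IsConjugateSystem U w (coeffsF₄ α β γ₁ γ₂))
  (hU : IsOpen U) (hreg : ∀ p ∈ U, IsRegularST₄ p) (hw : ContDiffOn 𝕜 ∞ w U)

include h hU hreg hw

theorem h_eq_zero_F₄ (hQ : PosFocalQuadrics U w (coeffsF₄ α β γ₁ γ₂)) (hp : p ∈ U) :
    (coeffsF₄ α β γ₁ γ₂).h p = 0 :=
  eq_zero_of_log_sum_inv_sq hU (fun p hp => (hreg p hp).add_ne_zero)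
    (fun p hp => (hreg p hp).sub_ne_zero) (fun p hp => h_coeffsF₄ (hreg p hp))
    (fun _ => h.pd₂_pd₁_h_mul_h hU hw (isIsothermallyConjugate_coeffsF₄ hreg) hQ) hp

theorem k_eq_zero_F₄ (hQ : NegFocalQuadrics U w (coeffsF₄ α β γ₁ γ₂)) (hp : p ∈ U) :
    (coeffsF₄ α β γ₁ γ₂).k p = 0 :=
  eq_zero_of_log_sum_inv_sq hU (fun p hp => (hreg p hp).add_ne_zero)
    (fun p hp => (hreg p hp).sub_ne_zero) (fun p hp => k_coeffsF₄ (hreg p hp))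
    (fun _ => h.pd₂_pd₁_k_mul_k hU hw (isIsothermallyConjugate_coeffsF₄ hreg) hQ) hp

end IsConjugateSystem

namespace IsSurfaceF₄

variable {F : 𝕜 × 𝕜 → (Fin 4 → 𝕜)} (h : IsSurfaceF₄ α β γ₁ γ₂ V F)

include h

theorem isTotalSystem :
    IsTotalSystem V (totalP₄ α β γ₁ γ₂) (totalQ₄ α β γ₁ γ₂) (frameF₄ γ₁ F) :=
  h.2.isTotalSystem_F₄ h.1.isOpen h.1.smooth h.1.subset_regular

theorem linearIndependent_frameF₄ (hp : p ∈ V) :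
    LinearIndependent 𝕜 fun i => frameF₄ γ₁ F i p :=
  h.isTotalSystem.linearIndependent (i₀ := 0) h.1.isOpen h.1.isConnected.isPreconnected
    h.1.independent hp

theorem γ₂_eq_of_isQuadricOn (hQ : IsQuadricOn V F) : γ₂ = α + β - γ₁ + 1 := by
  obtain ⟨M, hM, hMdet, hMF⟩ := hQ
  obtain ⟨p, hp⟩ := h.1.isConnected.nonempty
  have hi := h.linearIndependent_frameF₄ hp
  have hK (q) (hq : q ∈ V) := hasPartials_entry (h.isTotalSystem.hasPartials_gram M hq)
  have hsymm (q) : (Matrix.of fun i j => form M (frameF₄ γ₁ F i q) (frameF₄ γ₁ F j q)).IsSymm :=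
    Matrix.IsSymm.ext fun i j => form_comm hM _ _
  have h00 (q) (hq : q ∈ V) : form M (F q) (F q) = 0 := (form_apply ..).trans (hMF q hq)
  have h03 : form M (F p) (frameF₄ γ₁ F 3 p) ≠ 0 := fun h03 => hi.ne_zero 0 <| by
    obtain ⟨h01, h02⟩ := gram_fst_snd_eq_zero_F₄ h.1.isOpen h.1.subset_regular hK hsymm h00 hp
    refine eq_zero_of_form_eq_zero hMdet hi fun i => ?_
    rw [form_comm hM]
    fin_cases i
    exacts [h00 p hp, h01, h02, h03]
  have hγ := (mul_eq_zero.1 (mul_gram_eq_zero_F₄ h.1.isOpen h.1.subset_regular hK hsymm h00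
    hp)).resolve_right h03
  linear_combination hγ

theorem isQuadricOn_of_γ₂_eq (hγ : γ₂ = α + β - γ₁ + 1) : IsQuadricOn V F := by
  obtain ⟨p, hp⟩ := h.1.isConnected.nonempty
  exact h.isTotalSystem.isQuadricOn h.1.isOpen h.1.isConnected.isPreconnected hp
    (h.linearIndependent_frameF₄ hp) (isSymm_adaptedGram ..)
    (det_gramF₄_ne_zero (h.1.subset_regular hp).2.2) (fun _ _ => rfl) (fun _ _ => rfl)
    fun _ hq => hasPartials_gramF₄ hγ (h.1.subset_regular hq)

theorem isQuadricOn_iff : IsQuadricOn V F ↔ γ₂ = α + β - γ₁ + 1 :=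
  ⟨h.γ₂_eq_of_isQuadricOn, h.isQuadricOn_of_γ₂_eq⟩

theorem isRegularST₄ (hp : T₄ p ∈ V) : IsRegularST₄ p :=
  isRegularST₄_of_T₄_mem (h.1.subset_regular hp)

theorem solvesConjugate (hU : IsOpen U) (hUV : Set.MapsTo T₄ U V) :
    SolvesConjugate (coeffsF₄ α β γ₁ γ₂) U fun p => F (T₄ p) :=
  h.2.solvesConjugate h.1.isOpen h.1.smooth hU hUV fun _ hp => h.isRegularST₄ (hUV hp)

theorem isConjugateSystem (hU : IsOpen U) (hUV : Set.MapsTo T₄ U V) :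
    IsConjugateSystem U (fun p => F (T₄ p)) (coeffsF₄ α β γ₁ γ₂) :=
  (h.solvesConjugate hU hUV).isConjugateSystem_coeffsF₄ (fun _ hp => h.isRegularST₄ (hUV hp))
    fun _ hp => h.2.linearIndependent_jet_T₄ h.1.isOpen h.1.smooth hU hUV
      (fun _ hp => h.isRegularST₄ (hUV hp)) (h.linearIndependent_frameF₄ (hUV hp)) hp

variable {z : 𝕜 × 𝕜 → (Fin 4 → 𝕜)} {C : ConjugateCoeffs 𝕜} (hg : IsGaugedPullback T₄ V F U z)

include hg

theorem exists_isConjugateSystem : ∃ C, IsConjugateSystem U z C :=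
  hg.exists_isConjugateSystem (h.solvesConjugate hg.isOpen hg.mapsTo).smooth
    (h.isConjugateSystem hg.isOpen hg.mapsTo)

theorem h_eq_zero (hC : IsConjugateSystem U z C) (hQ : PosFocalQuadrics U z C) (hp : p ∈ U) :
    C.h p = 0 := by
  have hw := (h.solvesConjugate hg.isOpen hg.mapsTo).smooth
  have hF := h.isConjugateSystem hg.isOpen hg.mapsTo
  exact hg.h_eq_zero hw hF (fun hQ _ => hF.h_eq_zero_F₄ hg.isOpen
    (fun _ hp => h.isRegularST₄ (hg.mapsTo hp)) hw hQ) hC hQ hp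

theorem k_eq_zero (hC : IsConjugateSystem U z C) (hQ : NegFocalQuadrics U z C) (hp : p ∈ U) :
    C.k p = 0 := by
  have hw := (h.solvesConjugate hg.isOpen hg.mapsTo).smooth
  have hF := h.isConjugateSystem hg.isOpen hg.mapsTo
  exact hg.k_eq_zero hw hF (fun hQ _ => hF.k_eq_zero_F₄ hg.isOpen
    (fun _ hp => h.isRegularST₄ (hg.mapsTo hp)) hw hQ) hC hQ hp

end IsSurfaceF₄

end SurfaceF₄

end HypergeometricCongruence

theorem mainTheorem11 {𝕜 : Type*} [RCLike 𝕜] :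
    (∀ (α β₁ β₂ γ₁ γ₂ : 𝕜) (V : Set (𝕜 × 𝕜)) (F : 𝕜 × 𝕜 → (Fin 4 → 𝕜)),
      IsSurfaceF₂ α β₁ β₂ γ₁ γ₂ V F →
        (IsQuadricOn V F ↔ α = β₁ + β₂ - 1 / 2 ∧ γ₁ = 2 * β₁ ∧ γ₂ = 2 * β₂) ∧
        ∀ (U : Set (𝕜 × 𝕜)) (z : 𝕜 × 𝕜 → (Fin 4 → 𝕜)), IsGaugedPullback T₂ V F U z →
          (∃ C, IsConjugateSystem U z C) ∧
          ∀ C, IsConjugateSystem U z C →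
            (PosFocalQuadrics U z C → ∀ p ∈ U, C.h p = 0) ∧
            (NegFocalQuadrics U z C → ∀ p ∈ U, C.k p = 0)) ∧
    (∀ (α β γ₁ γ₂ : 𝕜) (V : Set (𝕜 × 𝕜)) (F : 𝕜 × 𝕜 → (Fin 4 → 𝕜)),
      IsSurfaceF₄ α β γ₁ γ₂ V F →
        (IsQuadricOn V F ↔ γ₂ = α + β - γ₁ + 1) ∧
        ∀ (U : Set (𝕜 × 𝕜)) (z : 𝕜 × 𝕜 → (Fin 4 → 𝕜)), IsGaugedPullback T₄ V F U z →
          (∃ C, IsConjugateSystem U z C) ∧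
          ∀ C, IsConjugateSystem U z C →
            (PosFocalQuadrics U z C → ∀ p ∈ U, C.h p = 0) ∧
            (NegFocalQuadrics U z C → ∀ p ∈ U, C.k p = 0)) := by
  refine ⟨fun _ _ _ _ _ _ _ h => ⟨h.isQuadricOn_iff, fun _ _ hg =>
      ⟨h.exists_isConjugateSystem hg, fun _ hC => ⟨fun hQ _ => h.h_eq_zero hg hC hQ,
        fun hQ _ => h.k_eq_zero hg hC hQ⟩⟩⟩,
    fun _ _ _ _ _ _ h => ⟨h.isQuadricOn_iff, fun _ _ hg =>
      ⟨h.exists_isConjugateSystem hg, fun _ hC => ⟨fun hQ _ => h.h_eq_zero hg hC hQ,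
        fun hQ _ => h.k_eq_zero hg hC hQ⟩⟩⟩⟩
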